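/- Let $\|\cdot\|$ be a strictly convex norm on $\mathbb{R}^d$, let $|\cdot|$ be the Euclidean norm, and assume (UA): either $d=2$, or $d\ge 2$ and $\|\cdot\|=|\cdot|$. Let $p>1$. There is a function $C(\cdot,\cdot)$ with finite nonnegative values (depending only on $d$, $\|\cdot\|$ and $p$) such that the following holds. Let $\Omega\subset\mathbb{R}^d$ be compact and convex with nonempty interior, and let $\kappa>0$ be such that all curvatures of $\partial\Omega$ are at least $\kappa$, that is, for every $x\in\partial\Omega$ and every inward unit normal $n$ at $x$ (a unit vector $n$ with $(y-x)\cdot n\ge 0$ for all $y\in\Omega$), $$\liminf_{y\to x,\ y\in\partial\Omega,\ y\neq x}\frac{2\,(y-x)\cdot n}{|y-x|^2}\ \ge\ \kappa$$ (for $\partial\Omega$ of class $C^2$ this says that all principal curvatures are at least $\kappa$). Let $0\le f^+\in L^p(\partial\Omega)$ with respect to $\mathcal{H}^{d-1}$, identify $f^+$ with the measure $f^+\,\mathcal{H}^{d-1}$ on $\partial\Omega$, and let $f^-$ be a positive Borel measure concentrated on $\partial\Omega$, with the same total mass as $f^+$, such that $f^+$ and $f^-$ are mutually singular. If $p>2$,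 assume also that $$\int_{\partial\Omega} f^+(x)^p\,\mathrm{d}(x,\operatorname{spt} f^-)^{2-p}\,d\mathcal{H}^{d-1}(x)<+\infty .$$ Then there is a unique plan $\gamma$ minimizing $\int\|x-y\|\,d\gamma(x,y)$ among the positive measures with marginals $f^+$ and $f^-$, and it is induced by a Borel map $T$, i.e. $\gamma=(\mathrm{id},T)_\# f^+$. For $0\le\tau\le 1$ set $$\sigma^{(\tau)}=\int_0^\tau f_t\,dt,\qquad f_t=(\Pi_t)_\#\big(\|x-y\|\,\gamma\big),\qquad \Pi_t(x,y)=(1-t)x+ty .$$ Then for every $\tau\in[0,1]$ the measure $\sigma^{(\tau)}$ is absolutely continuous with respect to Lebesgue measure, and its density, still denoted $\sigma^{(\tau)}$, satisfies $$\int_\Omega |\sigma^{(\tau)}|^p\,dx\ \le\ C(\kappa,\operatorname{diam}\Omega)\left(\int_0^\tau\frac{dt}{(1-t)^{(d-1)(p-1)}}\right)\int_{\partial\Omega} f^+(x)^p\,|x-T(x)|^{2-p}\,d\mathcal{H}^{d-1}(x),$$ where the integrals take values in $[0,+\infty]$ and $0\cdot\infty=0$. -/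

import Mathlib

open Set Filter Topology MeasureTheory
open scoped ENNReal NNReal RealInnerProductSpace

noncomputable section

namespace BoundaryTransport

/-- Euclidean space of dimension `d`; `‖·‖` is the Euclidean norm. -/
abbrev Space (d : ℕ) := EuclideanSpace ℝ (Fin d)

/-- `N` is a strictly convex norm: it vanishes only at the origin and its closed unit ball is a
strictly convex set. -/
structure IsStrictlyConvexNorm {d : ℕ} (N : Seminorm ℝ (Space d)) : Prop where
  eq_zero : ∀ v, N v = 0 → v = 0
  strictConvex : StrictConvex ℝ (N.closedBall 0 1)

/-- The uniqueness assumption: either the dimension is two, or the dimension is at least two and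
the norm is the Euclidean one. -/
def UniquenessAssumption {d : ℕ} (N : Seminorm ℝ (Space d)) : Prop :=
  d = 2 ∨ (2 ≤ d ∧ ∀ v, N v = ‖v‖)

/-- `n` is an inward unit normal to the convex set `Ω` at the point `x`. -/
def IsInwardNormal {d : ℕ} (Ω : Set (Space d)) (x n : Space d) : Prop :=
  ‖n‖ = 1 ∧ ∀ y ∈ Ω, 0 ≤ ⟪y - x, n⟫

/-- All curvatures of the boundary of `Ω` are at least `κ`: at every boundary point `x`, with inward
unit normal `n`, the limit inferior of `2 ⟪y - x, n⟫ / ‖y - x‖ ^ 2` as the boundary point `y` tends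
to `x` is at least `κ`. Where the boundary is of class `C^2` there is one inward unit normal, and
this limit inferior is the smallest principal curvature at `x`. -/
def CurvaturesGE {d : ℕ} (Ω : Set (Space d)) (κ : ℝ) : Prop :=
  ∀ x ∈ frontier Ω, ∀ n, IsInwardNormal Ω x n →
    ∀ k < κ, ∀ᶠ y in 𝓝[frontier Ω] x, k / 2 * ‖y - x‖ ^ 2 ≤ ⟪y - x, n⟫

/-- `Ω` is a compact convex domain (the closure of a nonempty bounded convex open set) that is
uniformly convex, with all curvatures of its boundary at least `κ > 0`. -/
structure IsUniformlyConvexDomain {d : ℕ} (Ω : Set (Space d)) (κ : ℝ) : Prop where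
  isCompact : IsCompact Ω
  convex : Convex ℝ Ω
  nonempty_interior : (interior Ω).Nonempty
  pos : 0 < κ
  curvatures_ge : CurvaturesGE Ω κ

/-- The surface measure on the boundary of `Ω`: the `(d-1)`-dimensional Hausdorff measure (normalized
so as to agree with Lebesgue measure on hyperplanes) restricted to the boundary. -/
def surfaceMeasure {d : ℕ} (Ω : Set (Space d)) : Measure (Space d) :=
  (Measure.euclideanHausdorffMeasure (d - 1)).restrict (frontier Ω)

/-- The measure on the boundary of `Ω` with density `f` with respect to the surface measure. -/
def boundaryMeasure {d : ℕ} (Ω : Set (Space d)) (f : Space d → ℝ) : Measure (Space d) :=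
  (surfaceMeasure Ω).withDensity fun x => ENNReal.ofReal (f x)

/-- `γ` is a transport plan from `μ` to `ν`. -/
def IsTransportPlan {d : ℕ} (μ ν : Measure (Space d)) (γ : Measure (Space d × Space d)) : Prop :=
  γ.map Prod.fst = μ ∧ γ.map Prod.snd = ν

/-- The cost of a transport plan, for the cost function `N (x - y)`. -/
def transportCost {d : ℕ} (N : Seminorm ℝ (Space d)) (γ : Measure (Space d × Space d)) : ℝ≥0∞ :=
  ∫⁻ z, ENNReal.ofReal (N (z.1 - z.2)) ∂γ

/-- `γ` is an optimal transport plan from `μ` to `ν`, for the cost function `N (x - y)`. -/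
def IsOptimalPlan {d : ℕ} (N : Seminorm ℝ (Space d)) (μ ν : Measure (Space d))
    (γ : Measure (Space d × Space d)) : Prop :=
  IsTransportPlan μ ν γ ∧
    ∀ γ', IsTransportPlan μ ν γ' → transportCost N γ ≤ transportCost N γ'

/-- The measure `f_t`, the image of `N (x - y) • γ` under `(x, y) ↦ (1 - t) x + t y`. -/
def interpolatedMeasure {d : ℕ} (N : Seminorm ℝ (Space d)) (γ : Measure (Space d × Space d))
    (t : ℝ) : Measure (Space d) :=
  (γ.withDensity fun z => ENNReal.ofReal (N (z.1 - z.2))).map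
    fun z => (1 - t) • z.1 + t • z.2

/-- The partial transport density `σ^{(τ)} = ∫_0^τ f_t dt`, a measure. -/
def partialTransportDensity {d : ℕ} (N : Seminorm ℝ (Space d))
    (γ : Measure (Space d × Space d)) (τ : ℝ) : Measure (Space d) :=
  (volume.restrict (Ioc 0 τ)).bind (interpolatedMeasure N γ)

theorem measurable_interpolatedMeasure {d : ℕ} (N : Seminorm ℝ (Space d))
    (γ : Measure (Space d × Space d)) [SFinite γ] : Measurable (interpolatedMeasure N γ) := by
  refine Measure.measurable_of_measurable_coe _ fun s hs => ?_
  have hm : Measurable fun p : ℝ × (Space d × Space d) => (1 - p.1) • p.2.1 + p.1 • p.2.2 := by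
    fun_prop
  have h : ∀ t, interpolatedMeasure N γ t s
      = (γ.withDensity fun z => ENNReal.ofReal (N (z.1 - z.2)))
        (Prod.mk t ⁻¹' ((fun p : ℝ × (Space d × Space d) =>
          (1 - p.1) • p.2.1 + p.1 • p.2.2) ⁻¹' s)) := by
    intro t
    rw [interpolatedMeasure, Measure.map_apply (by fun_prop) hs]
    rfl
  simp_rw [h]
  exact measurable_measure_prodMk_left (hm hs)

/-- The partial transport density is what the integral `∫_0^τ f_t dt` says on every Borel set. -/
theorem partialTransportDensity_apply {d : ℕ} (N : Seminorm ℝ (Space d))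
    (γ : Measure (Space d × Space d)) [SFinite γ] (τ : ℝ) {s : Set (Space d)}
    (hs : MeasurableSet s) :
    partialTransportDensity N γ τ s = ∫⁻ t in Ioc 0 τ, interpolatedMeasure N γ t s :=
  Measure.bind_apply hs (measurable_interpolatedMeasure N γ).aemeasurable

end BoundaryTransport

end

/-!
The proof rests on one inequality. Let `S` be the surface measure, let `T` be the optimal map, and
let `F (x, s) = (1 - s) x + s T(x)`. Then the image under `F` of the measure
`(1 - s) ^ (d - 1) |x - T(x)| ^ 2 dS(x) ds` is at most a constant times Lebesgue measure
(`coneMeasure_contactMap_le`). The transport segments do not cross, so `F` is injective, and the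
partial transport density is the image under `F` of a measure with an explicit density `g` with
respect to the one above. Its own density is thus the product of a bounded function and of `g ∘ F⁻¹`,
and the estimate is the integral of `g ^ p`
(`lintegral_rnDeriv_map_withDensity_rpow_le`, `partialTransportDensity_estimate`).

When `T` is constant, equal to a boundary point `y`, the inequality is a computation in polar
coordinates about a centre of `Ω`, by Eilenberg's inequality (which compares the surface measure
with volume), the theorem of Rademacher (for the gauge of `Ω`) and the change of variables formula
(`coneMeasure_const_le`). The Jacobian contains the height of `y` above the supporting hyperplane at
`x`. Uniform convexity bounds it from below by a multiple of `|x - y| ^ 2` (`norm_sq_le`), and this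
is where the curvature enters; the multiple depends only on `κ` and on the diameter, because a ball
whose radius depends only on these lies inside `Ω` (`exists_ball_subset`).

For maps with finitely many values `y`, chosen so as to minimize costs `N (x - y) + w y`, the cones
over the different values are disjoint, so that the constant does not change
(`coneMeasure_finite_le`). The optimal map is a limit of such maps: Kantorovich duality provides a
potential `w`, and `T(x)` minimizes `N (x - y) + w y` over the boundary points `y` away from `x`
(`tendsto_costArgmin`).

The plan provided by duality is concentrated on the pairs with `w x - w y = N (x - y)`, and so is
every optimal plan (`IsBoundaryPotential.isOptimalPlan`); mutual singularity keeps it off the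
diagonal. For almost every `x` there is at most one such `y ≠ x`
(`euclideanHausdorffMeasure_branchSet`): where the potential is differentiable along the boundary,
strict convexity of the norm determines the direction of `y - x` among those that point into `Ω`,
and the ray from `x` in this direction meets the boundary in one further point. Hence the optimal
plan is unique and is induced by a Borel map (`exists_optimal_contactMap`). This works for every
strictly convex norm in any dimension at least two.
-/

namespace BoundaryTransport

/-! ### Hausdorff measure and level sets of Lipschitz functions -/

section

/-- Any set has, at every scale, a countable cover that almost realizes its Hausdorff measure. -/
theorem exists_cover_tsum_le {X : Type*} [EMetricSpace X] [MeasurableSpace X] [BorelSpace X]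
    (e : ℝ) (s : Set X) (hs : μH[e] s ≠ ∞) {r ε : ℝ≥0∞} (hr : 0 < r) (hε : ε ≠ 0) :
    ∃ t : ℕ → Set X, s ⊆ ⋃ n, t n ∧ (∀ n, Metric.ediam (t n) ≤ r) ∧
      ∑' n, ⨆ _ : (t n).Nonempty, Metric.ediam (t n) ^ e ≤ μH[e] s + ε := by
  have h : (⨅ (t : ℕ → Set X) (_ : s ⊆ ⋃ n, t n) (_ : ∀ n, Metric.ediam (t n) ≤ r),
      ∑' n, ⨆ _ : (t n).Nonempty, Metric.ediam (t n) ^ e) < μH[e] s + ε := by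
    refine lt_of_le_of_lt ?_ (ENNReal.lt_add_right hs hε)
    rw [Measure.hausdorffMeasure_apply]
    exact le_iSup₂_of_le (f := fun (r : ℝ≥0∞) (_ : 0 < r) =>
      ⨅ (t : ℕ → Set X) (_ : s ⊆ ⋃ n, t n) (_ : ∀ n, Metric.ediam (t n) ≤ r),
          ∑' n, ⨆ _ : (t n).Nonempty, Metric.ediam (t n) ^ e) r hr le_rfl
  simp only [iInf_lt_iff] at h
  obtain ⟨t, h1, h2, h3⟩ := h
  exact ⟨t, h1, h2, h3.le⟩

/-- **Eilenberg's inequality** for a real-valued Lipschitz function: the Hausdorff measures of the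
level sets integrate to at most the Hausdorff measure in one dimension more. The level sets need not
be measurable in the level, the integral being a lower integral. -/
theorem lintegral_hausdorffMeasure_level_le {X : Type*} [EMetricSpace X] [MeasurableSpace X]
    [BorelSpace X] {e : ℝ} (he : 0 < e) {s : X → ℝ} {K : ℝ≥0} {B : Set X}
    (hs : LipschitzOnWith K s B) (hB : μH[e + 1] B ≠ ∞) :
    ∫⁻ t, μH[e] (B ∩ s ⁻¹' {t}) ≤ K * μH[e + 1] B := by
  have hpos : ∀ k : ℕ, ((k : ℝ≥0∞) + 1)⁻¹ ≠ 0 := fun k => by simp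
  choose T hT1 hT2 hT3 using fun k : ℕ => exists_cover_tsum_le (e + 1) B hB
    (pos_iff_ne_zero.2 (hpos k)) (hpos k)
  have hlim : Tendsto (fun k : ℕ => ((k : ℝ≥0∞) + 1)⁻¹) atTop (𝓝 0) := by
    have := ENNReal.tendsto_inv_nat_nhds_zero.comp (tendsto_add_atTop_nat 1)
    refine this.congr fun k => ?_
    simp
  -- Closures, so that the majorants `h k` of the measures of the level sets are measurable.
  let I : ℕ → ℕ → Set ℝ := fun k n => closure (s '' (B ∩ T k n))
  have hI : ∀ k n, volume (I k n) ≤ K * Metric.ediam (T k n) := fun k n => by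
    refine (Real.volume_le_diam _).trans ?_
    rw [Metric.ediam_closure]
    refine Metric.ediam_image_le_iff.2 fun x hx y hy => ?_
    exact (hs hx.1 hy.1).trans (mul_le_mul_right (Metric.edist_le_ediam_of_mem hx.2 hy.2) _)
  let h : ℕ → ℝ → ℝ≥0∞ := fun k t =>
    ∑' n, (I k n).indicator (fun _ => Metric.ediam (T k n) ^ e) t
  have hm : ∀ k, Measurable (h k) := fun k =>
    Measurable.tsum fun n => measurable_const.indicator isClosed_closure.measurableSet
  have hint : ∀ k, ∫⁻ t, h k t ≤ K * (μH[e + 1] B + ((k : ℝ≥0∞) + 1)⁻¹) := fun k => by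
    rw [lintegral_tsum fun n =>
      (measurable_const.indicator isClosed_closure.measurableSet).aemeasurable]
    refine le_trans ?_ (mul_le_mul_right (hT3 k) _)
    rw [← ENNReal.tsum_mul_left]
    refine ENNReal.tsum_le_tsum fun n => ?_
    rw [lintegral_indicator_const isClosed_closure.measurableSet]
    rcases (T k n).eq_empty_or_nonempty with h0 | h0
    · simp [h0]
    · simp only [h0, ciSup_pos]
      calc Metric.ediam (T k n) ^ e * volume (I k n)
          ≤ Metric.ediam (T k n) ^ e * (K * Metric.ediam (T k n)) := by gcongr; exact hI k n
        _ = K * Metric.ediam (T k n) ^ (e + 1) := by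
          rw [ENNReal.rpow_add_of_nonneg _ _ he.le zero_le_one, ENNReal.rpow_one]; ring
  have hpt : ∀ t, μH[e] (B ∩ s ⁻¹' {t}) ≤ liminf (fun k => h k t) atTop := fun t => by
    refine (Measure.hausdorffMeasure_le_liminf_tsum e (B ∩ s ⁻¹' {t})
      (fun k : ℕ => ((k : ℝ≥0∞) + 1)⁻¹) hlim (fun k n => (B ∩ s ⁻¹' {t}) ∩ T k n) ?_ ?_).trans ?_
    · exact Eventually.of_forall fun k n => (Metric.ediam_mono inter_subset_right).trans (hT2 k n)
    · refine Eventually.of_forall fun k => ?_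
      rw [← inter_iUnion]
      exact subset_inter subset_rfl (inter_subset_left.trans (hT1 k))
    · refine liminf_le_liminf (Eventually.of_forall fun k => ?_)
      refine ENNReal.tsum_le_tsum fun n => ?_
      rcases ((B ∩ s ⁻¹' {t}) ∩ T k n).eq_empty_or_nonempty with h0 | ⟨x, ⟨hx1, hx2⟩, hx3⟩
      · rw [h0, Metric.ediam_empty, ENNReal.zero_rpow_of_pos he]
        exact zero_le
      · have : t ∈ I k n := subset_closure ⟨x, ⟨hx1, hx3⟩, hx2⟩
        rw [indicator_of_mem this]
        gcongr
        exact inter_subset_right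
  calc ∫⁻ t, μH[e] (B ∩ s ⁻¹' {t}) ≤ ∫⁻ t, liminf (fun k => h k t) atTop := lintegral_mono hpt
    _ ≤ liminf (fun k => ∫⁻ t, h k t) atTop := lintegral_liminf_le hm
    _ ≤ liminf (fun k : ℕ => K * (μH[e + 1] B + ((k : ℝ≥0∞) + 1)⁻¹)) atTop :=
      liminf_le_liminf (Eventually.of_forall hint)
    _ = K * μH[e + 1] B := by
      refine Tendsto.liminf_eq ?_
      have := ENNReal.Tendsto.const_mul (a := (K : ℝ≥0∞)) (hlim.const_add (μH[e + 1] B))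
        (Or.inr ENNReal.coe_ne_top)
      simpa using this

/-- The constant in Eilenberg's inequality for the normalized Hausdorff measures of dimensions
`d - 1` and `d`: the normalizing factor of the former divided by that of the latter. -/
noncomputable def eilenbergConst (d : ℕ) : ℝ≥0 :=
  Measure.addHaarScalarFactor (volume : Measure (EuclideanSpace ℝ (Fin (d - 1)))) μH[(d - 1 : ℕ)] *
    (Measure.addHaarScalarFactor (volume : Measure (EuclideanSpace ℝ (Fin d))) μH[d])⁻¹

/-- Eilenberg's inequality in Euclidean space, for the normalized Hausdorff measure. -/
theorem lintegral_euclideanHausdorffMeasure_level_le {d : ℕ} (hd : 2 ≤ d) {s : Space d → ℝ}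
    {K : ℝ≥0} {B : Set (Space d)} (hs : LipschitzOnWith K s B) (hB : volume B ≠ ∞) :
    ∫⁻ t, Measure.euclideanHausdorffMeasure (d - 1) (B ∩ s ⁻¹' {t})
      ≤ eilenbergConst d * K * volume B := by
  set a := Measure.addHaarScalarFactor
    (volume : Measure (EuclideanSpace ℝ (Fin d))) μH[d] with ha
  have ha0 : a ≠ 0 := Measure.addHaarScalarFactor_volume_hausdorffMeasure_ne_zero d
  have hvol : volume B = a * μH[d] B := by
    rw [← EuclideanSpace.euclideanHausdorffMeasure_eq_volume,
      Measure.euclideanHausdorffMeasure_def]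
    rfl
  have ha0' : (a : ℝ≥0∞) ≠ 0 := by simpa using ha0
  have hd1 : ((d - 1 : ℕ) : ℝ) + 1 = d := by
    rw [Nat.cast_sub (by omega)]; simp
  have hH : μH[d] B = (a : ℝ≥0∞)⁻¹ * volume B := by
    rw [hvol, ← mul_assoc, ENNReal.inv_mul_cancel ha0' ENNReal.coe_ne_top, one_mul]
  have hfin : μH[d] B ≠ ∞ := by
    rw [hH]; exact ENNReal.mul_ne_top (by simpa using ha0) hB
  have key := lintegral_hausdorffMeasure_level_le (e := ((d - 1 : ℕ) : ℝ))
    (by exact_mod_cast (by omega : 0 < d - 1)) hs (by rwa [hd1])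
  rw [hd1, hH] at key
  simp_rw [Measure.euclideanHausdorffMeasure_def, Measure.smul_apply, ENNReal.smul_def, smul_eq_mul]
  rw [lintegral_const_mul' _ _ ENNReal.coe_ne_top]
  refine (mul_le_mul_right key _).trans (le_of_eq ?_)
  rw [eilenbergConst, ENNReal.coe_mul, ENNReal.coe_inv ha0]
  ring

end

/-! ### Geometry of uniformly convex domains -/

section

variable {d : ℕ} {Ω : Set (Space d)} {κ : ℝ}

/-- A convex body has a supporting hyperplane at every boundary point. -/
theorem exists_isInwardNormal (hconv : Convex ℝ Ω) (hne : (interior Ω).Nonempty)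
    {x : Space d} (hx : x ∉ interior Ω) : ∃ n, IsInwardNormal Ω x n := by
  obtain ⟨f, hf⟩ := geometric_hahn_banach_point_open hconv.interior isOpen_interior hx
  obtain ⟨c, hc⟩ := hne
  set u := (InnerProductSpace.toDual ℝ (Space d)).symm f with hu
  have hfu : ∀ v, f v = ⟪v, u⟫ := fun v => by
    rw [real_inner_comm, hu, InnerProductSpace.toDual_symm_apply]
  have hu0 : u ≠ 0 := fun h => by
    have := hf c hc
    rw [hfu, hfu, h, inner_zero_right, inner_zero_right] at this
    exact lt_irrefl _ this
  refine ⟨‖u‖⁻¹ • u, ?_, fun y hy => ?_⟩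
  · rw [norm_smul, norm_inv, norm_norm, inv_mul_cancel₀ (norm_ne_zero_iff.2 hu0)]
  · have hy' : y ∈ closure (interior Ω) :=
      hconv.closure_interior_eq_closure_of_nonempty_interior ⟨c, hc⟩ ▸ subset_closure hy
    have : f x ≤ f y := by
      refine closure_minimal (t := {z | f x ≤ f z}) (fun z hz => (hf z hz).le)
        (isClosed_le continuous_const f.continuous) hy'
    rw [inner_smul_right, inner_sub_left, ← hfu, ← hfu]
    exact mul_nonneg (by positivity) (by linarith)

/-- From an interior point one can move a little in any direction. -/
theorem exists_pos_sub_smul_mem {y : Space d} (hy : y ∈ interior Ω) (n : Space d) :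
    ∃ ε : ℝ, 0 < ε ∧ y - ε • n ∈ Ω := by
  have hc : Tendsto (fun ε : ℝ => y - ε • n) (𝓝[>] 0) (𝓝 y) := by
    have : Continuous fun ε : ℝ => y - ε • n := by fun_prop
    have := this.tendsto 0
    simp only [zero_smul, sub_zero] at this
    exact this.mono_left nhdsWithin_le_nhds
  obtain ⟨ε, hε, hε0⟩ :=
    ((hc.eventually (isOpen_interior.mem_nhds hy)).and self_mem_nhdsWithin).exists
  exact ⟨ε, hε0, interior_subset hε⟩

/-- The interior lies strictly on one side of a supporting hyperplane. -/
theorem IsInwardNormal.notMem_interior {x n y : Space d} (h : IsInwardNormal Ω x n)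
    (hy : ⟪y - x, n⟫ ≤ 0) : y ∉ interior Ω := fun hyi => by
  obtain ⟨ε, hε0, hε⟩ := exists_pos_sub_smul_mem hyi n
  have h1 := h.2 _ hε
  rw [sub_right_comm, inner_sub_left, real_inner_smul_left, real_inner_self_eq_norm_sq, h.1] at h1
  linarith

namespace IsUniformlyConvexDomain

variable (hΩ : IsUniformlyConvexDomain Ω κ)
include hΩ

theorem frontier_subset : frontier Ω ⊆ Ω := hΩ.isCompact.isClosed.frontier_subset

theorem mem_frontier_iff {x : Space d} : x ∈ frontier Ω ↔ x ∈ Ω ∧ x ∉ interior Ω := by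
  rw [hΩ.isCompact.isClosed.frontier_eq]; rfl

theorem exists_normal {x : Space d} (hx : x ∈ frontier Ω) : ∃ n, IsInwardNormal Ω x n :=
  exists_isInwardNormal hΩ.convex hΩ.nonempty_interior (hΩ.mem_frontier_iff.1 hx).2

/-- Positive curvature excludes segments in the boundary. -/
theorem strictConvex : StrictConvex ℝ Ω := by
  intro x hx y hy hxy a b ha hb hab
  by_contra hz
  set z := a • x + b • y with hzdef
  have hzΩ : z ∈ Ω := hΩ.convex hx hy ha.le hb.le hab
  obtain ⟨n, hn⟩ := exists_isInwardNormal hΩ.convex hΩ.nonempty_interior hz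
  have h1 := hn.2 x hx
  have h2 := hn.2 y hy
  have hxz : x - z = b • (x - y) := by
    rw [hzdef]
    have : a = 1 - b := by linarith
    rw [this]; module
  have hyz : y - z = (-a) • (x - y) := by
    rw [hzdef]
    have : b = 1 - a := by linarith
    rw [this]; module
  rw [hxz, real_inner_smul_left] at h1
  rw [hyz, real_inner_smul_left] at h2
  have h0 : ⟪x - y, n⟫ = 0 := by nlinarith
  have hzf : z ∈ frontier Ω := hΩ.mem_frontier_iff.2 ⟨hzΩ, hz⟩
  have hev := hΩ.curvatures_ge z hzf n hn (κ / 2) (by linarith [hΩ.pos])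
  have hc : Tendsto (fun s : ℝ => z + s • (x - z)) (𝓝[>] 0) (𝓝[frontier Ω] z) := by
    refine tendsto_nhdsWithin_iff.2 ⟨?_, ?_⟩
    · have : Continuous fun s : ℝ => z + s • (x - z) := by fun_prop
      have := this.tendsto 0
      simp only [zero_smul, add_zero] at this
      exact this.mono_left nhdsWithin_le_nhds
    · filter_upwards [Ioo_mem_nhdsGT (zero_lt_one' ℝ)] with s hs
      refine hΩ.mem_frontier_iff.2 ⟨?_, hn.notMem_interior ?_⟩
      · exact hΩ.convex.add_smul_sub_mem hzΩ hx ⟨hs.1.le, hs.2.le⟩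
      · rw [add_sub_cancel_left, hxz, smul_smul, real_inner_smul_left, h0, mul_zero]
  obtain ⟨s, hs, hs0⟩ := ((hc.eventually hev).and self_mem_nhdsWithin).exists
  rw [add_sub_cancel_left, hxz, smul_smul, real_inner_smul_left, h0, mul_zero, norm_smul] at hs
  have hs0' : (0 : ℝ) < s := hs0
  have : 0 < ‖s * b‖ * ‖x - y‖ := by
    have := norm_pos_iff.2 (sub_ne_zero.2 hxy)
    have : 0 < ‖s * b‖ := norm_pos_iff.2 (by positivity)
    positivity
  have := hΩ.pos
  have : 0 < κ / 2 / 2 * (‖s * b‖ * ‖x - y‖) ^ 2 := by positivity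
  linarith

theorem notMem_frontier_of_mem_openSegment {x y z : Space d} (hx : x ∈ Ω) (hy : y ∈ Ω)
    (hxy : x ≠ y) (hz : z ∈ openSegment ℝ x y) : z ∉ frontier Ω := fun h =>
  (hΩ.mem_frontier_iff.1 h).2 (hΩ.strictConvex.openSegment_subset hx hy hxy hz)

end IsUniformlyConvexDomain

/-- If a concave function on `[0, 1]` lies between `0` and a linear function of slope `h < A`, then
`A s (1 - s) - g s` attains its maximum over `(0, 1)`. -/
theorem exists_isMaxOn_parabola_sub {g : ℝ → ℝ} {h A : ℝ} (hg : ConcaveOn ℝ (Icc 0 1) g)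
    (hg0 : ∀ s ∈ Icc (0 : ℝ) 1, 0 ≤ g s) (hgh : ∀ s ∈ Icc (0 : ℝ) 1, g s ≤ s * h) (hA : h < A) :
    ∃ s₀ ∈ Ioo (0 : ℝ) 1, ∀ s ∈ Ioo (0 : ℝ) 1,
      A * (s * (1 - s)) - g s ≤ A * (s₀ * (1 - s₀)) - g s₀ := by
  have hh : 0 ≤ h := by
    have h1 := hg0 1 (by simp)
    have h2 := hgh 1 (by simp)
    linarith
  have hApos : 0 < A := by linarith
  set m : ℝ → ℝ := fun s => A * (s * (1 - s)) - g s with hm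
  have hcont : ContinuousOn m (Ioo 0 1) := by
    refine ContinuousOn.sub (by fun_prop) ?_
    exact (hg.subset Ioo_subset_Icc_self (convex_Ioo 0 1)).continuousOn isOpen_Ioo
  -- The function is at most `A s (1 - s)`, which is small near both ends, and it is positive at `s₁`.
  set s₁ := (A - h) / (2 * A) with hs₁
  have hs₁pos : 0 < s₁ := by rw [hs₁]; apply div_pos <;> linarith
  have hs₁half : s₁ ≤ 1 / 2 := by rw [hs₁, div_le_iff₀ (by positivity)]; linarith
  have hs₁A : A * s₁ = (A - h) / 2 := by rw [hs₁]; field_simp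
  have hmpos : 0 < m s₁ := by
    have := hgh s₁ ⟨hs₁pos.le, by linarith⟩
    have h1 : m s₁ ≥ s₁ * (A - A * s₁ - h) := by simp only [hm]; nlinarith
    have h2 : 0 < s₁ * (A - A * s₁ - h) := mul_pos hs₁pos (by rw [hs₁A]; linarith)
    linarith
  set ε := min s₁ (m s₁ / (2 * A)) with hε
  have hεpos : 0 < ε := lt_min hs₁pos (by positivity)
  have hεs : ε ≤ s₁ := min_le_left _ _
  have hεm : A * ε ≤ m s₁ / 2 := by
    have : ε ≤ m s₁ / (2 * A) := min_le_right _ _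
    rw [le_div_iff₀ (by positivity)] at this
    linarith
  obtain ⟨s₀, hs₀, hmax⟩ := (isCompact_Icc (a := ε) (b := 1 - ε)).exists_isMaxOn
    ⟨s₁, hεs, by linarith⟩ (hcont.mono fun s hs => ⟨by linarith [hs.1], by linarith [hs.2]⟩)
  have hge : m s₁ ≤ m s₀ := hmax ⟨hεs, by linarith⟩
  refine ⟨s₀, ⟨by linarith [hs₀.1], by linarith [hs₀.2]⟩, fun s hs => ?_⟩
  by_cases hs' : s ∈ Icc ε (1 - ε)
  · exact hmax hs'
  · have hgs := hg0 s ⟨hs.1.le, hs.2.le⟩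
    have hss : s * (1 - s) ≤ ε := by
      rw [mem_Icc, not_and_or, not_le, not_le] at hs'
      rcases hs' with h' | h' <;> nlinarith [hs.1, hs.2]
    have : m s ≤ A * ε := by simp only [hm]; nlinarith
    change m s ≤ m s₀
    linarith

namespace IsUniformlyConvexDomain

variable (hΩ : IsUniformlyConvexDomain Ω κ)
include hΩ

/-- The passage from local to global: the tangential part of `y - x` is controlled by its normal
part. The depth of `Ω` below the chord from `x` to `y`, in the direction `-n`, is a
concave function; were the conclusion false, a parabola minus the depth would have an interior
maximum, and the curvature at the corresponding boundary point would be too small. -/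
theorem tangential_le_normal {k : ℝ} (hk0 : 0 < k) (hk : k < κ) {x y n : Space d}
    (hx : x ∈ frontier Ω) (hy : y ∈ Ω) (hn : IsInwardNormal Ω x n) :
    k / 2 * (‖y - x‖ ^ 2 - ⟪y - x, n⟫ ^ 2) ≤ ⟪y - x, n⟫ := by
  by_contra! hcon
  have hxΩ : x ∈ Ω := hΩ.frontier_subset hx
  set v := y - x with hv
  set h := ⟪v, n⟫ with hh
  set t2 := ‖v‖ ^ 2 - h ^ 2 with ht2
  have hh0 : 0 ≤ h := hn.2 y hy
  have hnn : ⟪n, n⟫ = 1 := by rw [real_inner_self_eq_norm_sq, hn.1]; norm_num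
  have ht2pos : 0 < t2 := by
    by_contra! hle
    have : k / 2 * t2 ≤ 0 := mul_nonpos_of_nonneg_of_nonpos (by positivity) hle
    linarith
  have hyx : x ≠ y := fun hxy => by
    rw [hv, hxy, sub_self] at ht2 hh
    simp [hh] at ht2
    linarith
  have hmem : ∀ s ∈ Icc (0 : ℝ) 1, x + s • v ∈ Ω := fun s hs =>
    hΩ.convex.add_smul_sub_mem hxΩ hy hs
  -- The set of admissible depths below the point `x + s v` of the chord; `g s` is the largest one,
  -- and `z s` is the boundary point at that depth.
  let Λ : ℝ → Set ℝ := fun s => {l | 0 ≤ l ∧ x + s • v - l • n ∈ Ω}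
  have hΛle : ∀ s, ∀ l ∈ Λ s, l ≤ s * h := fun s l hl => by
    have := hn.2 _ hl.2
    have e : x + s • v - l • n - x = s • v - l • n := by abel
    rw [e, inner_sub_left, real_inner_smul_left, real_inner_smul_left, hnn] at this
    linarith
  have hΛcl : ∀ s, IsClosed (Λ s) := fun s =>
    isClosed_Ici.inter (hΩ.isCompact.isClosed.preimage (by fun_prop))
  have hΛbdd : ∀ s, BddAbove (Λ s) := fun s => ⟨s * h, fun l hl => hΛle s l hl⟩
  have hΛne : ∀ s ∈ Icc (0 : ℝ) 1, (0 : ℝ) ∈ Λ s := fun s hs => ⟨le_rfl, by simpa using hmem s hs⟩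
  let g : ℝ → ℝ := fun s => sSup (Λ s)
  have hgmem : ∀ s ∈ Icc (0 : ℝ) 1, g s ∈ Λ s := fun s hs =>
    (hΛcl s).csSup_mem ⟨0, hΛne s hs⟩ (hΛbdd s)
  have hgge : ∀ s, ∀ l ∈ Λ s, l ≤ g s := fun s l hl => le_csSup (hΛbdd s) hl
  have hgconc : ConcaveOn ℝ (Icc 0 1) g := by
    refine ⟨convex_Icc 0 1, fun s hs r hr a b ha hb hab => hgge _ _ ⟨?_, ?_⟩⟩
    · have := (hgmem s hs).1
      have := (hgmem r hr).1
      simp only [smul_eq_mul]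
      positivity
    · have := hΩ.convex (hgmem s hs).2 (hgmem r hr).2 ha hb hab
      convert this using 1
      have : a = 1 - b := by linarith
      subst this
      simp only [smul_eq_mul]
      module
  obtain ⟨s₀, hs₀, hmax⟩ := exists_isMaxOn_parabola_sub (h := h) (A := k / 2 * t2) hgconc
    (fun s hs => (hgmem s hs).1) (fun s hs => hΛle s _ (hgmem s hs)) hcon
  let z : ℝ → Space d := fun s => x + s • v - g s • n
  have hzf : ∀ s ∈ Ioo (0 : ℝ) 1, z s ∈ frontier Ω := fun s hs => by
    have hs' : s ∈ Icc (0 : ℝ) 1 := ⟨hs.1.le, hs.2.le⟩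
    refine hΩ.mem_frontier_iff.2 ⟨(hgmem s hs').2, fun hint => ?_⟩
    obtain ⟨ε, hε0, hε⟩ := exists_pos_sub_smul_mem hint n
    have : g s + ε ≤ g s := hgge s _ ⟨by linarith [(hgmem s hs').1], by
      have e : x + s • v - (g s + ε) • n = z s - ε • n := by simp only [z]; module
      rwa [e]⟩
    linarith
  have hs₀' : s₀ ∈ Icc (0 : ℝ) 1 := ⟨hs₀.1.le, hs₀.2.le⟩
  obtain ⟨n', hn'⟩ := hΩ.exists_normal (hzf s₀ hs₀)
  have hg0 : 0 < g s₀ := by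
    have hint : x + s₀ • v ∈ interior Ω := by
      have := hΩ.strictConvex hxΩ hy hyx (a := 1 - s₀) (b := s₀) (by linarith [hs₀.2]) hs₀.1
        (by ring)
      convert this using 1
      rw [hv]; module
    obtain ⟨ε, hε0, hε⟩ := exists_pos_sub_smul_mem hint n
    exact hε0.trans_le (hgge _ _ ⟨hε0.le, hε⟩)
  set a := ⟪n, n'⟫ with ha
  have ha0 : 0 ≤ a := by
    have := hn'.2 _ (hmem s₀ hs₀')
    have e : x + s₀ • v - z s₀ = g s₀ • n := by simp only [z]; abel
    rw [e, real_inner_smul_left] at this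
    exact nonneg_of_mul_nonneg_right this hg0
  have ha1 : a ≤ 1 := by
    have := real_inner_le_norm n n'
    rwa [hn.1, hn'.1, one_mul] at this
  -- The curvature at `z s₀` is tested with some `k'` between `k` and `κ`.
  obtain ⟨k', hk'1, hk'2⟩ := exists_between hk
  have hgcont : ContinuousOn g (Ioo 0 1) :=
    (hgconc.subset Ioo_subset_Icc_self (convex_Ioo 0 1)).continuousOn isOpen_Ioo
  have hzt : Tendsto z (𝓝 s₀) (𝓝[frontier Ω] (z s₀)) := by
    refine tendsto_nhdsWithin_iff.2 ⟨?_, ?_⟩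
    · have hg1 : ContinuousAt g s₀ := hgcont.continuousAt (isOpen_Ioo.mem_nhds hs₀)
      have : ContinuousAt z s₀ := by fun_prop
      exact this
    · filter_upwards [isOpen_Ioo.mem_nhds hs₀] with s hs using hzf s hs
  have hev := hzt.eventually (hΩ.curvatures_ge _ (hzf s₀ hs₀) n' hn' k' hk'2)
  set B := ⟪v, n'⟫ - a * (k / 2 * t2) * (1 - 2 * s₀) with hB
  -- Near `s₀` the quadratic term is dominated by a linear one, which is absurd, as is seen from the
  -- two signs of `σ`.
  have hkey : ∀ᶠ σ : ℝ in 𝓝 0, (k' - k) / 2 * t2 * σ ^ 2 ≤ B * σ := by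
    have hsh : Tendsto (fun σ : ℝ => s₀ + σ) (𝓝 0) (𝓝 s₀) := by
      have : Continuous fun σ : ℝ => s₀ + σ := by fun_prop
      simpa using this.tendsto 0
    filter_upwards [hsh.eventually hev, hsh.eventually (isOpen_Ioo.mem_nhds hs₀)] with σ hσ hσ1
    have hm := hmax _ hσ1
    set c := g (s₀ + σ) - g s₀ with hc
    have e : z (s₀ + σ) - z s₀ = σ • v - c • n := by simp only [z, hc]; module
    have hnorm : ‖σ • v - c • n‖ ^ 2 = σ ^ 2 * t2 + (σ * h - c) ^ 2 := by
      rw [norm_sub_sq_real, norm_smul, norm_smul, real_inner_smul_left, real_inner_smul_right,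
        ← hh, hn.1, ht2, mul_pow, mul_pow, Real.norm_eq_abs, Real.norm_eq_abs, sq_abs, sq_abs]
      ring
    rw [e, hnorm, inner_sub_left, real_inner_smul_left, real_inner_smul_left, ← ha] at hσ
    have hcge : k / 2 * t2 * (σ * (1 - 2 * s₀) - σ ^ 2) ≤ c := by rw [hc]; linarith
    have h1 : a * (k / 2 * t2 * (σ * (1 - 2 * s₀) - σ ^ 2)) ≤ a * c :=
      mul_le_mul_of_nonneg_left hcge ha0
    have h2 : 0 ≤ k' / 2 * (σ * h - c) ^ 2 := by
      have : 0 < k' := by linarith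
      positivity
    have h3 : a * (k / 2 * (σ ^ 2 * t2)) ≤ 1 * (k / 2 * (σ ^ 2 * t2)) :=
      mul_le_mul_of_nonneg_right ha1 (by positivity)
    rw [hB]
    linarith
  have hneg : Tendsto (fun σ : ℝ => -σ) (𝓝[>] 0) (𝓝 0) := by
    have : Continuous fun σ : ℝ => -σ := continuous_neg
    have := this.tendsto 0
    rw [neg_zero] at this
    exact this.mono_left nhdsWithin_le_nhds
  obtain ⟨σ, ⟨h1, h2⟩, h3⟩ := (((hkey.filter_mono nhdsWithin_le_nhds).and
    (hneg.eventually hkey)).and (self_mem_nhdsWithin (s := Ioi (0 : ℝ)))).exists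
  have h3' : (0 : ℝ) < σ := h3
  have h4 : 0 < (k' - k) / 2 * t2 * σ ^ 2 := by
    have : 0 < k' - k := by linarith
    positivity
  rw [neg_sq] at h2
  linarith

/-- Uniform convexity, globally: every inward normal at `x` sees `y` at a height at least
quadratic in the distance. -/
theorem norm_sq_le {x y n : Space d} (hx : x ∈ frontier Ω) (hy : y ∈ Ω)
    (hn : IsInwardNormal Ω x n) :
    ‖y - x‖ ^ 2 ≤ (2 / κ + Metric.diam Ω) * ⟪y - x, n⟫ := by
  have hκ := hΩ.pos
  set h := ⟪y - x, n⟫ with hh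
  have h0 : 0 ≤ h := hn.2 y hy
  have key : κ / 2 * (‖y - x‖ ^ 2 - h ^ 2) ≤ h := by
    have hlim : Tendsto (fun k : ℝ => k / 2 * (‖y - x‖ ^ 2 - h ^ 2)) (𝓝[<] κ)
        (𝓝 (κ / 2 * (‖y - x‖ ^ 2 - h ^ 2))) := by
      have : Continuous fun k : ℝ => k / 2 * (‖y - x‖ ^ 2 - h ^ 2) := by fun_prop
      exact (this.tendsto κ).mono_left nhdsWithin_le_nhds
    refine le_of_tendsto hlim ?_
    filter_upwards [Ioo_mem_nhdsLT hκ] with k hk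
    exact hΩ.tangential_le_normal hk.1 hk.2 hx hy hn
  have hle : h ≤ Metric.diam Ω := by
    have h1 := real_inner_le_norm (y - x) n
    rw [hn.1, mul_one, ← dist_eq_norm] at h1
    exact h1.trans (Metric.dist_le_diam_of_mem hΩ.isCompact.isBounded hy (hΩ.frontier_subset hx))
  have h2 : ‖y - x‖ ^ 2 - h ^ 2 ≤ 2 / κ * h := by
    rw [div_mul_eq_mul_div, le_div_iff₀ hκ]; linarith
  nlinarith

/-- The midpoint of a diameter is the centre of a ball inside `Ω`, whose radius depends only on the
curvature bound and on the diameter. -/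
theorem exists_ball_subset :
    ∃ c ∈ Ω, Metric.ball c (Metric.diam Ω ^ 2 / (4 * (2 / κ + Metric.diam Ω))) ⊆ Ω := by
  have hκ := hΩ.pos
  have hD : 0 ≤ Metric.diam Ω := Metric.diam_nonneg
  have hne : Ω.Nonempty := hΩ.nonempty_interior.mono interior_subset
  have hcont : ContinuousOn (fun p : Space d × Space d => dist p.1 p.2) (Ω ×ˢ Ω) :=
    continuous_dist.continuousOn
  obtain ⟨⟨a, b⟩, ⟨ha, hb⟩, hab⟩ :=
    (hΩ.isCompact.prod hΩ.isCompact).exists_isMaxOn (hne.prod hne) hcont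
  have hdiam : Metric.diam Ω = dist a b := by
    refine le_antisymm (Metric.diam_le_of_forall_dist_le dist_nonneg fun p hp q hq => ?_)
      (Metric.dist_le_diam_of_mem hΩ.isCompact.isBounded ha hb)
    exact isMaxOn_iff.1 hab (p, q) ⟨hp, hq⟩
  obtain ⟨c, hc⟩ : ∃ c, c = (1 / 2 : ℝ) • a + (1 / 2 : ℝ) • b := ⟨_, rfl⟩
  have hcΩ : c ∈ Ω := by
    rw [hc]; exact hΩ.convex ha hb (by norm_num) (by norm_num) (by norm_num)
  refine ⟨c, hcΩ, ?_⟩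
  set R := 2 / κ + Metric.diam Ω with hR
  have hRpos : 0 < R := by positivity
  by_contra hsub
  obtain ⟨p, hp, hpΩ⟩ := not_subset.1 hsub
  have hρ : 0 < Metric.diam Ω ^ 2 / (4 * R) := Metric.pos_of_mem_ball hp
  obtain ⟨x, hxb, hxf⟩ : ∃ x ∈ Metric.ball c (Metric.diam Ω ^ 2 / (4 * R)), x ∈ frontier Ω := by
    by_contra! hcon
    have hci : c ∈ interior Ω := by
      by_contra h
      exact hcon c (Metric.mem_ball_self hρ) (hΩ.mem_frontier_iff.2 ⟨hcΩ, h⟩)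
    obtain ⟨q, -, hq1, hq2⟩ := (convex_ball c (Metric.diam Ω ^ 2 / (4 * R))).isPreconnected
      (interior Ω) Ωᶜ isOpen_interior hΩ.isCompact.isClosed.isOpen_compl
      (fun q hq => by
        by_contra h
        rw [mem_union, not_or, notMem_compl_iff] at h
        exact hcon q hq (hΩ.mem_frontier_iff.2 ⟨h.2, h.1⟩))
      ⟨c, Metric.mem_ball_self hρ, hci⟩ ⟨p, hp, hpΩ⟩
    exact hq2 (interior_subset hq1)
  obtain ⟨n, hn⟩ := hΩ.exists_normal hxf
  have h1 := hΩ.norm_sq_le hxf ha hn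
  have h2 := hΩ.norm_sq_le hxf hb hn
  have h3 : ⟪c - x, n⟫ = (⟪a - x, n⟫ + ⟪b - x, n⟫) / 2 := by
    have : c - x = (1 / 2 : ℝ) • (a - x) + (1 / 2 : ℝ) • (b - x) := by rw [hc]; module
    rw [this, inner_add_left, real_inner_smul_left, real_inner_smul_left]; ring
  have h4 : ⟪c - x, n⟫ < Metric.diam Ω ^ 2 / (4 * R) := by
    have h1 := real_inner_le_norm (c - x) n
    rw [hn.1, mul_one, ← dist_eq_norm, dist_comm] at h1
    exact h1.trans_lt hxb
  rw [lt_div_iff₀ (by positivity)] at h4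
  have h5 : Metric.diam Ω ≤ ‖a - x‖ + ‖b - x‖ := by
    rw [hdiam, ← dist_eq_norm, ← dist_eq_norm]
    exact dist_triangle_right a b x
  have h6 : Metric.diam Ω ^ 2 ≤ (‖a - x‖ + ‖b - x‖) ^ 2 := by gcongr
  rw [h3] at h4
  nlinarith [sq_nonneg (‖a - x‖ - ‖b - x‖)]

end IsUniformlyConvexDomain

end

/-! ### Radial projection and the surface measure -/

section

variable {d : ℕ} {Ω : Set (Space d)} {κ : ℝ} {c : Space d}

/-- The Minkowski gauge of `Ω` with respect to the centre `c`. -/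
noncomputable def bodyGauge (Ω : Set (Space d)) (c p : Space d) : ℝ :=
  gauge ((fun z => z + c) ⁻¹' Ω) (p - c)

/-- The radial projection from the centre `c` onto the boundary of `Ω`. -/
noncomputable def bodyProj (Ω : Set (Space d)) (c p : Space d) : Space d :=
  c + (bodyGauge Ω c p)⁻¹ • (p - c)

/-- The region between the boundary of `Ω` and the boundary of the double of `Ω`. -/
def bodyShell (Ω : Set (Space d)) (c : Space d) : Set (Space d) :=
  {p | bodyGauge Ω c p ∈ Ioo (1 : ℝ) 2}

namespace IsUniformlyConvexDomain

variable (hΩ : IsUniformlyConvexDomain Ω κ) {ρ : ℝ≥0} (hρ : 0 < ρ) (hc : Metric.ball c ρ ⊆ Ω)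

include hΩ in
theorem convex_translate : Convex ℝ ((fun z => z + c) ⁻¹' Ω) :=
  hΩ.convex.translate_preimage_left c

include hc in
theorem ball_subset_translate : Metric.ball (0 : Space d) ρ ⊆ (fun z => z + c) ⁻¹' Ω :=
  fun z hz => hc (by simpa [dist_eq_norm] using hz)

include hρ hc

theorem translate_mem_nhds : (fun z => z + c) ⁻¹' Ω ∈ 𝓝 (0 : Space d) :=
  mem_of_superset (Metric.ball_mem_nhds _ (NNReal.coe_pos.2 hρ)) (ball_subset_translate hc)

theorem center_mem : c ∈ Ω := hc (Metric.mem_ball_self (NNReal.coe_pos.2 hρ))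

include hΩ

theorem lipschitzWith_bodyGauge : LipschitzWith ρ⁻¹ (bodyGauge Ω c) := by
  have h := hΩ.convex_translate.lipschitzWith_gauge hρ (ball_subset_translate hc)
  refine LipschitzWith.of_dist_le_mul fun p q => ?_
  simpa [bodyGauge] using h.dist_le_mul (p - c) (q - c)

theorem continuous_bodyGauge : Continuous (bodyGauge Ω c) :=
  (hΩ.lipschitzWith_bodyGauge hρ hc).continuous

omit hρ hΩ hc in
theorem bodyGauge_homothety {t : ℝ} (ht : 0 ≤ t) (v : Space d) :
    bodyGauge Ω c (c + t • v) = t * bodyGauge Ω c (c + v) := by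
  simp only [bodyGauge, add_sub_cancel_left]
  rw [gauge_smul_of_nonneg ht, smul_eq_mul]

theorem bodyGauge_eq_one_iff {x : Space d} : bodyGauge Ω c x = 1 ↔ x ∈ frontier Ω := by
  rw [bodyGauge, gauge_eq_one_iff_mem_frontier hΩ.convex_translate
    (translate_mem_nhds hρ hc)]
  have := (Homeomorph.addRight c).preimage_frontier Ω
  change _ ∈ frontier ((Homeomorph.addRight c) ⁻¹' Ω) ↔ _
  rw [← this]
  simp

omit hρ hΩ hc in
theorem bodyGauge_le_one {x : Space d} (hx : x ∈ Ω) : bodyGauge Ω c x ≤ 1 :=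
  gauge_le_one_of_mem (by simpa using hx)

theorem bodyGauge_add_le (p v : Space d) :
    bodyGauge Ω c (p + v) ≤ bodyGauge Ω c p + bodyGauge Ω c (c + v) := by
  simp only [bodyGauge, add_sub_cancel_left]
  rw [add_sub_right_comm]
  exact gauge_add_le hΩ.convex_translate
    (absorbent_nhds_zero (translate_mem_nhds hρ hc)) _ _

omit hρ hΩ hc in
theorem eq_homothety_bodyProj {p : Space d} (hp : 0 < bodyGauge Ω c p) :
    p = c + bodyGauge Ω c p • (bodyProj Ω c p - c) := by
  rw [bodyProj, add_sub_cancel_left, smul_smul, mul_inv_cancel₀ hp.ne', one_smul,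
    add_sub_cancel]

theorem bodyProj_mem_frontier {p : Space d} (hp : 0 < bodyGauge Ω c p) :
    bodyProj Ω c p ∈ frontier Ω := by
  rw [← hΩ.bodyGauge_eq_one_iff hρ hc, bodyProj, bodyGauge_homothety (by positivity),
    add_sub_cancel, inv_mul_cancel₀ hp.ne']

theorem bodyGauge_homothety_frontier {x : Space d} (hx : x ∈ frontier Ω) {t : ℝ} (ht : 0 ≤ t) :
    bodyGauge Ω c (c + t • (x - c)) = t := by
  rw [bodyGauge_homothety ht, add_sub_cancel, (hΩ.bodyGauge_eq_one_iff hρ hc).2 hx, mul_one]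

theorem bodyProj_homothety {x : Space d} (hx : x ∈ frontier Ω) {t : ℝ} (ht : 0 < t) :
    bodyProj Ω c (c + t • (x - c)) = x := by
  rw [bodyProj, hΩ.bodyGauge_homothety_frontier hρ hc hx ht.le, add_sub_cancel_left, smul_smul,
    inv_mul_cancel₀ ht.ne', one_smul, add_sub_cancel]

theorem norm_sub_center_le {x : Space d} (hx : x ∈ Ω) : ‖x - c‖ ≤ Metric.diam Ω := by
  rw [← dist_eq_norm]
  exact Metric.dist_le_diam_of_mem hΩ.isCompact.isBounded hx (center_mem hρ hc)

theorem isOpen_bodyShell : IsOpen (bodyShell Ω c) :=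
  isOpen_Ioo.preimage (hΩ.continuous_bodyGauge hρ hc)

theorem volume_bodyShell_ne_top : volume (bodyShell Ω c) ≠ ∞ := by
  refine ((Metric.isBounded_iff_subset_closedBall c).2
    ⟨2 * Metric.diam Ω, fun p hp => ?_⟩).measure_lt_top.ne
  have hp0 : 0 < bodyGauge Ω c p := by linarith [hp.1]
  have h1 := hΩ.norm_sub_center_le hρ hc
    (hΩ.frontier_subset (hΩ.bodyProj_mem_frontier hρ hc hp0))
  rw [mem_closedBall_iff_norm]
  have h2 : p - c = bodyGauge Ω c p • (bodyProj Ω c p - c) := by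
    rw [sub_eq_iff_eq_add', ← eq_homothety_bodyProj hp0]
  rw [h2, norm_smul, Real.norm_of_nonneg hp0.le]
  exact mul_le_mul hp.2.le h1 (norm_nonneg _) (by norm_num)

theorem measurable_bodyProj : Measurable (bodyProj Ω c) := by
  have := (hΩ.continuous_bodyGauge hρ hc).measurable
  unfold bodyProj
  fun_prop

theorem lipschitzOnWith_bodyProj :
    ∃ L, LipschitzOnWith L (bodyProj Ω c) (bodyShell Ω c) := by
  refine ⟨1 + (Metric.diam Ω).toNNReal * ρ⁻¹, LipschitzOnWith.of_dist_le_mul fun p hp q hq => ?_⟩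
  have hj : |bodyGauge Ω c p - bodyGauge Ω c q| ≤ ρ⁻¹ * ‖p - q‖ := by
    have := (hΩ.lipschitzWith_bodyGauge hρ hc).dist_le_mul p q
    rwa [Real.dist_eq, dist_eq_norm, NNReal.coe_inv] at this
  have hq0 : 0 < bodyGauge Ω c q := by linarith [hq.1]
  have hp1 := hp.1
  have hD := hΩ.norm_sub_center_le hρ hc
    (hΩ.frontier_subset (hΩ.bodyProj_mem_frontier hρ hc hq0))
  have e : bodyProj Ω c p - bodyProj Ω c q = (bodyGauge Ω c p)⁻¹ • ((p - q) -
      (bodyGauge Ω c p - bodyGauge Ω c q) • (bodyProj Ω c q - c)) := by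
    have h2 : q - c = bodyGauge Ω c q • (bodyProj Ω c q - c) := by
      conv_lhs => rw [eq_homothety_bodyProj hq0]
      rw [add_sub_cancel_left]
    have h3 : p - q = (p - c) - bodyGauge Ω c q • (bodyProj Ω c q - c) := by rw [← h2]; abel
    rw [h3]
    have hp0 : bodyGauge Ω c p ≠ 0 := by positivity
    have h4 : bodyProj Ω c p - bodyProj Ω c q
      = (bodyGauge Ω c p)⁻¹ • (p - c) - (bodyProj Ω c q - c) := by rw [bodyProj]; abel
    rw [h4]
    generalize bodyProj Ω c q - c = v
    have h5 : (bodyGauge Ω c p)⁻¹ • ((p - c) - bodyGauge Ω c q • v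
        - (bodyGauge Ω c p - bodyGauge Ω c q) • v)
        = (bodyGauge Ω c p)⁻¹ • (p - c) - ((bodyGauge Ω c p)⁻¹ * bodyGauge Ω c p) • v := by
      module
    rw [h5, inv_mul_cancel₀ hp0, one_smul]
  rw [dist_eq_norm, dist_eq_norm, e, norm_smul, norm_inv, Real.norm_of_nonneg (by linarith)]
  have h6 : ‖(p - q) - (bodyGauge Ω c p - bodyGauge Ω c q) • (bodyProj Ω c q - c)‖
      ≤ ‖p - q‖ + (ρ⁻¹ * ‖p - q‖) * Metric.diam Ω := by
    refine (norm_sub_le _ _).trans ?_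
    rw [norm_smul, Real.norm_eq_abs]
    gcongr
  have h7 : (bodyGauge Ω c p)⁻¹ ≤ 1 := inv_le_one_of_one_le₀ hp1.le
  push_cast
  rw [Real.coe_toNNReal _ Metric.diam_nonneg]
  calc _ ≤ 1 * (‖p - q‖ + (ρ⁻¹ * ‖p - q‖) * Metric.diam Ω) := by gcongr
    _ = _ := by rw [NNReal.coe_inv]; ring

/-- Eilenberg's inequality for the gauge: the surface measure of the slices of a subset of
`∂Ω × (0, 1)` is controlled by the volume of its radial copy in the shell. -/
theorem lintegral_surfaceMeasure_slice_le (hd : 2 ≤ d) (A : Set (Space d × ℝ)) :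
    ∫⁻ t in Ioo (0 : ℝ) 1, Measure.euclideanHausdorffMeasure (d - 1)
        ({x | (x, t) ∈ A} ∩ frontier Ω)
      ≤ (eilenbergConst d * ρ⁻¹ : ℝ≥0) *
        volume {p ∈ bodyShell Ω c | (bodyProj Ω c p, bodyGauge Ω c p - 1) ∈ A} := by
  set B := {p ∈ bodyShell Ω c | (bodyProj Ω c p, bodyGauge Ω c p - 1) ∈ A} with hB
  have hBfin : volume B ≠ ∞ :=
    ((measure_mono (sep_subset _ _)).trans_lt
      (hΩ.volume_bodyShell_ne_top hρ hc).lt_top).ne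
  have key := lintegral_euclideanHausdorffMeasure_level_le hd
    (lipschitzOnWith_univ.2 (hΩ.lipschitzWith_bodyGauge hρ hc) |>.mono (subset_univ B)) hBfin
  rw [← lintegral_add_left_eq_self _ (1 : ℝ)] at key
  rw [ENNReal.coe_mul]
  refine le_trans ?_ key
  refine le_trans (setLIntegral_mono' measurableSet_Ioo fun t ht => ?_)
    (setLIntegral_le_lintegral (Ioo (0 : ℝ) 1) _)
  -- The slice of `A` is the image of the slice of `B` under a contraction
  let φ : Space d → Space d := fun p => c + (1 + t)⁻¹ • (p - c)
  have ht1 : 0 < 1 + t := by linarith [ht.1]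
  have hφ : LipschitzWith 1 φ := by
    refine LipschitzWith.of_dist_le_mul fun p q => ?_
    simp only [φ, dist_add_left, dist_smul₀, dist_sub_right, NNReal.coe_one]
    gcongr
    rw [norm_inv, Real.norm_of_nonneg ht1.le]
    exact inv_le_one_of_one_le₀ (by linarith [ht.1])
  have hsub : {x | (x, t) ∈ A} ∩ frontier Ω ⊆ φ '' (B ∩ bodyGauge Ω c ⁻¹' {1 + t}) := by
    rintro x ⟨hxA, hxf⟩
    have h1 := hΩ.bodyGauge_homothety_frontier hρ hc hxf ht1.le
    refine ⟨c + (1 + t) • (x - c), ⟨⟨?_, ?_⟩, h1⟩, ?_⟩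
    · change _ ∈ Ioo (1 : ℝ) 2
      rw [h1]
      exact ⟨by linarith [ht.1], by linarith [ht.2]⟩
    · rw [hΩ.bodyProj_homothety hρ hc hxf ht1, h1]
      simpa using hxA
    · simp only [φ]
      rw [add_sub_cancel_left, smul_smul, inv_mul_cancel₀ ht1.ne', one_smul, add_sub_cancel]
  refine (measure_mono hsub).trans ?_
  simp only [Measure.euclideanHausdorffMeasure_def, Measure.smul_apply]
  refine smul_le_smul_of_nonneg_left ?_ zero_le
  simpa using hφ.hausdorffMeasure_image_le (Nat.cast_nonneg (d - 1))
    (B ∩ bodyGauge Ω c ⁻¹' {1 + t})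

/-- In particular, a subset of the boundary is negligible as soon as its radial copy in the shell
is. -/
theorem euclideanHausdorffMeasure_le (hd : 2 ≤ d) (M : Set (Space d)) :
    Measure.euclideanHausdorffMeasure (d - 1) (M ∩ frontier Ω)
      ≤ (eilenbergConst d * ρ⁻¹ : ℝ≥0) * volume {p ∈ bodyShell Ω c | bodyProj Ω c p ∈ M} := by
  have := hΩ.lintegral_surfaceMeasure_slice_le hρ hc hd (M ×ˢ univ)
  simpa using this

theorem isFiniteMeasure_surfaceMeasure (hd : 2 ≤ d) : IsFiniteMeasure (surfaceMeasure Ω) := by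
  refine ⟨?_⟩
  have := hΩ.euclideanHausdorffMeasure_le hρ hc hd univ
  rw [surfaceMeasure, Measure.restrict_apply_univ]
  rw [univ_inter] at this
  refine this.trans_lt (ENNReal.mul_lt_top ENNReal.coe_lt_top ?_)
  exact (measure_mono (sep_subset _ _)).trans_lt (hΩ.volume_bodyShell_ne_top hρ hc).lt_top

/-- The product of the surface measure with the Lebesgue measure of `(0, 1)` is controlled by the
image of the Lebesgue measure of the shell in polar coordinates. -/
theorem surfaceMeasure_prod_le (hd : 2 ≤ d) :
    (surfaceMeasure Ω).prod (volume.restrict (Ioo (0 : ℝ) 1)) ≤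
      (eilenbergConst d * ρ⁻¹ : ℝ≥0) •
        (volume.restrict (bodyShell Ω c)).map
          (fun p => (bodyProj Ω c p, bodyGauge Ω c p - 1)) := by
  have := hΩ.isFiniteMeasure_surfaceMeasure hρ hc hd
  have hm : Measurable fun p : Space d => (bodyProj Ω c p, bodyGauge Ω c p - 1) :=
    (hΩ.measurable_bodyProj hρ hc).prodMk
      ((hΩ.continuous_bodyGauge hρ hc).measurable.sub_const 1)
  refine Measure.le_iff.2 fun A hA => ?_
  rw [Measure.prod_apply_symm hA, Measure.smul_apply, Measure.map_apply hm hA,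
    Measure.restrict_apply (hm hA)]
  convert hΩ.lintegral_surfaceMeasure_slice_le hρ hc hd A using 3
  · rw [surfaceMeasure, Measure.restrict_apply (measurable_prodMk_right hA)]
    rfl
  · rw [ENNReal.smul_def, smul_eq_mul, inter_comm]
    rfl

omit hΩ hρ hc in
/-- Euler's identity, the gauge being homogeneous of degree one about the centre. -/
theorem fderiv_bodyGauge_radial {p : Space d} {ξ : Space d →L[ℝ] ℝ}
    (hξ : HasFDerivAt (bodyGauge Ω c) ξ p) : ξ (p - c) = bodyGauge Ω c p := by
  have h1 : HasDerivAt (fun t : ℝ => bodyGauge Ω c (c + t • (p - c))) (ξ (p - c)) 1 := by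
    have hl : HasDerivAt (fun t : ℝ => c + t • (p - c)) (p - c) 1 := by
      simpa using ((hasDerivAt_id (1 : ℝ)).smul_const (p - c)).const_add c
    refine HasFDerivAt.comp_hasDerivAt (l := bodyGauge Ω c) (1 : ℝ) ?_ hl
    simpa using hξ
  have h2 : HasDerivAt (fun t : ℝ => bodyGauge Ω c (c + t • (p - c))) (bodyGauge Ω c p) 1 := by
    have : HasDerivAt (fun t : ℝ => t * bodyGauge Ω c p) (bodyGauge Ω c p) 1 := by
      simpa using (hasDerivAt_id (1 : ℝ)).mul_const (bodyGauge Ω c p)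
    refine this.congr_of_eventuallyEq ?_
    filter_upwards [lt_mem_nhds (zero_lt_one' ℝ)] with t ht
    rw [bodyGauge_homothety ht.le, add_sub_cancel]
  exact h1.unique h2

theorem fderiv_bodyGauge_le_one {p : Space d} {ξ : Space d →L[ℝ] ℝ}
    (hξ : HasFDerivAt (bodyGauge Ω c) ξ p) {y : Space d} (hy : y ∈ Ω) : ξ (y - c) ≤ 1 := by
  have h1 : HasDerivAt (fun t : ℝ => bodyGauge Ω c (p + t • (y - c))) (ξ (y - c)) 0 := by
    have hl : HasDerivAt (fun t : ℝ => p + t • (y - c)) (y - c) 0 := by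
      simpa using ((hasDerivAt_id (0 : ℝ)).smul_const (y - c)).const_add p
    refine HasFDerivAt.comp_hasDerivAt (l := bodyGauge Ω c) (0 : ℝ) ?_ hl
    simpa using hξ
  have h2 := (hasDerivAt_iff_tendsto_slope_zero.1 h1).mono_left
    (nhdsWithin_mono 0 (s := Ioi (0 : ℝ)) fun t ht => ne_of_gt ht)
  refine le_of_tendsto h2 ?_
  filter_upwards [self_mem_nhdsWithin] with t ht
  have ht' : (0 : ℝ) < t := ht
  have h3 := hΩ.bodyGauge_add_le hρ hc p (t • (y - c))
  rw [bodyGauge_homothety ht'.le, add_sub_cancel] at h3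
  have h4 := bodyGauge_le_one (c := c) hy
  rw [zero_add, zero_smul, add_zero, smul_eq_mul, inv_mul_le_iff₀ ht']
  nlinarith

/-- The derivative of the gauge is, up to sign and scaling, the inward normal; uniform convexity
becomes a quadratic bound for it. -/
theorem norm_sq_le_fderiv_bodyGauge {p : Space d} {ξ : Space d →L[ℝ] ℝ}
    (hξ : HasFDerivAt (bodyGauge Ω c) ξ p) (hp : 0 < bodyGauge Ω c p) {y : Space d} (hy : y ∈ Ω) :
    ‖y - bodyProj Ω c p‖ ^ 2
      ≤ (2 / κ + Metric.diam Ω) * Metric.diam Ω * (1 - ξ (y - c)) := by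
  have hκ := hΩ.pos
  set x := bodyProj Ω c p with hx
  have hxf : x ∈ frontier Ω := hΩ.bodyProj_mem_frontier hρ hc hp
  have hξx : ξ (x - c) = 1 := by
    rw [hx, bodyProj, add_sub_cancel_left, map_smul, fderiv_bodyGauge_radial hξ,
      smul_eq_mul, inv_mul_cancel₀ hp.ne']
  set u := (InnerProductSpace.toDual ℝ (Space d)).symm ξ with hu
  have hξu : ∀ v, ξ v = ⟪v, u⟫ := fun v => by
    rw [real_inner_comm, hu, InnerProductSpace.toDual_symm_apply]
  have hu0 : 0 < ‖u‖ := by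
    refine norm_pos_iff.2 fun h => ?_
    rw [hξu, h, inner_zero_right] at hξx
    exact zero_ne_one hξx
  have hval : ∀ z, ⟪z - x, -(‖u‖⁻¹ • u)⟫ = ‖u‖⁻¹ * (1 - ξ (z - c)) := fun z => by
    have h1 : ⟪z - x, u⟫ = ξ (z - c) - 1 := by
      rw [← hξu, ← hξx, ← map_sub]; congr 1; abel
    rw [inner_neg_right, real_inner_smul_right, h1]; ring
  have hn : IsInwardNormal Ω x (-(‖u‖⁻¹ • u)) := by
    refine ⟨?_, fun z hz => ?_⟩
    · rw [norm_neg, norm_smul, norm_inv, norm_norm, inv_mul_cancel₀ hu0.ne']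
    · rw [hval]
      have := hΩ.fderiv_bodyGauge_le_one hρ hc hξ hz
      exact mul_nonneg (by positivity) (by linarith)
  have h1 := hΩ.norm_sq_le hxf hy hn
  rw [hval] at h1
  have h2 : ‖u‖⁻¹ ≤ Metric.diam Ω := by
    have h3 := real_inner_le_norm (x - c) u
    rw [← hξu, hξx] at h3
    have h4 := hΩ.norm_sub_center_le hρ hc (hΩ.frontier_subset hxf)
    rw [inv_le_iff_one_le_mul₀ hu0]
    exact h3.trans (by gcongr)
  have h3 : 0 ≤ 1 - ξ (y - c) := by linarith [hΩ.fderiv_bodyGauge_le_one hρ hc hξ hy]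
  have h4 : (0 : ℝ) ≤ 2 / κ + Metric.diam Ω := by
    have : 0 ≤ Metric.diam Ω := Metric.diam_nonneg
    positivity
  calc _ ≤ (2 / κ + Metric.diam Ω) * (‖u‖⁻¹ * (1 - ξ (y - c))) := h1
    _ ≤ (2 / κ + Metric.diam Ω) * (Metric.diam Ω * (1 - ξ (y - c))) := by gcongr
    _ = _ := by ring

end IsUniformlyConvexDomain

end

/-! ### Interpolation towards one boundary point -/

section

variable {d : ℕ} {Ω : Set (Space d)} {κ : ℝ} {c : Space d}

/-- The interpolation map `(x, s) ↦ (1 - s) x + s T(x)` of a map `T`. -/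
noncomputable def interpolationMap (T : Space d → Space d) (q : Space d × ℝ) : Space d :=
  (1 - q.2) • q.1 + q.2 • T q.1

/-- The weight `(1 - s) ^ (d - 1) |x - T(x)| ^ 2`, a lower bound, up to a constant, for the Jacobian
of the interpolation map of `T` on the product of the boundary with `(0, 1)`. -/
noncomputable def coneWeight (T : Space d → Space d) (q : Space d × ℝ) : ℝ≥0∞ :=
  ENNReal.ofReal ((1 - q.2) ^ (d - 1) * ‖q.1 - T q.1‖ ^ 2)

/-- The product of the surface measure with the Lebesgue measure of the unit interval. -/
noncomputable def cylinderMeasure (Ω : Set (Space d)) : Measure (Space d × ℝ) :=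
  (surfaceMeasure Ω).prod (volume.restrict (Ioo (0 : ℝ) 1))

/-- The measure with density `coneWeight T` on the product of the boundary with `(0, 1)`. -/
noncomputable def coneMeasure (Ω : Set (Space d)) (T : Space d → Space d) :
    Measure (Space d × ℝ) :=
  (cylinderMeasure Ω).withDensity (coneWeight T)

theorem measurable_interpolationMap {T : Space d → Space d} (hT : Measurable T) :
    Measurable (interpolationMap T) := by
  unfold interpolationMap
  fun_prop

theorem measurable_coneWeight {T : Space d → Space d} (hT : Measurable T) :
    Measurable (coneWeight T) := by
  unfold coneWeight
  fun_prop

theorem det_smul_id_add_smulRight {a : ℝ} (ha : a ≠ 0) (hd : 1 ≤ d) (ξ : Space d →L[ℝ] ℝ)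
    (u : Space d) :
    (a • ContinuousLinearMap.id ℝ (Space d) + ξ.smulRight u).det = a ^ (d - 1) * (a + ξ u) := by
  have h : ((a • ContinuousLinearMap.id ℝ (Space d) + ξ.smulRight u :
      Space d →L[ℝ] Space d) : Space d →ₗ[ℝ] Space d)
      = a • LinearMap.transvection (ξ : Space d →ₗ[ℝ] ℝ) (a⁻¹ • u) := by
    ext1 v
    simp [LinearMap.transvection.apply, smul_smul, mul_left_comm a, ha]
  rw [ContinuousLinearMap.det, h, LinearMap.det_smul, LinearMap.transvection.det,
    finrank_euclideanSpace_fin]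
  obtain ⟨k, rfl⟩ : ∃ k, d = k + 1 := ⟨d - 1, by omega⟩
  simp only [ContinuousLinearMap.coe_coe, map_smul, smul_eq_mul, Nat.add_sub_cancel]
  field_simp
  ring

/-- The constant in the lower bound for the volume of cones over parts of the boundary. -/
noncomputable def coneConst (d : ℕ) (κ D : ℝ) : ℝ≥0 :=
  eilenbergConst d * (D ^ 2 / (4 * (2 / κ + D))).toNNReal⁻¹ *
    (2 ^ (d - 1) * ((2 / κ + D) * D)).toNNReal

namespace IsUniformlyConvexDomain

variable (hΩ : IsUniformlyConvexDomain Ω κ)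

include hΩ in
/-- Segments joining boundary points to a common boundary point meet only at that point. -/
theorem interpolation_injective {x x' y : Space d} (hx : x ∈ frontier Ω) (hx' : x' ∈ frontier Ω)
    (hy : y ∈ frontier Ω) (hxy : x ≠ y) (hx'y : x' ≠ y) {s s' : ℝ} (hs : s ∈ Ioo (0 : ℝ) 1)
    (hs' : s' ∈ Ioo (0 : ℝ) 1) (h : (1 - s) • x + s • y = (1 - s') • x' + s' • y) :
    x = x' ∧ s = s' := by
  have aux : ∀ {x x' : Space d} {s s' : ℝ}, x ∈ frontier Ω → x' ∈ frontier Ω → x' ≠ y →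
      s ∈ Ioo (0 : ℝ) 1 → s' ∈ Ioo (0 : ℝ) 1 →
      (1 - s) • x + s • y = (1 - s') • x' + s' • y → ¬ s < s' := by
    intro x x' s s' hx hx' hx'y hs hs' h hlt
    have h1 : 0 < 1 - s := by linarith [hs.2]
    have h2 : 0 < 1 - s' := by linarith [hs'.2]
    refine hΩ.notMem_frontier_of_mem_openSegment (hΩ.frontier_subset hx')
      (hΩ.frontier_subset hy) hx'y ?_ hx
    refine ⟨(1 - s') / (1 - s), (s' - s) / (1 - s), div_pos h2 h1, div_pos (by linarith) h1,
      by rw [← add_div, div_eq_one_iff_eq h1.ne']; ring, ?_⟩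
    have h3 : (1 - s) • x = (1 - s') • x' + (s' - s) • y := by
      rw [← sub_eq_iff_eq_add.2 h.symm.symm]; module
    rw [div_eq_inv_mul, div_eq_inv_mul, mul_smul, mul_smul, ← smul_add, ← h3, smul_smul,
      inv_mul_cancel₀ h1.ne', one_smul]
  have hss : s = s' := le_antisymm (not_lt.1 (aux hx' hx hxy hs' hs h.symm))
    (not_lt.1 (aux hx hx' hx'y hs hs' h))
  subst hss
  have h1 : 1 - s ≠ 0 := by linarith [hs.2]
  exact ⟨smul_right_injective _ h1 (add_right_cancel h), rfl⟩

variable {ρ : ℝ≥0} (hρ : 0 < ρ) (hc : Metric.ball c ρ ⊆ Ω)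

include hΩ hρ hc

omit hΩ hρ hc in
/-- The derivative of the interpolation towards a boundary point `y`, in polar coordinates. -/
theorem hasFDerivAt_interpolation {p y : Space d} {ξ : Space d →L[ℝ] ℝ}
    (hξ : HasFDerivAt (bodyGauge Ω c) ξ p) (hp : 0 < bodyGauge Ω c p) :
    HasFDerivAt (fun p => interpolationMap (fun _ => y) (bodyProj Ω c p, bodyGauge Ω c p - 1))
      ((2 / bodyGauge Ω c p - 1) • ContinuousLinearMap.id ℝ (Space d) +
        ξ.smulRight (y - c - (2 / bodyGauge Ω c p ^ 2) • (p - c))) p := by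
  have h1 : HasFDerivAt (fun p : Space d => (bodyGauge Ω c p)⁻¹)
      ((-(bodyGauge Ω c p ^ 2)⁻¹) • ξ) p := by
    exact (hasDerivAt_inv hp.ne').comp_hasFDerivAt p hξ
  have h2 : HasFDerivAt (bodyProj Ω c) _ p :=
    (h1.smul ((hasFDerivAt_id p).sub_const c)).const_add c
  have h3 := ((hξ.sub_const 1).const_sub 1).smul h2
  have h4 := (hξ.sub_const 1).smul_const y
  refine (h3.add h4).congr_fderiv ?_
  ext1 v
  have e : bodyProj Ω c p = c + (bodyGauge Ω c p)⁻¹ • (p - c) := rfl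
  simp only [e, add_apply, smul_apply,
    ContinuousLinearMap.smulRight_apply, ContinuousLinearMap.id_apply,
    neg_apply, id_eq, smul_eq_mul]
  set j := bodyGauge Ω c p
  have hj : j ≠ 0 := hp.ne'
  match_scalars <;> field_simp <;> ring

/-- The Jacobian of the interpolation towards `y` in polar coordinates is at least a multiple of
the cone weight. -/
theorem coneWeight_le_det (hd : 1 ≤ d) {p y : Space d} {ξ : Space d →L[ℝ] ℝ} (hy : y ∈ Ω)
    (hξ : HasFDerivAt (bodyGauge Ω c) ξ p) (hp : p ∈ bodyShell Ω c) :
    coneWeight (fun _ => y) (bodyProj Ω c p, bodyGauge Ω c p - 1) ≤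
      (2 ^ (d - 1) * ((2 / κ + Metric.diam Ω) * Metric.diam Ω)).toNNReal *
      ENNReal.ofReal |((2 / bodyGauge Ω c p - 1) • ContinuousLinearMap.id ℝ (Space d) +
        ξ.smulRight (y - c - (2 / bodyGauge Ω c p ^ 2) • (p - c))).det| := by
  have hp0 : 0 < bodyGauge Ω c p := by linarith [hp.1]
  have h1 := hΩ.norm_sq_le_fderiv_bodyGauge hρ hc hξ hp0 hy
  have h2 := fderiv_bodyGauge_radial hξ
  have h3 := hΩ.fderiv_bodyGauge_le_one hρ hc hξ hy
  set j := bodyGauge Ω c p with hj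
  have hj2 : j < 2 := hp.2
  have ha : 0 < 2 / j - 1 := by
    rw [sub_pos, lt_div_iff₀ hp0]; linarith
  rw [det_smul_id_add_smulRight ha.ne' hd, map_sub, map_smul, h2, smul_eq_mul]
  have e : 2 / j - 1 + (ξ (y - c) - 2 / j ^ 2 * j) = -(1 - ξ (y - c)) := by
    field_simp; ring
  have h4 : 0 ≤ 1 - ξ (y - c) := by linarith
  rw [e, mul_neg, abs_neg, abs_of_nonneg (by positivity)]
  have hκ := hΩ.pos
  have hD : 0 ≤ Metric.diam Ω := Metric.diam_nonneg
  rw [← ENNReal.ofReal_coe_nnreal, ← ENNReal.ofReal_mul (by positivity),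
    Real.coe_toNNReal _ (by positivity), coneWeight]
  refine ENNReal.ofReal_le_ofReal ?_
  -- With `s = j - 1`, the factor `1 - s` of the weight is compared with the factor `(1 - s) / j` of
  -- the Jacobian, where `j < 2`.
  have h5 : 1 - (j - 1) ≤ 2 * (2 / j - 1) := by
    have : 2 * (2 / j - 1) - (1 - (j - 1)) = (2 - j) ^ 2 / j := by field_simp; ring
    have : 0 ≤ (2 - j) ^ 2 / j := by positivity
    linarith
  have h6 : 0 ≤ 1 - (j - 1) := by linarith
  rw [norm_sub_rev]
  calc (1 - (j - 1)) ^ (d - 1) * ‖y - bodyProj Ω c p‖ ^ 2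
      ≤ (2 * (2 / j - 1)) ^ (d - 1) *
        ((2 / κ + Metric.diam Ω) * Metric.diam Ω * (1 - ξ (y - c))) := by gcongr
    _ = _ := by rw [mul_pow]; ring

/-- The image of the cone measure with apex `y` is at most a multiple of the volume. -/
theorem coneMeasure_const_preimage_le (hd : 2 ≤ d) {y : Space d} (hy : y ∈ frontier Ω)
    {B : Set (Space d)} (hB : MeasurableSet B) :
    coneMeasure Ω (fun _ => y) (interpolationMap (fun _ => y) ⁻¹' B) ≤
      (eilenbergConst d * ρ⁻¹ *
        (2 ^ (d - 1) * ((2 / κ + Metric.diam Ω) * Metric.diam Ω)).toNNReal : ℝ≥0) *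
        volume B := by
  have hw := measurable_coneWeight (d := d) (measurable_const (a := y))
  have hF := measurable_interpolationMap (d := d) (measurable_const (a := y))
  have hm : Measurable fun p : Space d => (bodyProj Ω c p, bodyGauge Ω c p - 1) :=
    (hΩ.measurable_bodyProj hρ hc).prodMk
      ((hΩ.continuous_bodyGauge hρ hc).measurable.sub_const 1)
  set Ψ : Space d → Space d :=
    fun p => interpolationMap (fun _ => y) (bodyProj Ω c p, bodyGauge Ω c p - 1) with hΨ
  have hΨm : Measurable Ψ := hF.comp hm
  set A := 2 ^ (d - 1) * ((2 / κ + Metric.diam Ω) * Metric.diam Ω) with hA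
  -- The part of the shell where the change of variables takes place
  set S : Set (Space d) := {p | DifferentiableAt ℝ (bodyGauge Ω c) p} ∩ bodyShell Ω c ∩
    {p | bodyProj Ω c p ≠ y} ∩ Ψ ⁻¹' B with hS
  have hSm : MeasurableSet S :=
    (((measurableSet_of_differentiableAt ℝ _).inter
      (hΩ.isOpen_bodyShell hρ hc).measurableSet).inter
      (hΩ.measurable_bodyProj hρ hc (measurableSet_singleton y)).compl).inter (hΨm hB)
  have hdiff : ∀ p ∈ S, HasFDerivAt (bodyGauge Ω c) (fderiv ℝ (bodyGauge Ω c) p) p :=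
    fun p hp => DifferentiableAt.hasFDerivAt hp.1.1.1
  have hinj : InjOn Ψ S := by
    rintro p ⟨⟨⟨-, hp⟩, hpy⟩, -⟩ q ⟨⟨⟨-, hq⟩, hqy⟩, -⟩ hpq
    have hp0 : 0 < bodyGauge Ω c p := by linarith [hp.1]
    have hq0 : 0 < bodyGauge Ω c q := by linarith [hq.1]
    obtain ⟨h1, h2⟩ := hΩ.interpolation_injective (hΩ.bodyProj_mem_frontier hρ hc hp0)
      (hΩ.bodyProj_mem_frontier hρ hc hq0) hy hpy hqy
      ⟨by linarith [hp.1], by linarith [hp.2]⟩ ⟨by linarith [hq.1], by linarith [hq.2]⟩ hpq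
    rw [eq_homothety_bodyProj hp0, eq_homothety_bodyProj hq0, h1]
    congr 2
    linarith
  have hcv := lintegral_abs_det_fderiv_eq_addHaar_image volume hSm
    (fun p hp => (hasFDerivAt_interpolation (y := y) (hdiff p hp)
      (by linarith [hp.1.1.2.1])).hasFDerivWithinAt) hinj
  have hae : ∀ᵐ p ∂(volume : Measure (Space d)), DifferentiableAt ℝ (bodyGauge Ω c) p :=
    (hΩ.lipschitzWith_bodyGauge hρ hc).ae_differentiableAt
  calc coneMeasure Ω (fun _ => y) (interpolationMap (fun _ => y) ⁻¹' B)
      = ∫⁻ q in interpolationMap (fun _ => y) ⁻¹' B, coneWeight (fun _ => y) q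
          ∂(cylinderMeasure Ω) := withDensity_apply _ (hF hB)
    _ ≤ ∫⁻ q in interpolationMap (fun _ => y) ⁻¹' B, coneWeight (fun _ => y) q
          ∂((eilenbergConst d * ρ⁻¹ : ℝ≥0) •
            (volume.restrict (bodyShell Ω c)).map
              (fun p => (bodyProj Ω c p, bodyGauge Ω c p - 1))) :=
        lintegral_mono' (Measure.restrict_mono' (Eventually.of_forall fun _ h => h)
          (hΩ.surfaceMeasure_prod_le hρ hc hd)) le_rfl
    _ = (eilenbergConst d * ρ⁻¹ : ℝ≥0) * ∫⁻ p in Ψ ⁻¹' B ∩ bodyShell Ω c,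
          coneWeight (fun _ => y) (bodyProj Ω c p, bodyGauge Ω c p - 1) := by
        rw [Measure.restrict_smul, lintegral_smul_measure, setLIntegral_map (hF hB) hw hm,
          Measure.restrict_restrict (hm (hF hB)), ENNReal.smul_def, smul_eq_mul]
        rfl
    _ ≤ (eilenbergConst d * ρ⁻¹ : ℝ≥0) * ∫⁻ p in S, A.toNNReal * ENNReal.ofReal
          |((2 / bodyGauge Ω c p - 1) • ContinuousLinearMap.id ℝ (Space d) +
            (fderiv ℝ (bodyGauge Ω c) p).smulRight
              (y - c - (2 / bodyGauge Ω c p ^ 2) • (p - c))).det| := by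
        refine mul_le_mul_right ?_ _
        rw [← lintegral_indicator ((hΨm hB).inter (hΩ.isOpen_bodyShell hρ hc).measurableSet),
          ← lintegral_indicator hSm]
        refine lintegral_mono_ae ?_
        filter_upwards [hae] with p hp
        by_cases hpB : p ∈ Ψ ⁻¹' B ∩ bodyShell Ω c
        · rw [indicator_of_mem hpB]
          by_cases hpy : bodyProj Ω c p = y
          · simp [coneWeight, hpy]
          · rw [indicator_of_mem (show p ∈ S from ⟨⟨⟨hp, hpB.2⟩, hpy⟩, hpB.1⟩)]
            exact hΩ.coneWeight_le_det hρ hc (by omega) (hΩ.frontier_subset hy)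
              hp.hasFDerivAt hpB.2
        · rw [indicator_of_notMem hpB]
          exact zero_le
    _ = (eilenbergConst d * ρ⁻¹ : ℝ≥0) * (A.toNNReal * volume (Ψ '' S)) := by
        rw [lintegral_const_mul' _ _ ENNReal.coe_ne_top, hcv]
    _ ≤ (eilenbergConst d * ρ⁻¹ : ℝ≥0) * (A.toNNReal * volume B) := by
        gcongr
        rintro _ ⟨p, hp, rfl⟩
        exact hp.2
    _ = _ := by rw [← mul_assoc, ← ENNReal.coe_mul]

omit hρ hc in
theorem diam_pos (hd : 1 ≤ d) : 0 < Metric.diam Ω := by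
  refine Metric.diam_nonneg.lt_of_ne' fun h0 => ?_
  have : Nonempty (Fin d) := ⟨⟨0, hd⟩⟩
  obtain ⟨z, hz⟩ := hΩ.nonempty_interior
  have hsub : Ω ⊆ {z} := fun x hx => by
    have := Metric.dist_le_diam_of_mem hΩ.isCompact.isBounded hx (interior_subset hz)
    rw [h0] at this
    exact dist_le_zero.1 this
  have := interior_mono hsub hz
  rw [interior_singleton] at this
  exact this

omit hρ hc in
/-- A centre and a radius, depending only on the curvature bound and on the diameter. -/
theorem exists_center (hd : 1 ≤ d) :
    0 < (Metric.diam Ω ^ 2 / (4 * (2 / κ + Metric.diam Ω))).toNNReal ∧ ∃ c, Metric.ball c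
      ((Metric.diam Ω ^ 2 / (4 * (2 / κ + Metric.diam Ω))).toNNReal : ℝ) ⊆ Ω := by
  have hD := hΩ.diam_pos hd
  have hκ := hΩ.pos
  have hpos : 0 < Metric.diam Ω ^ 2 / (4 * (2 / κ + Metric.diam Ω)) := by positivity
  refine ⟨Real.toNNReal_pos.2 hpos, ?_⟩
  rw [Real.coe_toNNReal _ hpos.le]
  obtain ⟨c, -, hc⟩ := hΩ.exists_ball_subset
  exact ⟨c, hc⟩

omit hρ hc in
/-- The volume swept by the segments from a part of the boundary to a boundary point `y` is at least
a multiple of the integral of the cone weight. -/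
theorem coneMeasure_const_le (hd : 2 ≤ d) {y : Space d} (hy : y ∈ frontier Ω)
    {B : Set (Space d)} (hB : MeasurableSet B) :
    coneMeasure Ω (fun _ => y) (interpolationMap (fun _ => y) ⁻¹' B) ≤
      coneConst d κ (Metric.diam Ω) * volume B := by
  obtain ⟨hρ, c, hc⟩ := hΩ.exists_center (by omega)
  exact hΩ.coneMeasure_const_preimage_le hρ hc hd hy hB

omit hρ hc in
theorem finite_surfaceMeasure (hd : 2 ≤ d) : IsFiniteMeasure (surfaceMeasure Ω) := by
  obtain ⟨hρ, c, hc⟩ := hΩ.exists_center (by omega)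
  exact hΩ.isFiniteMeasure_surfaceMeasure hρ hc hd

end IsUniformlyConvexDomain

end

/-! ### Kantorovich duality on a compact space -/

section

section Duality

variable {K : Type*} [MetricSpace K] [CompactSpace K] [Nonempty K]

/-- A continuous pseudometric on a topological space, as a real function of two variables. -/
structure IsContinuousPseudometric (c : K → K → ℝ) : Prop where
  continuous : Continuous fun p : K × K => c p.1 p.2
  self : ∀ x, c x x = 0
  symm : ∀ x y, c x y = c y x
  triangle : ∀ x y z, c x z ≤ c x y + c y z

/-- `u` is `1`-Lipschitz for the pseudometric `c`. -/
def IsPotential (c : K → K → ℝ) (u : K → ℝ) : Prop := ∀ x y, u x - u y ≤ c x y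

variable {c : K → K → ℝ} (hc : IsContinuousPseudometric c)
include hc

omit [CompactSpace K] [Nonempty K] in
theorem IsContinuousPseudometric.tendsto_left (x₀ : K) :
    Tendsto (fun x => c x₀ x) (𝓝 x₀) (𝓝 0) := by
  have : Continuous fun x => c x₀ x := hc.continuous.comp (f := fun x => (x₀, x)) (by fun_prop)
  simpa [hc.self] using this.tendsto x₀

omit [CompactSpace K] [Nonempty K] in
theorem IsContinuousPseudometric.abs_sub_le {u : K → ℝ} {a : ℝ}
    (h : ∀ x y, u x - u y ≤ a * c x y) (x y : K) : |u x - u y| ≤ a * c x y := by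
  rw [abs_sub_le_iff]
  exact ⟨h x y, hc.symm x y ▸ h y x⟩

omit [CompactSpace K] [Nonempty K] in
theorem IsContinuousPseudometric.continuous_of_sub_le {u : K → ℝ} {a : ℝ}
    (h : ∀ x y, u x - u y ≤ a * c x y) : Continuous u := by
  refine continuous_iff_continuousAt.2 fun x₀ => ?_
  rw [ContinuousAt, tendsto_iff_dist_tendsto_zero]
  have h0 : Tendsto (fun x => a * c x₀ x) (𝓝 x₀) (𝓝 0) := by
    simpa using (hc.tendsto_left x₀).const_mul a
  refine squeeze_zero (fun _ => dist_nonneg) (fun x => ?_) h0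
  rw [dist_comm, Real.dist_eq]
  exact hc.abs_sub_le h x₀ x

/-- The infimal convolution of a continuous function with a multiple of the pseudometric. -/
theorem IsContinuousPseudometric.exists_infConvolution (ψ : C(K, ℝ)) {a : ℝ} (ha : 0 ≤ a) :
    ∃ u : C(K, ℝ), (∀ x y, u x - u y ≤ a * c x y) ∧ (∀ x, u x ≤ ψ x) ∧
      ∀ x, ∃ y, u x = ψ y + a * c x y := by
  have hcont : ∀ x, Continuous fun y => ψ y + a * c x y := fun x => by
    have : Continuous fun y => c x y := hc.continuous.comp (f := fun y => (x, y)) (by fun_prop)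
    fun_prop
  choose m hm using fun x => (isCompact_univ (X := K)).exists_isMinOn univ_nonempty
    (hcont x).continuousOn
  have hmin : ∀ x y, ψ (m x) + a * c x (m x) ≤ ψ y + a * c x y := fun x y =>
    isMinOn_iff.1 (hm x).2 y (mem_univ y)
  have hlip : ∀ x y, (ψ (m x) + a * c x (m x)) - (ψ (m y) + a * c y (m y)) ≤ a * c x y :=
    fun x y => by
      have h1 := hmin x (m y)
      have h2 := mul_le_mul_of_nonneg_left (hc.triangle x y (m y)) ha
      linarith
  refine ⟨⟨fun x => ψ (m x) + a * c x (m x), hc.continuous_of_sub_le hlip⟩, hlip,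
    fun x => ?_, fun x => ⟨m x, rfl⟩⟩
  have := hmin x x
  rw [hc.self, mul_zero, add_zero] at this
  exact this

variable [MeasurableSpace K] [BorelSpace K] (μ ν : Measure K) [IsFiniteMeasure μ]
  [IsFiniteMeasure ν]

/-- The dual problem of optimal transport has a solution, by the theorem of Arzelà and Ascoli. -/
theorem IsContinuousPseudometric.exists_isMax_dual (hμν : μ univ = ν univ) :
    ∃ w : C(K, ℝ), IsPotential c w ∧ ∀ u : C(K, ℝ), IsPotential c u →
      ∫ x, u x ∂μ - ∫ x, u x ∂ν ≤ ∫ x, w x ∂μ - ∫ x, w x ∂ν := by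
  set x₀ : K := Classical.arbitrary K
  obtain ⟨M, hM⟩ := (isCompact_univ (X := K × K)).bddAbove_image hc.continuous.continuousOn
  have hM' : ∀ x y, c x y ≤ M := fun x y => hM ⟨(x, y), mem_univ _, rfl⟩
  let A : Set (BoundedContinuousFunction K ℝ) := {u | (∀ x y, u x - u y ≤ c x y) ∧ u x₀ = 0}
  have hAcl : IsClosed A := by
    have hev : ∀ x, Continuous fun u : BoundedContinuousFunction K ℝ => u x := fun x =>
      continuous_eval_const x
    have hA : A = (⋂ x, ⋂ y, {u | u x - u y ≤ c x y}) ∩ {u | u x₀ = 0} := by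
      ext u
      simp [A]
    rw [hA]
    exact (isClosed_iInter fun x => isClosed_iInter fun y =>
      isClosed_le ((hev x).sub (hev y)) continuous_const).inter
      (isClosed_eq (hev x₀) continuous_const)
  have hAcomp : IsCompact A := by
    refine BoundedContinuousFunction.arzela_ascoli₂ (Icc (-M) M) isCompact_Icc A hAcl ?_ ?_
    · rintro u x ⟨h1, h2⟩
      have ha := h1 x x₀
      have hb := h1 x₀ x
      rw [h2] at ha hb
      exact ⟨by linarith [hM' x₀ x], by linarith [hM' x x₀]⟩
    · intro y₀
      rw [Metric.equicontinuousAt_iff_right]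
      intro ε hε
      filter_upwards [(hc.tendsto_left y₀).eventually (gt_mem_nhds hε)] with y hy u
      rw [Real.dist_eq]
      refine lt_of_le_of_lt ?_ hy
      simpa using hc.abs_sub_le (a := 1) (u := (u : BoundedContinuousFunction K ℝ))
        (fun x y => by rw [one_mul]; exact u.2.1 x y) y₀ y
  have hint : ∀ m : Measure K, IsFiniteMeasure m →
      Continuous fun u : BoundedContinuousFunction K ℝ => ∫ x, u x ∂m := fun m hm => by
    refine LipschitzWith.continuous (K := (m univ).toNNReal)
      (LipschitzWith.of_dist_le_mul fun u v => ?_)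
    rw [dist_eq_norm, dist_eq_norm, ← integral_sub (u.integrable m) (v.integrable m)]
    exact (u - v).norm_integral_le_mul_norm m
  obtain ⟨w, hwA, hw⟩ := hAcomp.exists_isMaxOn ⟨0, fun x y => by
      have h1 := hc.triangle x y x
      rw [hc.self, hc.symm y x] at h1
      simp only [BoundedContinuousFunction.coe_zero, Pi.zero_apply, sub_zero]
      linarith, rfl⟩
    ((hint μ inferInstance).sub (hint ν inferInstance)).continuousOn
  refine ⟨w.toContinuousMap, hwA.1, fun u hu => ?_⟩
  -- Normalize the competitor at the base point
  let u' : BoundedContinuousFunction K ℝ :=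
    BoundedContinuousFunction.mkOfCompact (u - ContinuousMap.const K (u x₀))
  have hu' : ∀ x, u' x = u x - u x₀ := fun x => rfl
  have h1 := isMaxOn_iff.1 hw u' ⟨fun x y => by rw [hu', hu', sub_sub_sub_cancel_right]; exact hu x y,
    by rw [hu', sub_self]⟩
  have hui : ∀ m : Measure K, IsFiniteMeasure m → Integrable (fun x => u x) m := fun m _ =>
    (BoundedContinuousFunction.mkOfCompact u).integrable m
  simp only [Pi.sub_apply, hu'] at h1
  rw [integral_sub (hui μ inferInstance) (integrable_const _),
    integral_sub (hui ν inferInstance) (integrable_const _), integral_const, integral_const,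
    measureReal_def, measureReal_def, hμν, sub_sub_sub_cancel_right] at h1
  exact h1

/-- Weak duality in the form used for the extension of functionals. -/
theorem IsContinuousPseudometric.dual_nonneg (hμν : μ univ = ν univ) {V : ℝ}
    (hV : ∀ u : C(K, ℝ), IsPotential c u → ∫ x, u x ∂μ - ∫ x, u x ∂ν ≤ V)
    (φ ψ : C(K, ℝ)) {a : ℝ} (ha : 0 ≤ a) (h : ∀ x y, 0 ≤ φ x + ψ y + a * c x y) :
    0 ≤ ∫ x, φ x ∂μ + ∫ x, ψ x ∂ν + a * V := by
  have hi : ∀ (u : C(K, ℝ)) (m : Measure K), IsFiniteMeasure m → Integrable (fun x => u x) m :=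
    fun u m _ => (BoundedContinuousFunction.mkOfCompact u).integrable m
  obtain ⟨u, hu1, hu2, hu3⟩ := hc.exists_infConvolution ψ ha
  have h1 : -∫ x, φ x ∂μ ≤ ∫ x, u x ∂μ := by
    rw [← integral_neg]
    refine integral_mono (hi φ μ inferInstance).neg (hi u μ inferInstance) fun x => ?_
    obtain ⟨y, hy⟩ := hu3 x
    have := h x y
    simp only
    linarith
  have h2 : ∫ x, u x ∂ν ≤ ∫ x, ψ x ∂ν :=
    integral_mono (hi u ν inferInstance) (hi ψ ν inferInstance) hu2
  have h3 : ∫ x, u x ∂μ - ∫ x, u x ∂ν ≤ a * V := by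
    rcases ha.eq_or_lt with rfl | ha
    · set x₀ : K := Classical.arbitrary K
      have : ∀ x, u x = u x₀ := fun x => by
        have h1 := hu1 x x₀
        have h2 := hu1 x₀ x
        linarith
      simp [this, measureReal_def, hμν]
    · have := hV (a⁻¹ • u) fun x y => by
        have := hu1 x y
        simp only [ContinuousMap.coe_smul, Pi.smul_apply, smul_eq_mul]
        rw [← mul_sub, inv_mul_le_iff₀ ha]
        exact this
      simp only [ContinuousMap.coe_smul, Pi.smul_apply, smul_eq_mul] at this
      rwa [integral_const_mul, integral_const_mul, ← mul_sub, inv_mul_le_iff₀ ha] at this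
  linarith

/-- A functional representing an optimal plan: the bound, used for `F` and `-F`, forces the
marginals to be `μ` and `ν` and the cost to be at most `V`. It is obtained from the extension
theorem of M. Riesz. -/
theorem IsContinuousPseudometric.exists_functional (hμν : μ univ = ν univ) {V : ℝ}
    (hV : ∀ u : C(K, ℝ), IsPotential c u → ∫ x, u x ∂μ - ∫ x, u x ∂ν ≤ V) :
    ∃ L : C(K × K, ℝ) →ₗ[ℝ] ℝ, ∀ (F : C(K × K, ℝ)) (φ ψ : C(K, ℝ)) (a : ℝ), 0 ≤ a →
      (∀ x y, F (x, y) ≤ φ x + ψ y + a * c x y) →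
      L F ≤ ∫ x, φ x ∂μ + ∫ x, ψ x ∂ν + a * V := by
  have hi : ∀ (u : C(K, ℝ)) (m : Measure K), IsFiniteMeasure m → Integrable (fun x => u x) m :=
    fun u m _ => (BoundedContinuousFunction.mkOfCompact u).integrable m
  -- The cone is the epigraph of the functional that maps `F` to the least value of
  -- `∫ φ dμ + ∫ ψ dν + a V` over all majorants `φ x + ψ y + a c x y` of `F`.
  let S : PointedCone ℝ (C(K × K, ℝ) × ℝ) :=
    { carrier := {p | ∃ (φ ψ : C(K, ℝ)) (a : ℝ), 0 ≤ a ∧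
        (∀ x y, p.1 (x, y) ≤ φ x + ψ y + a * c x y) ∧
        ∫ x, φ x ∂μ + ∫ x, ψ x ∂ν + a * V ≤ p.2}
      add_mem' := by
        rintro p q ⟨φ, ψ, a, ha, h1, h2⟩ ⟨φ', ψ', a', ha', h1', h2'⟩
        refine ⟨φ + φ', ψ + ψ', a + a', by positivity, fun x y => ?_, ?_⟩
        · have := h1 x y
          have := h1' x y
          simp only [Prod.fst_add, ContinuousMap.add_apply]
          linarith
        · simp only [ContinuousMap.add_apply, Prod.snd_add]
          rw [integral_add (hi _ μ inferInstance) (hi _ μ inferInstance),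
            integral_add (hi _ ν inferInstance) (hi _ ν inferInstance)]
          linarith
      zero_mem' := ⟨0, 0, 0, le_rfl, by simp, by simp⟩
      smul_mem' := by
        rintro ⟨r, hr⟩ p ⟨φ, ψ, a, ha, h1, h2⟩
        refine ⟨r • φ, r • ψ, r * a, by positivity, fun x y => ?_, ?_⟩
        · have := mul_le_mul_of_nonneg_left (h1 x y) hr
          change r * p.1 (x, y) ≤ r * φ x + r * ψ y + r * a * c x y
          linarith
        · have := mul_le_mul_of_nonneg_left h2 hr
          change ∫ x, r * φ x ∂μ + ∫ x, r * ψ x ∂ν + r * a * V ≤ r * p.2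
          rw [integral_const_mul, integral_const_mul]
          linarith }
  let f : (C(K × K, ℝ) × ℝ) →ₗ.[ℝ] ℝ :=
    { domain := Submodule.prod ⊥ ⊤
      toFun := (LinearMap.snd ℝ (C(K × K, ℝ)) ℝ).comp (Submodule.subtype _) }
  have hfdom : ∀ r : ℝ, ((0, r) : C(K × K, ℝ) × ℝ) ∈ f.domain := fun r =>
    Submodule.mem_prod.2 ⟨rfl, trivial⟩
  obtain ⟨g, hg1, hg2⟩ := riesz_extension S f (by
    rintro ⟨⟨F, r⟩, hF⟩ ⟨φ, ψ, a, ha, h1, h2⟩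
    have hF0 : F = 0 := (Submodule.mem_prod.1 hF).1
    change 0 ≤ r
    refine le_trans (hc.dual_nonneg μ ν hμν hV φ ψ ha fun x y => ?_) h2
    simpa [hF0] using h1 x y) (by
    rintro ⟨F, r⟩
    obtain ⟨M, hM⟩ := (isCompact_univ (X := K × K)).bddAbove_image F.continuous.continuousOn
    have hM' : ∀ p, F p ≤ M := fun p => hM ⟨p, mem_univ _, rfl⟩
    refine ⟨⟨(0, ∫ _, M ∂μ - r), hfdom _⟩, ContinuousMap.const K M, 0, 0, le_rfl,
      fun x y => ?_, ?_⟩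
    · simpa using hM' (x, y)
    · simp)
  refine ⟨-(g.comp (LinearMap.inl ℝ (C(K × K, ℝ)) ℝ)), fun F φ ψ a ha h => ?_⟩
  set R := ∫ x, φ x ∂μ + ∫ x, ψ x ∂ν + a * V with hR
  have h1 : 0 ≤ g (F, R) := hg2 _ ⟨φ, ψ, a, ha, h, le_rfl⟩
  have h2 : g (0, R) = R := hg1 ⟨(0, R), hfdom R⟩
  have h3 : g (F, R) = g (F, 0) + g (0, R) := by rw [← map_add]; simp
  simp only [LinearMap.neg_apply, LinearMap.comp_apply, LinearMap.inl_apply]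
  linarith

/-- **Kantorovich duality** for a continuous pseudometric on a compact space: there are a potential
and a plan such that the plan is concentrated where the potential decreases at full rate. -/
theorem IsContinuousPseudometric.exists_potential_plan (hμν : μ univ = ν univ) :
    ∃ w : K → ℝ, IsPotential c w ∧ ∃ γ : Measure (K × K), γ.map Prod.fst = μ ∧
      γ.map Prod.snd = ν ∧ ∀ᵐ z ∂γ, w z.1 - w z.2 = c z.1 z.2 := by
  obtain ⟨w, hw, hmax⟩ := hc.exists_isMax_dual μ ν hμν
  obtain ⟨L, hL⟩ := hc.exists_functional μ ν hμν hmax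
  have hLneg : ∀ F : C(K × K, ℝ), (∀ p, 0 ≤ F p) → 0 ≤ L F := fun F hF => by
    have := hL (-F) 0 0 0 le_rfl fun x y => by simpa using hF (x, y)
    simpa using this
  let Λ : CompactlySupportedContinuousMap (K × K) ℝ →ₚ[ℝ] ℝ := PositiveLinearMap.mk₀
    { toFun := fun F => L F.toContinuousMap
      map_add' := fun F G => L.map_add F.toContinuousMap G.toContinuousMap
      map_smul' := fun r F => L.map_smul r F.toContinuousMap }
    fun F hF => hLneg _ fun p => hF p
  let γ := RealRMK.rieszMeasure Λ
  have hγ : ∀ F : C(K × K, ℝ), ∫ p, F p ∂γ = L F := fun F =>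
    RealRMK.integral_rieszMeasure Λ ⟨F, HasCompactSupport.of_compactSpace _⟩
  have hfst : γ.map Prod.fst = μ := by
    refine ext_of_forall_integral_eq_of_IsFiniteMeasure fun φ => ?_
    rw [integral_map (by fun_prop) (by fun_prop)]
    have e := hγ (φ.toContinuousMap.comp ContinuousMap.fst)
    refine e.trans (le_antisymm ?_ ?_)
    · have := hL (φ.toContinuousMap.comp ContinuousMap.fst) φ.toContinuousMap 0 0 le_rfl
        fun x y => by simp
      simpa using this
    · have := hL (-(φ.toContinuousMap.comp ContinuousMap.fst)) (-φ.toContinuousMap) 0 0 le_rfl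
        fun x y => by simp
      rw [map_neg] at this
      simp only [ContinuousMap.neg_apply, integral_neg, ContinuousMap.zero_apply,
        integral_zero] at this
      simp at this
      exact this
  have hsnd : γ.map Prod.snd = ν := by
    refine ext_of_forall_integral_eq_of_IsFiniteMeasure fun φ => ?_
    rw [integral_map (by fun_prop) (by fun_prop)]
    have e := hγ (φ.toContinuousMap.comp ContinuousMap.snd)
    refine e.trans (le_antisymm ?_ ?_)
    · have := hL (φ.toContinuousMap.comp ContinuousMap.snd) 0 φ.toContinuousMap 0 le_rfl
        fun x y => by simp
      simpa using this
    · have := hL (-(φ.toContinuousMap.comp ContinuousMap.snd)) 0 (-φ.toContinuousMap) 0 le_rfl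
        fun x y => by simp
      rw [map_neg] at this
      simp only [ContinuousMap.neg_apply, integral_neg, ContinuousMap.zero_apply,
        integral_zero] at this
      simp at this
      exact this
  refine ⟨w, hw, γ, hfst, hsnd, ?_⟩
  -- The nonnegative function `c x y - (w x - w y)` has nonpositive integral
  let C : C(K × K, ℝ) := ⟨fun p => c p.1 p.2, hc.continuous⟩
  let G : C(K × K, ℝ) := C - (w.comp ContinuousMap.fst - w.comp ContinuousMap.snd)
  have hG0 : ∀ p, 0 ≤ G p := fun p => sub_nonneg.2 (hw p.1 p.2)
  have hGint : ∫ p, G p ∂γ ≤ 0 := by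
    rw [hγ]
    refine (hL G (-w) w 1 zero_le_one fun x y => ?_).trans (le_of_eq ?_)
    · change c x y - (w x - w y) ≤ -w x + w y + 1 * c x y
      linarith
    · simp only [ContinuousMap.neg_apply, integral_neg]
      ring
  have hGi : Integrable (fun p => G p) γ := (BoundedContinuousFunction.mkOfCompact G).integrable γ
  have := (integral_eq_zero_iff_of_nonneg hG0 hGi).1
    (le_antisymm hGint (integral_nonneg hG0))
  filter_upwards [this] with p hp
  have : c p.1 p.2 - (w p.1 - w p.2) = 0 := hp
  linarith

end Duality

end

/-! ### Points of contact of a potential -/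

section

variable {d : ℕ} {Ω : Set (Space d)} {κ : ℝ} {c : Space d} {N : Seminorm ℝ (Space d)}

theorem continuous_seminorm (N : Seminorm ℝ (Space d)) : Continuous N :=
  continuousOn_univ.1 (N.convexOn.continuousOn isOpen_univ)

theorem exists_seminorm_le (N : Seminorm ℝ (Space d)) : ∃ C : ℝ≥0, ∀ v, N v ≤ C * ‖v‖ := by
  obtain ⟨C, hC, h⟩ := Seminorm.bound_of_continuous_normedSpace N (continuous_seminorm N)
  exact ⟨⟨C, hC.le⟩, h⟩

theorem IsStrictlyConvexNorm.pos (hN : IsStrictlyConvexNorm N) {v : Space d} (hv : v ≠ 0) :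
    0 < N v := (apply_nonneg N v).lt_of_ne' fun h => hv (hN.eq_zero v h)

/-- Equality in the triangle inequality of a strictly convex norm. -/
theorem IsStrictlyConvexNorm.smul_eq_smul_of_add_eq (hN : IsStrictlyConvexNorm N) {a b : Space d}
    (h : N a + N b ≤ N (a + b)) : N b • a = N a • b := by
  by_cases ha : a = 0
  · simp [ha]
  by_cases hb : b = 0
  · simp [hb]
  have ha0 := hN.pos ha
  have hb0 := hN.pos hb
  by_contra hne
  set t := N a + N b with ht
  have ht0 : 0 < t := by positivity
  have hunit : ∀ v, v ≠ 0 → (N v)⁻¹ • v ∈ N.closedBall 0 1 := fun v hv => by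
    have := hN.pos hv
    rw [Seminorm.mem_closedBall_zero, map_smul_eq_mul, norm_inv, Real.norm_of_nonneg this.le,
      inv_mul_cancel₀ this.ne']
  have hne' : (N a)⁻¹ • a ≠ (N b)⁻¹ • b := fun h' => hne <| by
    have e1 : N b • a = (N a * N b) • (N a)⁻¹ • a := by
      rw [smul_smul]; congr 1; field_simp
    have e2 : N a • b = (N a * N b) • (N b)⁻¹ • b := by
      rw [smul_smul]; congr 1; field_simp
    rw [e1, e2, h']
  have hint := hN.strictConvex (hunit a ha) (hunit b hb) hne' (a := N a / t) (b := N b / t)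
    (by positivity) (by positivity) (by rw [← add_div, div_self ht0.ne'])
  have e : (N a / t) • (N a)⁻¹ • a + (N b / t) • (N b)⁻¹ • b = t⁻¹ • (a + b) := by
    rw [smul_smul, smul_smul, smul_add]
    congr 2 <;> field_simp
  rw [e] at hint
  obtain ⟨ε, hε, hmem⟩ := exists_pos_sub_smul_mem hint (-(t⁻¹ • (a + b)))
  rw [Seminorm.mem_closedBall_zero] at hmem
  have e2 : t⁻¹ • (a + b) - ε • -(t⁻¹ • (a + b)) = ((1 + ε) * t⁻¹) • (a + b) := by module
  rw [e2, map_smul_eq_mul, Real.norm_of_nonneg (by positivity)] at hmem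
  have h3 : 1 ≤ t⁻¹ * N (a + b) := by
    rw [← inv_mul_cancel₀ ht0.ne']; gcongr
  nlinarith

/-- `y` is a point of contact of `x` for the potential `w`: another boundary point, towards which
`w` decreases from `x` at full rate. -/
def IsContact (N : Seminorm ℝ (Space d)) (Ω : Set (Space d)) (w : Space d → ℝ) (x y : Space d) :
    Prop :=
  y ∈ frontier Ω ∧ y ≠ x ∧ w x - w y = N (x - y)

/-- `w` is a potential on the boundary of `Ω`: it is `1`-Lipschitz there for the norm `N`. -/
def IsBoundaryPotential (N : Seminorm ℝ (Space d)) (Ω : Set (Space d)) (w : Space d → ℝ) : Prop :=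
  ∀ x ∈ frontier Ω, ∀ y ∈ frontier Ω, w x - w y ≤ N (x - y)

/-- The boundary points with several points of contact. -/
def branchSet (N : Seminorm ℝ (Space d)) (Ω : Set (Space d)) (w : Space d → ℝ) : Set (Space d) :=
  {x | x ∈ frontier Ω ∧ ∃ y y', y ≠ y' ∧ IsContact N Ω w x y ∧ IsContact N Ω w x y'}

theorem IsBoundaryPotential.abs_sub_le {w : Space d → ℝ} (hw : IsBoundaryPotential N Ω w)
    {x y : Space d} (hx : x ∈ frontier Ω) (hy : y ∈ frontier Ω) : |w x - w y| ≤ N (x - y) := by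
  rw [abs_sub_le_iff]
  exact ⟨hw x hx y hy, map_sub_rev N x y ▸ hw y hy x hx⟩

theorem hasFDerivAt_bodyProj {p : Space d} {ξ : Space d →L[ℝ] ℝ}
    (hξ : HasFDerivAt (bodyGauge Ω c) ξ p) (hp : 0 < bodyGauge Ω c p) :
    HasFDerivAt (bodyProj Ω c) ((bodyGauge Ω c p)⁻¹ • ContinuousLinearMap.id ℝ (Space d) +
      ((-(bodyGauge Ω c p ^ 2)⁻¹) • ξ).smulRight (p - c)) p := by
  have h1 : HasFDerivAt (fun p : Space d => (bodyGauge Ω c p)⁻¹)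
      ((-(bodyGauge Ω c p ^ 2)⁻¹) • ξ) p :=
    (hasDerivAt_inv hp.ne').comp_hasFDerivAt p hξ
  exact (h1.smul ((hasFDerivAt_id p).sub_const c)).const_add c

namespace IsUniformlyConvexDomain

/-- A ray from a boundary point meets the rest of the boundary at most once. -/
theorem eq_of_sub_eq_smul (hΩ : IsUniformlyConvexDomain Ω κ) {x y y' : Space d}
    (hx : x ∈ frontier Ω) (hy : y ∈ frontier Ω) (hy' : y' ∈ frontier Ω) (hyx : y ≠ x) {t : ℝ}
    (ht : 0 < t) (h : x - y' = t • (x - y)) : y' = y := by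
  have hyx' : y' ≠ x := fun h' => by
    rw [h', sub_self, eq_comm, smul_eq_zero, sub_eq_zero] at h
    exact h.elim ht.ne' fun h => hyx h.symm
  have e : y' = x - t • (x - y) := by rw [← h]; abel
  rcases lt_trichotomy t 1 with h1 | h1 | h1
  · refine absurd hy' (hΩ.notMem_frontier_of_mem_openSegment (hΩ.frontier_subset hx)
      (hΩ.frontier_subset hy) hyx.symm ⟨1 - t, t, by linarith, ht, by ring, ?_⟩)
    rw [e]; module
  · rw [e, h1, one_smul, sub_sub_cancel]
  · refine absurd hy (hΩ.notMem_frontier_of_mem_openSegment (hΩ.frontier_subset hx)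
      (hΩ.frontier_subset hy') hyx'.symm ⟨1 - t⁻¹, t⁻¹, ?_, by positivity, by ring, ?_⟩)
    · rw [sub_pos]; exact inv_lt_one_of_one_lt₀ h1
    · have : y = x - t⁻¹ • (x - y') := by
        rw [h, smul_smul, inv_mul_cancel₀ ht.ne', one_smul, sub_sub_cancel]
      refine Eq.trans ?_ this.symm
      module

variable (hΩ : IsUniformlyConvexDomain Ω κ) {ρ : ℝ≥0} (hρ : 0 < ρ) (hc : Metric.ball c ρ ⊆ Ω)

include hΩ hρ hc

omit hΩ hρ hc in
theorem fderiv_bodyGauge_proj {p : Space d} {ξ : Space d →L[ℝ] ℝ}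
    (hξ : HasFDerivAt (bodyGauge Ω c) ξ p) (hp : 0 < bodyGauge Ω c p) :
    ξ (bodyProj Ω c p - c) = 1 := by
  rw [bodyProj, add_sub_cancel_left, map_smul, fderiv_bodyGauge_radial hξ, smul_eq_mul,
    inv_mul_cancel₀ hp.ne']

theorem fderiv_bodyGauge_sub_pos {p y : Space d} {ξ : Space d →L[ℝ] ℝ}
    (hξ : HasFDerivAt (bodyGauge Ω c) ξ p) (hp : 0 < bodyGauge Ω c p) (hy : y ∈ Ω)
    (hyp : y ≠ bodyProj Ω c p) : 0 < ξ (bodyProj Ω c p - y) := by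
  have h1 := hΩ.norm_sq_le_fderiv_bodyGauge hρ hc hξ hp hy
  have h2 := hΩ.fderiv_bodyGauge_le_one hρ hc hξ hy
  have h3 : ξ (bodyProj Ω c p - y) = 1 - ξ (y - c) := by
    rw [← fderiv_bodyGauge_proj hξ hp, ← map_sub]; congr 1; abel
  rw [h3]
  refine lt_of_le_of_ne (by linarith) fun h0 => ?_
  rw [← h0, mul_zero] at h1
  have : 0 < ‖y - bodyProj Ω c p‖ := norm_pos_iff.2 (sub_ne_zero.2 hyp)
  have : 0 < ‖y - bodyProj Ω c p‖ ^ 2 := by positivity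
  linarith

/-- At a point of contact, the tangential derivative of the potential is bounded by the difference
quotients of the norm, by convexity. -/
theorem fderiv_potential_le {w : Space d → ℝ} (hw : IsBoundaryPotential N Ω w) {p y ζ : Space d}
    {ξ L : Space d →L[ℝ] ℝ} (hξ : HasFDerivAt (bodyGauge Ω c) ξ p) (hp : 0 < bodyGauge Ω c p)
    (hL : HasFDerivAt (fun q => w (bodyProj Ω c q)) L p)
    (hy : IsContact N Ω w (bodyProj Ω c p) y) (hζ : ξ ζ = 0) {α : ℝ} (hα : 0 < α)
    {a : Space d} (ha : bodyProj Ω c p - y = α • a) :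
    L (bodyGauge Ω c p • ζ) ≤ 2 * (N (a + (1 / 2 : ℝ) • ζ) - N a) := by
  set x := bodyProj Ω c p with hx
  have hxf : x ∈ frontier Ω := hΩ.bodyProj_mem_frontier hρ hc hp
  obtain ⟨C, hC⟩ := exists_seminorm_le N
  let q : ℝ → Space d := fun ε => p + ε • (bodyGauge Ω c p • ζ)
  have hq0 : q 0 = p := by simp [q]
  have hq : HasDerivAt q (bodyGauge Ω c p • ζ) 0 := by
    change HasDerivAt (fun ε : ℝ => p + ε • (bodyGauge Ω c p • ζ)) _ 0
    simpa using ((hasDerivAt_id (0 : ℝ)).smul_const (bodyGauge Ω c p • ζ)).const_add p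
  have h1 : HasDerivAt (fun ε => w (bodyProj Ω c (q ε))) (L (bodyGauge Ω c p • ζ)) 0 := by
    refine HasFDerivAt.comp_hasDerivAt (l := fun q => w (bodyProj Ω c q)) (0 : ℝ) ?_ hq
    rwa [hq0]
  have h2 : HasDerivAt (fun ε => bodyProj Ω c (q ε)) ζ 0 := by
    have := HasFDerivAt.comp_hasDerivAt (l := bodyProj Ω c) (0 : ℝ)
      (by rw [hq0]; exact hasFDerivAt_bodyProj hξ hp) hq
    refine this.congr_deriv ?_
    simp [hζ, smul_smul, mul_inv_cancel₀ hp.ne']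
  have hs1 := (hasDerivAt_iff_tendsto_slope_zero.1 h1).mono_left
    (nhdsWithin_mono 0 (s := Ioi (0 : ℝ)) fun t ht => ne_of_gt ht)
  have hs2 := (hasDerivAt_iff_tendsto_slope_zero.1 h2).mono_left
    (nhdsWithin_mono 0 (s := Ioi (0 : ℝ)) fun t ht => ne_of_gt ht)
  simp only [zero_add, hq0] at hs1 hs2
  have hs3 : Tendsto (fun t : ℝ => 2 * (N (a + (1 / 2 : ℝ) • ζ) - N a) +
      C * ‖t⁻¹ • (bodyProj Ω c (q t) - x) - ζ‖) (𝓝[>] 0)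
      (𝓝 (2 * (N (a + (1 / 2 : ℝ) • ζ) - N a))) := by
    have := ((hs2.sub_const ζ).norm.const_mul (C : ℝ)).const_add
      (2 * (N (a + (1 / 2 : ℝ) • ζ) - N a))
    simpa using this
  refine le_of_tendsto_of_tendsto hs1 hs3 ?_
  have hjq : ∀ᶠ t in 𝓝[>] (0 : ℝ), 0 < bodyGauge Ω c (q t) := by
    have hcont : Continuous fun t => bodyGauge Ω c (q t) := by
      have := hΩ.continuous_bodyGauge hρ hc
      fun_prop
    refine ((hcont.tendsto 0).eventually (lt_mem_nhds ?_)).filter_mono nhdsWithin_le_nhds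
    rwa [hq0]
  filter_upwards [hjq, Ioo_mem_nhdsGT (show 0 < α / 2 by positivity)] with t htj ht
  have ht0 : 0 < t := ht.1
  set r := bodyProj Ω c (q t) - x - t • ζ with hr
  have h3 : w (bodyProj Ω c (q t)) - w x ≤ N (bodyProj Ω c (q t) - y) - N (x - y) := by
    have := hw _ (hΩ.bodyProj_mem_frontier hρ hc htj) y hy.1
    have := hy.2.2
    linarith
  have e1 : bodyProj Ω c (q t) - y = (α - 2 * t) • a + (2 * t) • (a + (1 / 2 : ℝ) • ζ) + r := by
    have : bodyProj Ω c (q t) - y = (x - y) + t • ζ + r := by rw [hr]; abel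
    rw [this, ha]
    module
  have h4 : N (bodyProj Ω c (q t) - y)
      ≤ (α - 2 * t) * N a + (2 * t) * N (a + (1 / 2 : ℝ) • ζ) + C * ‖r‖ := by
    rw [e1]
    refine (map_add_le_add N _ _).trans (add_le_add ((map_add_le_add N _ _).trans ?_) (hC r))
    rw [map_smul_eq_mul, map_smul_eq_mul, Real.norm_of_nonneg (by linarith [ht.2]),
      Real.norm_of_nonneg (by linarith)]
  have h5 : N (x - y) = α * N a := by
    rw [ha, map_smul_eq_mul, Real.norm_of_nonneg hα.le]
  have e2 : t⁻¹ • (bodyProj Ω c (q t) - x) - ζ = t⁻¹ • r := by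
    rw [hr, smul_sub t⁻¹ (bodyProj Ω c (q t) - x), smul_smul, inv_mul_cancel₀ ht0.ne', one_smul]
  rw [e2, norm_smul, norm_inv, Real.norm_of_nonneg ht0.le, smul_eq_mul, inv_mul_le_iff₀ ht0]
  have e3 : t * (2 * (N (a + (1 / 2 : ℝ) • ζ) - N a) + C * (t⁻¹ * ‖r‖))
      = 2 * t * (N (a + (1 / 2 : ℝ) • ζ) - N a) + C * ‖r‖ := by field_simp
  rw [e3]
  linarith

/-- Where gauge and potential are differentiable there is at most one point of contact: its
direction is determined by the tangential derivative, because the norm is strictly convex. -/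
theorem contact_unique_of_hasFDerivAt (hN : IsStrictlyConvexNorm N) {w : Space d → ℝ}
    (hw : IsBoundaryPotential N Ω w) {p y y' : Space d}
    {ξ L : Space d →L[ℝ] ℝ} (hξ : HasFDerivAt (bodyGauge Ω c) ξ p) (hp : 0 < bodyGauge Ω c p)
    (hL : HasFDerivAt (fun q => w (bodyProj Ω c q)) L p)
    (hy : IsContact N Ω w (bodyProj Ω c p) y) (hy' : IsContact N Ω w (bodyProj Ω c p) y') :
    y = y' := by
  have hxf : bodyProj Ω c p ∈ frontier Ω := hΩ.bodyProj_mem_frontier hρ hc hp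
  have hα := hΩ.fderiv_bodyGauge_sub_pos hρ hc hξ hp (hΩ.frontier_subset hy.1) hy.2.1
  have hβ := hΩ.fderiv_bodyGauge_sub_pos hρ hc hξ hp (hΩ.frontier_subset hy'.1) hy'.2.1
  have hyy := fun ζ (hζ : ξ ζ = 0) α (hα : 0 < α) a =>
    hΩ.fderiv_potential_le hρ hc hw hξ hp hL hy hζ hα (a := a)
  have hyy' := fun ζ (hζ : ξ ζ = 0) α (hα : 0 < α) a =>
    hΩ.fderiv_potential_le hρ hc hw hξ hp hL hy' hζ hα (a := a)
  have hyx := hy.2.1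
  have hyx' := hy'.2.1
  set x := bodyProj Ω c p with hx
  set α := ξ (x - y) with hαdef
  set β := ξ (x - y') with hβdef
  -- Both directions are scaled to the hyperplane `ξ = 1`; their difference is then tangential, and
  -- the derivatives along the difference and along its opposite add up to zero.
  obtain ⟨a, ha⟩ : ∃ a, a = α⁻¹ • (x - y) := ⟨_, rfl⟩
  obtain ⟨b, hb⟩ : ∃ b, b = β⁻¹ • (x - y') := ⟨_, rfl⟩
  have hξa : ξ a = 1 := by rw [ha, map_smul, smul_eq_mul, inv_mul_cancel₀ hα.ne']
  have hξb : ξ b = 1 := by rw [hb, map_smul, smul_eq_mul, inv_mul_cancel₀ hβ.ne']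
  have ha' : x - y = α • a := by rw [ha, smul_smul, mul_inv_cancel₀ hα.ne', one_smul]
  have hb' : x - y' = β • b := by rw [hb, smul_smul, mul_inv_cancel₀ hβ.ne', one_smul]
  have h1 := hyy (b - a) (by rw [map_sub, hξa, hξb, sub_self]) α hα a ha'
  have h2 := hyy' (a - b) (by rw [map_sub, hξa, hξb, sub_self]) β hβ b hb'
  have e1 : a + (1 / 2 : ℝ) • (b - a) = (1 / 2 : ℝ) • (a + b) := by module
  have e2 : b + (1 / 2 : ℝ) • (a - b) = (1 / 2 : ℝ) • (a + b) := by module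
  have e3 : L (bodyGauge Ω c p • (a - b)) = -L (bodyGauge Ω c p • (b - a)) := by
    rw [← map_neg, ← smul_neg, neg_sub]
  have hmid : N ((1 / 2 : ℝ) • (a + b)) = 1 / 2 * N (a + b) := by
    rw [map_smul_eq_mul, Real.norm_of_nonneg (by norm_num)]
  rw [e1, hmid] at h1
  rw [e2, e3, hmid] at h2
  have h3 := hN.smul_eq_smul_of_add_eq (a := a) (b := b) (by linarith)
  have h4 : N b = N a := by
    have := congrArg ξ h3
    rwa [map_smul, map_smul, hξa, hξb, smul_eq_mul, smul_eq_mul, mul_one, mul_one] at this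
  have hNa : N a ≠ 0 := (hN.pos fun h0 => by simp [h0] at hξa).ne'
  have hab : a = b := by
    rw [h4] at h3
    exact smul_right_injective _ hNa h3
  refine (hΩ.eq_of_sub_eq_smul hxf hy.1 hy'.1 hyx (t := β * α⁻¹) (by positivity) ?_).symm
  rw [hb', ← hab, ha, smul_smul]

omit hρ hc in
/-- Almost every boundary point has at most one point of contact: by the theorem of Rademacher the
potential, extended to be constant along rays from the centre, is differentiable almost everywhere
in the shell, and Eilenberg's inequality brings this back to the boundary. -/
theorem euclideanHausdorffMeasure_branchSet (hd : 2 ≤ d) (hN : IsStrictlyConvexNorm N)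
    {w : Space d → ℝ} (hw : IsBoundaryPotential N Ω w) :
    Measure.euclideanHausdorffMeasure (d - 1) (branchSet N Ω w) = 0 := by
  obtain ⟨hρ, c, hc⟩ := hΩ.exists_center (by omega)
  obtain ⟨C, hC⟩ := exists_seminorm_le N
  obtain ⟨L, hL⟩ := hΩ.lipschitzOnWith_bodyProj hρ hc
  have hpos : ∀ p ∈ bodyShell Ω c, 0 < bodyGauge Ω c p := fun p hp => by linarith [hp.1]
  have hlip : LipschitzOnWith (C * L) (fun p => w (bodyProj Ω c p)) (bodyShell Ω c) := by
    refine LipschitzOnWith.of_dist_le_mul fun p hp q hq => ?_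
    rw [Real.dist_eq]
    refine (hw.abs_sub_le (hΩ.bodyProj_mem_frontier hρ hc (hpos p hp))
      (hΩ.bodyProj_mem_frontier hρ hc (hpos q hq))).trans ((hC _).trans ?_)
    have := hL.dist_le_mul p hp q hq
    rw [dist_eq_norm] at this
    push_cast
    rw [mul_assoc]
    gcongr
  have hsub : branchSet N Ω w ⊆ frontier Ω := fun x hx => hx.1
  rw [← inter_eq_left.2 hsub]
  refine le_antisymm ((hΩ.euclideanHausdorffMeasure_le hρ hc hd _).trans ?_) zero_le
  rw [nonpos_iff_eq_zero, mul_eq_zero]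
  right
  have h1 := hlip.ae_differentiableWithinAt_of_mem (μ := volume)
  have h2 := (hΩ.lipschitzWith_bodyGauge hρ hc).ae_differentiableAt (μ := volume)
  refine measure_mono_null (t := {p | ¬ ((p ∈ bodyShell Ω c → DifferentiableWithinAt ℝ
    (fun p => w (bodyProj Ω c p)) (bodyShell Ω c) p) ∧ DifferentiableAt ℝ (bodyGauge Ω c) p)})
    ?_ (h1.and h2)
  rintro p ⟨hpS, -, y, y', hyy, hy, hy'⟩ ⟨hd1, hd2⟩
  exact hyy (hΩ.contact_unique_of_hasFDerivAt hρ hc hN hw hd2.hasFDerivAt (hpos p hpS)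
    ((hd1 hpS).differentiableAt ((hΩ.isOpen_bodyShell hρ hc).mem_nhds hpS)).hasFDerivAt hy hy')

end IsUniformlyConvexDomain

end

/-! ### Interpolation along a contact map -/

section

variable {d : ℕ} {Ω : Set (Space d)} {κ : ℝ} {N : Seminorm ℝ (Space d)} {w : Space d → ℝ}
  {G : Set (Space d)} {T : Space d → Space d}

/-- `T` is a Borel map that sends each point of the Borel set `G` of boundary points to its only
point of contact for the potential `w`. -/
structure IsContactMap (N : Seminorm ℝ (Space d)) (Ω : Set (Space d)) (w : Space d → ℝ)
    (G : Set (Space d)) (T : Space d → Space d) : Prop where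
  measurableSet : MeasurableSet G
  measurable : Measurable T
  subset : G ⊆ frontier Ω
  contact : ∀ x ∈ G, IsContact N Ω w x (T x)
  unique : ∀ x ∈ G, ∀ y, IsContact N Ω w x y → y = T x

theorem interpolationMap_sub_right (T : Space d → Space d) (x : Space d) (s : ℝ) :
    interpolationMap T (x, s) - T x = (1 - s) • (x - T x) := by
  simp only [interpolationMap]; module

theorem sub_interpolationMap (T : Space d → Space d) (x : Space d) (s : ℝ) :
    x - interpolationMap T (x, s) = s • (x - T x) := by
  simp only [interpolationMap]; module

theorem seminorm_sub_interpolationMap_add (T : Space d → Space d) (x : Space d) {s : ℝ}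
    (hs : s ∈ Ioo (0 : ℝ) 1) :
    N (x - interpolationMap T (x, s)) + N (interpolationMap T (x, s) - T x) = N (x - T x) := by
  rw [sub_interpolationMap, interpolationMap_sub_right, map_smul_eq_mul, map_smul_eq_mul,
    Real.norm_of_nonneg hs.1.le, Real.norm_of_nonneg (by linarith [hs.2])]
  ring

theorem seminorm_sub_le (N : Seminorm ℝ (Space d)) (x y z : Space d) :
    N (x - z) ≤ N (x - y) + N (y - z) := by
  have := map_add_le_add N (x - y) (y - z)
  rwa [sub_add_sub_cancel] at this

namespace IsUniformlyConvexDomain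

variable (hΩ : IsUniformlyConvexDomain Ω κ) (hN : IsStrictlyConvexNorm N)
include hΩ hN

/-- If an interior point of the segment from `x` to `T x` also lies, in the sense of the norm,
between `x` and the boundary point `y'`, then `y' = T x`. -/
theorem eq_of_aligned {x y' : Space d} (hx : x ∈ frontier Ω) (hTx : T x ∈ frontier Ω)
    (hxT : T x ≠ x) (hy' : y' ∈ frontier Ω) {s : ℝ} (hs : s ∈ Ioo (0 : ℝ) 1)
    (h : N (x - interpolationMap T (x, s)) + N (interpolationMap T (x, s) - y') ≤ N (x - y')) :
    y' = T x := by
  set z := interpolationMap T (x, s) with hz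
  have hxz : x - z = s • (x - T x) := sub_interpolationMap T x s
  have hpos : 0 < N (x - z) := by
    rw [hxz]
    exact hN.pos (smul_ne_zero hs.1.ne' (sub_ne_zero.2 hxT.symm))
  have h1 := hN.smul_eq_smul_of_add_eq (a := x - z) (b := z - y') (by rwa [sub_add_sub_cancel])
  obtain ⟨r, hr, h2⟩ : ∃ r : ℝ, 0 ≤ r ∧ z - y' = r • (x - z) := by
    refine ⟨(N (x - z))⁻¹ * N (z - y'), by positivity, ?_⟩
    rw [mul_smul, h1, smul_smul, inv_mul_cancel₀ hpos.ne', one_smul]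
  refine hΩ.eq_of_sub_eq_smul hx hTx hy' hxT (t := s + r * s) (by have := hs.1; positivity) ?_
  have h3 : x - y' = (x - z) + (z - y') := by abel
  rw [h3, h2, hxz, add_smul, smul_smul]

omit hN in
/-- The image of the cone measure under interpolation with a map taking finitely many values, each
of them optimal among these values for the costs `N (x - y) + v y`: the interpolating segments
towards different values sweep disjoint regions. -/
theorem coneMeasure_finite_le (hN : IsStrictlyConvexNorm N) (hd : 2 ≤ d) {Y : Finset (Space d)}
    (hY : ∀ y ∈ Y, y ∈ frontier Ω) (v : Space d → ℝ) (hT : Measurable T) {E : Set (Space d)}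
    (hE : MeasurableSet E) (hEf : E ⊆ frontier Ω) (hTY : ∀ x ∈ E, T x ∈ Y)
    (hEY : ∀ x ∈ E, x ∉ Y)
    (hmin : ∀ x ∈ E, ∀ y ∈ Y, N (x - T x) + v (T x) ≤ N (x - y) + v y)
    {B : Set (Space d)} (hB : MeasurableSet B) :
    coneMeasure Ω T ((E ×ˢ Ioo (0 : ℝ) 1) ∩ interpolationMap T ⁻¹' B) ≤
      coneConst d κ (Metric.diam Ω) * volume B := by
  -- The open cell of the points for which `y` is the only optimal value contains the interiors of
  -- the segments that end at `y`.
  let Z : Space d → Set (Space d) := fun y =>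
    {z | ∀ y' ∈ Y, y' ≠ y → N (z - y) + v y < N (z - y') + v y'}
  have hNc := continuous_seminorm N
  have hZm : ∀ y, MeasurableSet (Z y) := fun y => by
    have : Z y = ⋂ y' ∈ Y, ⋂ _ : y' ≠ y, {z | N (z - y) + v y < N (z - y') + v y'} := by
      ext z; simp [Z]
    rw [this]
    refine Finset.measurableSet_biInter _ fun y' _ => MeasurableSet.iInter fun _ => ?_
    exact (isOpen_lt (by fun_prop) (by fun_prop)).measurableSet
  have hmem : ∀ x ∈ E, ∀ s ∈ Ioo (0 : ℝ) 1, interpolationMap T (x, s) ∈ Z (T x) := by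
    intro x hx s hs y' hy' hne
    by_contra! hle
    refine hne (hΩ.eq_of_aligned hN (hEf hx) (hY _ (hTY x hx))
      (fun h => hEY x hx (h ▸ hTY x hx)) (hY y' hy') hs ?_)
    have h1 := hmin x hx y' hy'
    have h2 := seminorm_sub_interpolationMap_add (N := N) T x hs
    linarith
  have hsub : (E ×ˢ Ioo (0 : ℝ) 1) ∩ interpolationMap T ⁻¹' B ⊆
      ⋃ y ∈ Y, ((E ∩ T ⁻¹' {y}) ×ˢ Ioo (0 : ℝ) 1) ∩ interpolationMap T ⁻¹' (B ∩ Z y) := by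
    rintro ⟨x, s⟩ ⟨⟨hx, hs⟩, hxB⟩
    exact mem_iUnion₂.2 ⟨T x, hTY x hx, ⟨⟨hx, rfl⟩, hs⟩, hxB, hmem x hx s hs⟩
  have hpiece : ∀ y ∈ Y,
      coneMeasure Ω T (((E ∩ T ⁻¹' {y}) ×ˢ Ioo (0 : ℝ) 1) ∩ interpolationMap T ⁻¹' (B ∩ Z y))
        ≤ coneConst d κ (Metric.diam Ω) * volume (B ∩ Z y) := by
    intro y hy
    have hAm : MeasurableSet (((E ∩ T ⁻¹' {y}) ×ˢ Ioo (0 : ℝ) 1) ∩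
        interpolationMap T ⁻¹' (B ∩ Z y)) :=
      ((hE.inter (hT (measurableSet_singleton y))).prod measurableSet_Ioo).inter
        (measurable_interpolationMap hT (hB.inter (hZm y)))
    have hFm := measurable_interpolationMap (d := d) (measurable_const (a := y))
      (hB.inter (hZm y))
    refine le_trans ?_ (hΩ.coneMeasure_const_le hd (hY y hy) (hB.inter (hZm y)))
    rw [coneMeasure, coneMeasure, withDensity_apply _ hAm, withDensity_apply _ hFm]
    have hcongr : ∀ q ∈ ((E ∩ T ⁻¹' {y}) ×ˢ Ioo (0 : ℝ) 1) ∩ interpolationMap T ⁻¹' (B ∩ Z y),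
        coneWeight T q = coneWeight (fun _ => y) q := by
      rintro ⟨x, s⟩ ⟨⟨⟨-, hx⟩, -⟩, -⟩
      have hx' : T x = y := hx
      simp only [coneWeight, hx']
    rw [setLIntegral_congr_fun hAm hcongr]
    refine lintegral_mono_set ?_
    rintro ⟨x, s⟩ ⟨⟨⟨-, hx⟩, -⟩, hB'⟩
    have hx' : T x = y := hx
    simp only [mem_preimage, interpolationMap, hx'] at hB' ⊢
    exact hB'
  calc _ ≤ coneMeasure Ω T (⋃ y ∈ Y, ((E ∩ T ⁻¹' {y}) ×ˢ Ioo (0 : ℝ) 1) ∩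
          interpolationMap T ⁻¹' (B ∩ Z y)) := measure_mono hsub
    _ ≤ ∑ y ∈ Y, coneMeasure Ω T (((E ∩ T ⁻¹' {y}) ×ˢ Ioo (0 : ℝ) 1) ∩
          interpolationMap T ⁻¹' (B ∩ Z y)) := measure_biUnion_finset_le _ _
    _ ≤ ∑ y ∈ Y, coneConst d κ (Metric.diam Ω) * volume (B ∩ Z y) := Finset.sum_le_sum hpiece
    _ = coneConst d κ (Metric.diam Ω) * volume (⋃ y ∈ Y, B ∩ Z y) := by
        rw [← Finset.mul_sum, measure_biUnion_finset ?_ fun y _ => hB.inter (hZm y)]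
        intro y hy y' hy' hne
        refine disjoint_left.2 fun z hz hz' => ?_
        exact lt_asymm (hz.2 y' hy' hne.symm) (hz'.2 y hy hne)
    _ ≤ _ := by
        gcongr
        exact iUnion₂_subset fun y _ => inter_subset_left

end IsUniformlyConvexDomain

/-- Selection, among the first `n + 1` points of a sequence, of one that minimizes the cost
`N (x - y) + v y`. -/
noncomputable def costArgmin (N : Seminorm ℝ (Space d)) (v : Space d → ℝ) (y : ℕ → Space d) :
    ℕ → Space d → Space d
  | 0, _ => y 0
  | n + 1, x =>
    open Classical in
    if N (x - y (n + 1)) + v (y (n + 1)) <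
      N (x - costArgmin N v y n x) + v (costArgmin N v y n x)
    then y (n + 1) else costArgmin N v y n x

theorem measurable_costArgmin {v : Space d → ℝ} (hv : Measurable v) (y : ℕ → Space d) (n : ℕ) :
    Measurable (costArgmin N v y n) := by
  have hN := (continuous_seminorm N).measurable
  induction n with
  | zero => exact measurable_const
  | succ n ih =>
    refine Measurable.ite (measurableSet_lt ?_ ?_) measurable_const ih
    · fun_prop
    · fun_prop

theorem costArgmin_mem (v : Space d → ℝ) (y : ℕ → Space d) (n : ℕ) (x : Space d) :
    ∃ i ≤ n, costArgmin N v y n x = y i := by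
  induction n with
  | zero => exact ⟨0, le_rfl, rfl⟩
  | succ n ih =>
    rw [costArgmin]
    split_ifs
    · exact ⟨n + 1, le_rfl, rfl⟩
    · obtain ⟨i, hi, h⟩ := ih
      exact ⟨i, by omega, h⟩

theorem costArgmin_le (v : Space d → ℝ) (y : ℕ → Space d) (x : Space d) {n i : ℕ} (hi : i ≤ n) :
    N (x - costArgmin N v y n x) + v (costArgmin N v y n x) ≤ N (x - y i) + v (y i) := by
  induction n with
  | zero =>
    obtain rfl : i = 0 := by omega
    exact le_rfl
  | succ n ih =>
    rw [costArgmin]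
    split_ifs with h
    · rcases Nat.le_succ_iff.1 hi with h' | rfl
      · exact h.le.trans (ih h')
      · exact le_rfl
    · rcases Nat.le_succ_iff.1 hi with h' | rfl
      · exact ih h'
      · exact not_lt.1 h

theorem IsBoundaryPotential.continuousOn (hw : IsBoundaryPotential N Ω w) :
    ContinuousOn w (frontier Ω) := by
  obtain ⟨C, hC⟩ := exists_seminorm_le N
  refine LipschitzOnWith.continuousOn (K := C) (LipschitzOnWith.of_dist_le_mul fun x hx y hy => ?_)
  rw [Real.dist_eq, dist_eq_norm]
  exact (hw.abs_sub_le hx hy).trans (hC _)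

/-- The selections among more and more points of a dense sequence in a compact set converge to the
point of contact, when this is the only one in the compact set. -/
theorem IsContactMap.tendsto_costArgmin (hT : IsContactMap N Ω w G T)
    (hw : IsBoundaryPotential N Ω w) {Y : Set (Space d)} (hY : IsCompact Y)
    (hYf : Y ⊆ frontier Ω) {y : ℕ → Space d} (hyY : ∀ n, y n ∈ Y) (hdense : Y ⊆ closure (range y))
    {x : Space d} (hx : x ∈ G) (hxY : x ∉ Y) (hTx : T x ∈ Y) :
    Tendsto (fun n => costArgmin N w y n x) atTop (𝓝 (T x)) := by
  have hNc := continuous_seminorm N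
  have hcost : ContinuousOn (fun z => N (x - z) + w z) Y :=
    (Continuous.continuousOn (by fun_prop)).add (hw.continuousOn.mono hYf)
  have hmem : ∀ n, costArgmin N w y n x ∈ Y := fun n => by
    obtain ⟨i, -, h⟩ := costArgmin_mem (N := N) w y n x
    rw [h]; exact hyY i
  refine hY.tendsto_nhds_of_unique_mapClusterPt (Eventually.of_forall hmem) fun z hz hcl => ?_
  have h1 : ∀ i, N (x - z) + w z ≤ N (x - y i) + w (y i) := fun i => by
    have hcl' : IsClosed {z ∈ Y | N (x - z) + w z ≤ N (x - y i) + w (y i)} :=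
      hcost.preimage_isClosed_of_isClosed hY.isClosed isClosed_Iic
    by_contra hzi
    have h2 : ∃ᶠ n in atTop, costArgmin N w y n x ∈
        {z ∈ Y | N (x - z) + w z ≤ N (x - y i) + w (y i)}ᶜ :=
      hcl.frequently (hcl'.isOpen_compl.mem_nhds fun h => hzi h.2)
    refine h2 ((eventually_ge_atTop i).mono fun n hn => ?_)
    exact not_not.2 ⟨hmem n, costArgmin_le w y x hn⟩
  have h2 : T x ∈ {z' ∈ Y | N (x - z) + w z ≤ N (x - z') + w z'} := by
    have hcl' : IsClosed {z' ∈ Y | N (x - z) + w z ≤ N (x - z') + w z'} :=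
      hcost.preimage_isClosed_of_isClosed hY.isClosed isClosed_Ici
    refine closure_minimal ?_ hcl' (hdense hTx)
    rintro _ ⟨i, rfl⟩
    exact ⟨hyY i, h1 i⟩
  have h3 := (hT.contact x hx).2.2
  refine hT.unique x hx z ⟨hYf hz, fun h => hxY (h ▸ hz), le_antisymm ?_ ?_⟩
  · exact hw x (hT.subset hx) z (hYf hz)
  · linarith [h2.2]

theorem coneMeasure_apply (Ω : Set (Space d)) (T : Space d → Space d) {A : Set (Space d × ℝ)}
    (hA : MeasurableSet A) :
    coneMeasure Ω T A = ∫⁻ q, A.indicator (coneWeight T) q ∂cylinderMeasure Ω := by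
  rw [coneMeasure, withDensity_apply _ hA, lintegral_indicator hA]

namespace IsUniformlyConvexDomain

variable (hΩ : IsUniformlyConvexDomain Ω κ) (hN : IsStrictlyConvexNorm N) (hd : 2 ≤ d)
  (hw : IsBoundaryPotential N Ω w) (hwm : Measurable w) (hT : IsContactMap N Ω w G T)
include hΩ hN hd hw hwm hT

/-- The bound for the points `x` that are separated from their images `T x` by a compact set `Y`: on
these, `T` is a limit of maps with finitely many values, and the bound passes to the limit on open
sets by Fatou's lemma and then to all sets by outer regularity. -/
theorem coneMeasure_contactMap_local_le {Y : Set (Space d)} (hY : IsCompact Y)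
    (hYf : Y ⊆ frontier Ω) {E : Set (Space d)} (hE : MeasurableSet E) (hEG : E ⊆ G)
    (hTY : ∀ x ∈ E, T x ∈ Y) (hEY : ∀ x ∈ E, x ∉ Y) (B : Set (Space d)) :
    coneMeasure Ω T ((E ×ˢ Ioo (0 : ℝ) 1) ∩ interpolationMap T ⁻¹' B) ≤
      coneConst d κ (Metric.diam Ω) * volume B := by
  rcases Y.eq_empty_or_nonempty with rfl | hYne
  · have : E = ∅ := eq_empty_of_forall_notMem fun x hx => hTY x hx
    simp [this]
  have hopen : ∀ U : Set (Space d), IsOpen U →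
      coneMeasure Ω T ((E ×ˢ Ioo (0 : ℝ) 1) ∩ interpolationMap T ⁻¹' U) ≤
        coneConst d κ (Metric.diam Ω) * volume U := by
    intro U hU
    obtain ⟨y, hyY, hdense⟩ : ∃ y : ℕ → Space d, (∀ n, y n ∈ Y) ∧ Y ⊆ closure (range y) := by
      have := hYne.to_subtype
      refine ⟨fun n => (TopologicalSpace.denseSeq Y n : Space d), fun n => (TopologicalSpace.denseSeq Y n).2, ?_⟩
      intro z hz
      have := image_closure_subset_closure_image (continuous_subtype_val (p := (· ∈ Y)))
        (mem_image_of_mem _ (TopologicalSpace.denseRange_denseSeq Y ⟨z, hz⟩))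
      rwa [← range_comp] at this
    set S : ℕ → Space d → Space d := fun n => costArgmin N w y n
    have hSm : ∀ n, Measurable (S n) := fun n => measurable_costArgmin hwm y n
    have hAm : ∀ R : Space d → Space d, Measurable R →
        MeasurableSet ((E ×ˢ Ioo (0 : ℝ) 1) ∩ interpolationMap R ⁻¹' U) := fun R hR =>
      (hE.prod measurableSet_Ioo).inter (measurable_interpolationMap hR hU.measurableSet)
    have hle : ∀ n, coneMeasure Ω (S n) ((E ×ˢ Ioo (0 : ℝ) 1) ∩ interpolationMap (S n) ⁻¹' U) ≤
        coneConst d κ (Metric.diam Ω) * volume U := by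
      intro n
      classical
      refine hΩ.coneMeasure_finite_le hN hd (Y := (Finset.range (n + 1)).image y) ?_ w (hSm n) hE
        (hEG.trans hT.subset) ?_ ?_ ?_ hU.measurableSet
      · simp only [Finset.mem_image]
        rintro _ ⟨i, -, rfl⟩
        exact hYf (hyY i)
      · intro x _
        obtain ⟨i, hi, h⟩ := costArgmin_mem (N := N) w y n x
        exact Finset.mem_image.2 ⟨i, Finset.mem_range.2 (by omega), h.symm⟩
      · intro x hx h
        obtain ⟨i, -, h⟩ := Finset.mem_image.1 h
        exact hEY x hx (h ▸ hyY i)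
      · intro x _ z hz
        obtain ⟨i, hi, rfl⟩ := Finset.mem_image.1 hz
        exact costArgmin_le w y x (by simpa [Nat.lt_succ_iff] using hi)
    calc _ = ∫⁻ q, ((E ×ˢ Ioo (0 : ℝ) 1) ∩ interpolationMap T ⁻¹' U).indicator
            (coneWeight T) q ∂cylinderMeasure Ω := coneMeasure_apply Ω T
          (hAm T hT.measurable)
      _ ≤ ∫⁻ q, liminf (fun n => ((E ×ˢ Ioo (0 : ℝ) 1) ∩ interpolationMap (S n) ⁻¹' U).indicator
            (coneWeight (S n)) q) atTop ∂cylinderMeasure Ω := by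
          refine lintegral_mono fun q => ?_
          by_cases hq : q ∈ (E ×ˢ Ioo (0 : ℝ) 1) ∩ interpolationMap T ⁻¹' U
          swap
          · rw [indicator_of_notMem hq]; exact zero_le
          have hlim : Tendsto (fun n => S n q.1) atTop (𝓝 (T q.1)) :=
            hT.tendsto_costArgmin hw hY hYf hyY hdense (hEG hq.1.1) (hEY _ hq.1.1) (hTY _ hq.1.1)
          have hF : Tendsto (fun n => interpolationMap (S n) q) atTop
              (𝓝 (interpolationMap T q)) :=
            (hlim.const_smul q.2).const_add _
          have hW : Tendsto (fun n => coneWeight (S n) q) atTop (𝓝 (coneWeight T q)) :=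
            ENNReal.tendsto_ofReal (((hlim.const_sub q.1).norm.pow 2).const_mul _)
          rw [indicator_of_mem hq]
          refine (Tendsto.liminf_eq (hW.congr' ?_)).ge
          filter_upwards [hF.eventually (hU.mem_nhds hq.2)] with n hn
          rw [indicator_of_mem]
          exact ⟨hq.1, hn⟩
      _ ≤ liminf (fun n => ∫⁻ q, ((E ×ˢ Ioo (0 : ℝ) 1) ∩ interpolationMap (S n) ⁻¹' U).indicator
            (coneWeight (S n)) q ∂cylinderMeasure Ω) atTop :=
          lintegral_liminf_le fun n => (measurable_coneWeight (hSm n)).indicator (hAm _ (hSm n))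
      _ ≤ _ := by
          refine (liminf_le_liminf (Eventually.of_forall fun n => ?_)).trans
            (liminf_const (coneConst d κ (Metric.diam Ω) * volume U)).le
          exact (coneMeasure_apply Ω (S n) (hAm _ (hSm n))).symm.le.trans (hle n)
  refine ENNReal.le_of_forall_pos_le_add fun δ hδ _ => ?_
  set C := coneConst d κ (Metric.diam Ω)
  have hδ' : (0 : ℝ≥0) < δ / (C + 1) := by positivity
  obtain ⟨U, hBU, hU, hUle⟩ := B.exists_isOpen_le_add volume
    (ε := ((δ / (C + 1) : ℝ≥0) : ℝ≥0∞)) (by exact_mod_cast hδ'.ne')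
  calc _ ≤ coneMeasure Ω T ((E ×ˢ Ioo (0 : ℝ) 1) ∩ interpolationMap T ⁻¹' U) := by gcongr
    _ ≤ C * volume U := hopen U hU
    _ ≤ C * (volume B + ((δ / (C + 1) : ℝ≥0) : ℝ≥0∞)) := by gcongr
    _ ≤ C * volume B + δ := by
        rw [mul_add]
        gcongr
        rw [← ENNReal.coe_mul]
        refine ENNReal.coe_le_coe.2 ?_
        rw [mul_div_assoc', div_le_iff₀ (by positivity), mul_comm]
        gcongr
        simp

omit hwm hd in
/-- The interpolating segments of a contact map do not cross. -/
theorem injOn_interpolationMap : InjOn (interpolationMap T) (G ×ˢ Ioo (0 : ℝ) 1) := by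
  rintro ⟨x, s⟩ ⟨hx, hs⟩ ⟨x', s'⟩ ⟨hx', hs'⟩ h
  have c := hT.contact x hx
  have c' := hT.contact x' hx'
  have e := seminorm_sub_interpolationMap_add (N := N) T x hs
  have e' := seminorm_sub_interpolationMap_add (N := N) T x' hs'
  have t' := seminorm_sub_le N x' (interpolationMap T (x', s')) (T x)
  rw [← h] at e' t'
  -- The potential decreases at full rate along both segments. At a common point one may therefore
  -- pass from one segment to the other without loss.
  have hTT : T x' = T x := by
    refine hΩ.eq_of_aligned hN (hT.subset hx) c.1 c.2.1 c'.1 hs ?_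
    have t := hw x' (hT.subset hx') (T x) c.1
    have t2 := hw x (hT.subset hx) (T x') c'.1
    have := c.2.2
    have := c'.2.2
    linarith
  rw [interpolationMap, interpolationMap] at h
  dsimp only at h
  rw [hTT] at h
  obtain ⟨rfl, rfl⟩ := hΩ.interpolation_injective (hT.subset hx) (hT.subset hx') c.1 c.2.1.symm
    (hTT ▸ c'.2.1.symm) hs hs' h
  rfl

/-- The push-forward of the cone measure of a contact map, under interpolation, is bounded by a
multiple of Lebesgue measure. The points `x` are sorted into countably many pieces according to a
small ball that contains `T x` and not `x`; by injectivity the images of the pieces are disjoint. -/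
theorem coneMeasure_contactMap_le {B : Set (Space d)} (hB : MeasurableSet B) :
    coneMeasure Ω T ((G ×ˢ Ioo (0 : ℝ) 1) ∩ interpolationMap T ⁻¹' B) ≤
      coneConst d κ (Metric.diam Ω) * volume B := by
  have hFm := measurable_interpolationMap hT.measurable
  have hinj := hΩ.injOn_interpolationMap hN hw hT
  let a : ℕ → Space d := TopologicalSpace.denseSeq (Space d)
  let K : ℕ → Set (Space d) := fun m =>
    Metric.closedBall (a m.unpair.1) (1 / ((m.unpair.2 : ℝ) + 1))
  -- The points `x` for which the ball `K m` contains `T x` and not `x`.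
  let P : ℕ → Set (Space d) := fun m => (G ∩ T ⁻¹' K m) \ K m
  have hKc : ∀ m, IsClosed (K m) := fun m => Metric.isClosed_closedBall
  have hPm : ∀ m, MeasurableSet (P m) := fun m =>
    (hT.measurableSet.inter (hT.measurable (hKc m).measurableSet)).diff (hKc m).measurableSet
  have hcover : G ⊆ ⋃ m, P m := by
    intro x hx
    have hpos : 0 < dist x (T x) := dist_pos.2 (hT.contact x hx).2.1.symm
    obtain ⟨k, hk⟩ := exists_nat_one_div_lt (half_pos hpos)
    obtain ⟨n, hn⟩ := (TopologicalSpace.denseRange_denseSeq (Space d)).exists_dist_lt (T x)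
      (ε := 1 / ((k : ℝ) + 1)) (by positivity)
    refine mem_iUnion.2 ⟨Nat.pair n k, ⟨hx, ?_⟩, ?_⟩
    · simpa [K, a] using hn.le
    · have := dist_triangle_right x (T x) (a n)
      have h' : 1 / ((k : ℝ) + 1) < dist x (a n) := by linarith
      simpa [K, a] using h'
  let A : ℕ → Set (Space d × ℝ) := fun m =>
    (disjointed P m ×ˢ Ioo (0 : ℝ) 1) ∩ interpolationMap T ⁻¹' B
  have hPG : ∀ m, disjointed P m ⊆ G := fun m x hx => (disjointed_subset P m hx).1.1
  have hAG : ∀ m, A m ⊆ G ×ˢ Ioo (0 : ℝ) 1 := fun m =>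
    inter_subset_left.trans (prod_mono (hPG m) Subset.rfl)
  have hdm : ∀ m, MeasurableSet (disjointed P m) := fun m => MeasurableSet.disjointed hPm m
  have hAm : ∀ m, MeasurableSet (A m) := fun m =>
    ((hdm m).prod measurableSet_Ioo).inter (hFm hB)
  have hZm : ∀ m, MeasurableSet (interpolationMap T '' A m) := fun m =>
    (hAm m).image_of_measurable_injOn hFm (hinj.mono (hAG m))
  have hdisj : Pairwise (Function.onFun Disjoint fun m => interpolationMap T '' A m) := by
    intro m n hmn
    refine disjoint_left.2 ?_
    rintro _ ⟨q, hq, rfl⟩ ⟨q', hq', h⟩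
    obtain rfl := hinj (hAG n hq') (hAG m hq) h
    exact disjoint_left.1 (disjoint_disjointed P hmn) hq.1.1 hq'.1.1
  calc _ ≤ coneMeasure Ω T (⋃ m, A m) := by
        refine measure_mono ?_
        rintro ⟨x, s⟩ ⟨⟨hx, hs⟩, hxB⟩
        have := hcover hx
        rw [← iUnion_disjointed] at this
        obtain ⟨m, hm⟩ := mem_iUnion.1 this
        exact mem_iUnion.2 ⟨m, ⟨hm, hs⟩, hxB⟩
    _ ≤ ∑' m, coneMeasure Ω T (A m) := measure_iUnion_le _
    _ ≤ ∑' m, coneConst d κ (Metric.diam Ω) * volume (interpolationMap T '' A m) := by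
        refine ENNReal.tsum_le_tsum fun m => ?_
        refine le_trans (measure_mono fun q hq => ?_)
          (hΩ.coneMeasure_contactMap_local_le hN hd hw hwm hT
            (hΩ.isCompact.of_isClosed_subset (isClosed_frontier.inter (hKc m))
              (inter_subset_left.trans hΩ.frontier_subset)) inter_subset_left (hdm m) (hPG m)
            (fun x hx => ⟨(hT.contact x (hPG m hx)).1, (disjointed_subset P m hx).1.2⟩)
            (fun x hx h => (disjointed_subset P m hx).2 h.2) _)
        exact ⟨hq.1, mem_image_of_mem _ hq⟩
    _ = coneConst d κ (Metric.diam Ω) * volume (⋃ m, interpolationMap T '' A m) := by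
        rw [ENNReal.tsum_mul_left, measure_iUnion hdisj hZm]
    _ ≤ _ := by
        gcongr
        refine iUnion_subset fun m => ?_
        rintro _ ⟨q, hq, rfl⟩
        exact hq.2

end IsUniformlyConvexDomain

end

/-! ### Existence, uniqueness and structure of optimal plans -/

section

variable {d : ℕ} {Ω : Set (Space d)} {κ : ℝ} {N : Seminorm ℝ (Space d)} {w : Space d → ℝ}
  {μ ν : Measure (Space d)}

/-- Kantorovich duality on the boundary: there are a potential and a plan such that the plan is
concentrated where the potential decreases at the full rate. -/
theorem IsUniformlyConvexDomain.exists_boundaryPotential_plan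
    (hΩ : IsUniformlyConvexDomain Ω κ) (hd : 2 ≤ d) (N : Seminorm ℝ (Space d))
    [IsFiniteMeasure μ] [IsFiniteMeasure ν] (hμ : μ (frontier Ω)ᶜ = 0) (hν : ν (frontier Ω)ᶜ = 0)
    (hμν : μ univ = ν univ) :
    ∃ w : Space d → ℝ, Measurable w ∧ IsBoundaryPotential N Ω w ∧
      ∃ γ, IsTransportPlan μ ν γ ∧ ∀ᵐ z ∂γ, w z.1 - w z.2 = N (z.1 - z.2) := by
  have hcomp : IsCompact (frontier Ω) :=
    hΩ.isCompact.of_isClosed_subset isClosed_frontier hΩ.frontier_subset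
  have : CompactSpace (frontier Ω) := isCompact_iff_compactSpace.1 hcomp
  have hne : (frontier Ω).Nonempty := by
    have : Nonempty (Fin d) := Fin.pos_iff_nonempty.1 (by omega)
    exact nonempty_frontier_iff.2
      ⟨hΩ.nonempty_interior.mono interior_subset, fun h => noncompact_univ _ (h ▸ hΩ.isCompact)⟩
  have := hne.to_subtype
  have he : MeasurableEmbedding (Subtype.val : frontier Ω → Space d) :=
    .subtype_coe isClosed_frontier.measurableSet
  have hNc := continuous_seminorm N
  have hmap : ∀ μ : Measure (Space d), μ (frontier Ω)ᶜ = 0 →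
      (μ.comap (Subtype.val : frontier Ω → Space d)).map Subtype.val = μ := fun μ hμ => by
    rw [he.map_comap, Subtype.range_coe]
    exact Measure.restrict_eq_self_of_ae_mem (measure_eq_zero_iff_ae_notMem.1 hμ |>.mono
      fun x hx => not_not.1 hx)
  have huniv : ∀ μ : Measure (Space d), μ (frontier Ω)ᶜ = 0 →
      μ.comap (Subtype.val : frontier Ω → Space d) univ = μ univ := fun μ hμ => by
    conv_rhs => rw [← hmap μ hμ]
    rw [Measure.map_apply measurable_subtype_coe MeasurableSet.univ, preimage_univ]
  have hfin : ∀ μ : Measure (Space d), μ (frontier Ω)ᶜ = 0 → IsFiniteMeasure μ →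
      IsFiniteMeasure (μ.comap (Subtype.val : frontier Ω → Space d)) := fun μ hμ _ =>
    ⟨by rw [huniv μ hμ]; exact measure_lt_top μ univ⟩
  have := hfin μ hμ inferInstance
  have := hfin ν hν inferInstance
  have hc : IsContinuousPseudometric fun x y : frontier Ω => N ((x : Space d) - y) := by
    refine ⟨?_, fun x => ?_, fun x y => map_sub_rev N _ _, fun x y z => seminorm_sub_le N _ _ _⟩
    · fun_prop
    · simp
  obtain ⟨u, hu, γ, h1, h2, h3⟩ := hc.exists_potential_plan
    (μ.comap (Subtype.val : frontier Ω → Space d)) (ν.comap (Subtype.val : frontier Ω → Space d))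
    (by rw [huniv μ hμ, huniv ν hν, hμν])
  have huc : Continuous u := hc.continuous_of_sub_le (a := 1) (fun x y => by simpa using hu x y)
  have hext : ∀ x : frontier Ω, Function.extend Subtype.val u 0 (x : Space d) = u x :=
    fun x => Subtype.val_injective.extend_apply u 0 x
  have hvm : Measurable (Prod.map Subtype.val Subtype.val :
      frontier Ω × frontier Ω → Space d × Space d) :=
    measurable_subtype_coe.prodMap measurable_subtype_coe
  have hwm : Measurable (Function.extend (Subtype.val : frontier Ω → Space d) u 0) :=
    he.measurable_extend huc.measurable measurable_zero
  refine ⟨Function.extend Subtype.val u 0, hwm, ?_, γ.map (Prod.map Subtype.val Subtype.val),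
    ⟨?_, ?_⟩, ?_⟩
  · intro x hx y hy
    have := hu ⟨x, hx⟩ ⟨y, hy⟩
    rwa [← hext, ← hext] at this
  · rw [Measure.map_map measurable_fst hvm]
    conv_rhs => rw [← hmap μ hμ, ← h1, Measure.map_map measurable_subtype_coe measurable_fst]
    rfl
  · rw [Measure.map_map measurable_snd hvm]
    conv_rhs => rw [← hmap ν hν, ← h2, Measure.map_map measurable_subtype_coe measurable_snd]
    rfl
  · have hNm : Measurable fun z : Space d × Space d => N (z.1 - z.2) :=
      hNc.measurable.comp (measurable_fst.sub measurable_snd)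
    rw [ae_map_iff hvm.aemeasurable (measurableSet_eq_fun (by fun_prop) hNm)]
    filter_upwards [h3] with z hz
    simpa only [Prod.map_fst, Prod.map_snd, hext] using hz

/-- Almost every boundary point that has a point of contact has only one, and sending it there is a
Borel map. -/
theorem IsUniformlyConvexDomain.exists_isContactMap (hΩ : IsUniformlyConvexDomain Ω κ)
    (hd : 2 ≤ d) (hN : IsStrictlyConvexNorm N) (hwm : Measurable w)
    (hw : IsBoundaryPotential N Ω w) :
    ∃ G T, IsContactMap N Ω w G T ∧
      ∀ᵐ x ∂surfaceMeasure Ω, ∀ y, IsContact N Ω w x y → x ∈ G := by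
  have hNc := (continuous_seminorm N).measurable
  have hf : MeasurableSet (frontier Ω) := isClosed_frontier.measurableSet
  let M := toMeasurable (Measure.euclideanHausdorffMeasure (d - 1)) (branchSet N Ω w)
  have hMm : MeasurableSet M := measurableSet_toMeasurable _ _
  have hM0 : Measure.euclideanHausdorffMeasure (d - 1) M = 0 := by
    rw [measure_toMeasurable, hΩ.euclideanHausdorffMeasure_branchSet hd hN hw]
  -- The contact set over the complement of a negligible Borel set that contains all branch points;
  -- it is a Borel graph over its projection `G`, whose Borel subsets project to Borel sets.
  let Γ : Set (Space d × Space d) := {z | (z.1 ∈ frontier Ω ∧ z.1 ∉ M) ∧ z.2 ∈ frontier Ω ∧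
    z.2 ≠ z.1 ∧ w z.1 - w z.2 = N (z.1 - z.2)}
  have hΓm : MeasurableSet Γ := by
    refine ((measurable_fst hf).inter (measurable_fst hMm.compl)).inter
      ((measurable_snd hf).inter (MeasurableSet.inter ?_ ?_))
    · exact (measurableSet_eq_fun measurable_snd measurable_fst).compl
    · exact measurableSet_eq_fun (by fun_prop) (hNc.comp (measurable_fst.sub measurable_snd))
  have hinj : InjOn Prod.fst Γ := by
    rintro ⟨x, y⟩ ⟨⟨hx, hxM⟩, hy⟩ ⟨x', y'⟩ ⟨-, hy'⟩ (rfl : x = x')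
    by_contra hne
    exact hxM (subset_toMeasurable _ _
      ⟨hx, y, y', fun h => hne (Prod.ext rfl h), hy, hy'⟩)
  have himg : ∀ {A : Set (Space d × Space d)}, MeasurableSet A →
      MeasurableSet (Prod.fst '' (Γ ∩ A)) := fun hA =>
    (hΓm.inter hA).image_of_measurable_injOn measurable_fst (hinj.mono inter_subset_left)
  have hG : MeasurableSet (Prod.fst '' Γ) := by simpa using himg MeasurableSet.univ
  have hex : ∀ x, ∃ y, (x ∈ Prod.fst '' Γ → (x, y) ∈ Γ) ∧ (x ∉ Prod.fst '' Γ → y = x) := fun x => by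
    by_cases hx : x ∈ Prod.fst '' Γ
    · obtain ⟨⟨x, y⟩, hxy, rfl⟩ := hx
      exact ⟨y, fun _ => hxy, fun h => absurd (mem_image_of_mem _ hxy) h⟩
    · exact ⟨x, fun h => absurd h hx, fun _ => rfl⟩
  choose T hT hT' using hex
  refine ⟨Prod.fst '' Γ, T, ⟨hG, fun B hB => ?_, ?_, fun x hx => (hT x hx).2, ?_⟩, ?_⟩
  · have : T ⁻¹' B = Prod.fst '' (Γ ∩ Prod.snd ⁻¹' B) ∪ ((Prod.fst '' Γ)ᶜ ∩ B) := by
      ext x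
      by_cases hx : x ∈ Prod.fst '' Γ
      · simp only [mem_preimage, mem_union, mem_inter_iff, mem_compl_iff, hx, not_true, false_and,
          or_false]
        constructor
        · exact fun h => ⟨(x, T x), ⟨hT x hx, h⟩, rfl⟩
        · rintro ⟨⟨x', y⟩, ⟨hxy, hy⟩, rfl⟩
          have := hinj (hT x' hx) hxy rfl
          rw [Prod.mk.injEq] at this
          exact this.2 ▸ hy
      · have h' : x ∉ Prod.fst '' (Γ ∩ Prod.snd ⁻¹' B) := fun h =>
          hx (image_mono inter_subset_left h)
        simp only [mem_preimage, mem_union, mem_inter_iff, mem_compl_iff, hx, h', not_false_iff,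
          true_and, false_or, hT' x hx]
    rw [this]
    exact (himg (measurable_snd hB)).union (hG.compl.inter hB)
  · rintro _ ⟨z, hz, rfl⟩
    exact hz.1.1
  · intro x hx y hy
    have := hinj (hT x hx) (show (x, y) ∈ Γ from ⟨(hT x hx).1, hy⟩) rfl
    rw [Prod.mk.injEq] at this
    exact this.2.symm
  · rw [surfaceMeasure]
    filter_upwards [ae_restrict_mem hf,
      ae_restrict_of_ae (measure_eq_zero_iff_ae_notMem.1 hM0)] with x hx hxM y hy
    exact ⟨(x, y), ⟨⟨hx, hxM⟩, hy⟩, rfl⟩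

/-- A plan concentrated where a potential decreases at the full rate is optimal, and every
optimal plan is concentrated there. -/
theorem IsBoundaryPotential.isOptimalPlan (hw : IsBoundaryPotential N Ω w) (hwm : Measurable w)
    (hΩ : IsCompact (frontier Ω)) [IsFiniteMeasure μ] [IsFiniteMeasure ν]
    (hμ : ∀ᵐ x ∂μ, x ∈ frontier Ω) (hν : ∀ᵐ x ∂ν, x ∈ frontier Ω)
    {γ : Measure (Space d × Space d)} (hγ : IsTransportPlan μ ν γ)
    (hγw : ∀ᵐ z ∂γ, w z.1 - w z.2 = N (z.1 - z.2)) :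
    IsOptimalPlan N μ ν γ ∧
      ∀ γ', IsOptimalPlan N μ ν γ' → ∀ᵐ z ∂γ', w z.1 - w z.2 = N (z.1 - z.2) := by
  have hNm : Measurable fun z : Space d × Space d => N (z.1 - z.2) :=
    (continuous_seminorm N).measurable.comp (measurable_fst.sub measurable_snd)
  obtain ⟨M, hM⟩ := hΩ.exists_bound_of_continuousOn hw.continuousOn
  -- The potential is shifted so as to be nonnegative on the boundary.
  let v : Space d → ℝ≥0∞ := fun x => ENNReal.ofReal (w x + M)
  have hvm : Measurable v := by fun_prop
  have hMw : ∀ x ∈ frontier Ω, 0 ≤ w x + M := fun x hx => by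
    have := (abs_le.1 (hM x hx)).1; linarith
  have hvfin : ∀ μ : Measure (Space d), IsFiniteMeasure μ → (∀ᵐ x ∂μ, x ∈ frontier Ω) →
      ∫⁻ x, v x ∂μ ≠ ∞ := fun μ _ hμ => by
    refine ne_top_of_le_ne_top (b := ENNReal.ofReal (M + M) * μ univ)
      (ENNReal.mul_ne_top ENNReal.ofReal_ne_top (measure_ne_top μ univ)) ?_
    rw [← lintegral_const]
    refine lintegral_mono_ae (hμ.mono fun x hx => ?_)
    exact ENNReal.ofReal_le_ofReal (by have := (abs_le.1 (hM x hx)).2; linarith)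
  have hfst : ∀ {γ}, IsTransportPlan μ ν γ → ∫⁻ z : Space d × Space d, v z.1 ∂γ = ∫⁻ x, v x ∂μ :=
    fun h => by rw [← h.1, lintegral_map hvm measurable_fst]
  have hsnd : ∀ {γ}, IsTransportPlan μ ν γ →
      ∫⁻ z : Space d × Space d, ENNReal.ofReal (N (z.1 - z.2)) + v z.2 ∂γ
        = transportCost N γ + ∫⁻ x, v x ∂ν :=
    fun h => by
      rw [lintegral_add_left hNm.ennreal_ofReal, ← h.2, lintegral_map hvm measurable_snd]
      rfl
  have hmem : ∀ {γ}, IsTransportPlan μ ν γ →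
      ∀ᵐ z : Space d × Space d ∂γ, z.1 ∈ frontier Ω ∧ z.2 ∈ frontier Ω := fun h =>
    (ae_of_ae_map measurable_fst.aemeasurable (h.1.symm ▸ hμ)).and
      (ae_of_ae_map measurable_snd.aemeasurable (h.2.symm ▸ hν))
  have hle : ∀ {γ}, IsTransportPlan μ ν γ →
      ∀ᵐ z : Space d × Space d ∂γ, v z.1 ≤ ENNReal.ofReal (N (z.1 - z.2)) + v z.2 := fun h => by
    filter_upwards [hmem h] with z hz
    rw [← ENNReal.ofReal_add (apply_nonneg N _) (hMw _ hz.2)]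
    exact ENNReal.ofReal_le_ofReal (by have := hw _ hz.1 _ hz.2; linarith)
  have hcost : transportCost N γ + ∫⁻ x, v x ∂ν = ∫⁻ x, v x ∂μ := by
    rw [← hsnd hγ, ← hfst hγ]
    refine lintegral_congr_ae ?_
    filter_upwards [hmem hγ, hγw] with z hz hzw
    rw [← ENNReal.ofReal_add (apply_nonneg N _) (hMw _ hz.2), ← hzw]
    ring_nf
    rfl
  have hopt : ∀ γ', IsTransportPlan μ ν γ' → transportCost N γ ≤ transportCost N γ' := by
    intro γ' h
    refine (ENNReal.add_le_add_iff_right (hvfin ν inferInstance hν)).1 ?_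
    rw [hcost, ← hfst h, ← hsnd h]
    exact lintegral_mono_ae (hle h)
  refine ⟨⟨hγ, hopt⟩, fun γ' h => ?_⟩
  have heq := ae_eq_of_ae_le_of_lintegral_le (hle h.1)
    (by rw [hfst h.1]; exact hvfin μ inferInstance hμ)
    (hNm.ennreal_ofReal.add (hvm.comp measurable_snd)).aemeasurable (by
      rw [hsnd h.1, hfst h.1, ← hcost]
      gcongr
      exact h.2 γ hγ)
  filter_upwards [heq, hmem h.1] with z hz hzm
  rw [← ENNReal.ofReal_add (apply_nonneg N _) (hMw _ hzm.2),
    ENNReal.ofReal_eq_ofReal_iff (hMw _ hzm.1)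
      (add_nonneg (apply_nonneg N _) (hMw _ hzm.2))] at hz
  linarith

/-- Existence and uniqueness of the optimal plan, and its structure: it is induced by a contact
map. -/
theorem IsUniformlyConvexDomain.exists_optimal_contactMap (hΩ : IsUniformlyConvexDomain Ω κ)
    (hd : 2 ≤ d) (hN : IsStrictlyConvexNorm N) [IsFiniteMeasure μ] [IsFiniteMeasure ν]
    (hμ : μ ≪ surfaceMeasure Ω) (hν : ν (frontier Ω)ᶜ = 0) (hμν : μ univ = ν univ)
    (hsing : Measure.MutuallySingular μ ν) :
    ∃ w G T, Measurable w ∧ IsBoundaryPotential N Ω w ∧ IsContactMap N Ω w G T ∧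
      (∀ᵐ x ∂μ, x ∈ G) ∧ IsOptimalPlan N μ ν (μ.map fun x => (x, T x)) ∧
      ∀ γ, IsOptimalPlan N μ ν γ → γ = μ.map fun x => (x, T x) := by
  have hf : MeasurableSet (frontier Ω) := isClosed_frontier.measurableSet
  have hcomp : IsCompact (frontier Ω) :=
    hΩ.isCompact.of_isClosed_subset isClosed_frontier hΩ.frontier_subset
  have hμf : ∀ᵐ x ∂μ, x ∈ frontier Ω := hμ.ae_le (ae_restrict_mem hf)
  have hνf : ∀ᵐ x ∂ν, x ∈ frontier Ω := mem_ae_iff.2 hν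
  obtain ⟨w, hwm, hw, γ₀, hγ₀, hγ₀w⟩ := hΩ.exists_boundaryPotential_plan hd N
    (mem_ae_iff.1 hμf) hν hμν
  obtain ⟨G, T, hT, hG⟩ := hΩ.exists_isContactMap hd hN hwm hw
  obtain ⟨hopt, hconc⟩ := hw.isOptimalPlan hwm hcomp hμf hνf hγ₀ hγ₀w
  obtain ⟨s, -, hs, hs'⟩ := hsing
  have key : ∀ γ, IsOptimalPlan N μ ν γ → ∀ᵐ z ∂γ, z.1 ∈ G ∧ z.2 = T z.1 := by
    intro γ hγ
    have h1 : ∀ᵐ x ∂μ, x ∉ s ∧ ∀ y, IsContact N Ω w x y → x ∈ G :=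
      (measure_eq_zero_iff_ae_notMem.1 hs).and (hμ.ae_le hG)
    have h2 : ∀ᵐ x ∂ν, x ∈ s ∧ x ∈ frontier Ω := Filter.Eventually.and (mem_ae_iff.2 hs') hνf
    -- The mutual singularity of the marginals excludes the diagonal.
    filter_upwards [ae_of_ae_map measurable_fst.aemeasurable (hγ.1.1.symm ▸ h1),
      ae_of_ae_map measurable_snd.aemeasurable (hγ.1.2.symm ▸ h2), hconc γ hγ] with z hz1 hz2 hz
    have hc : IsContact N Ω w z.1 z.2 := ⟨hz2.2, fun h => hz1.1 (h ▸ hz2.1), hz⟩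
    exact ⟨hz1.2 _ hc, hT.unique _ (hz1.2 _ hc) _ hc⟩
  have hgraph : ∀ γ, IsOptimalPlan N μ ν γ → γ = μ.map fun x => (x, T x) := by
    intro γ hγ
    have hm : Measurable fun x => (x, T x) := measurable_id.prodMk hT.measurable
    rw [← hγ.1.1, Measure.map_map hm measurable_fst]
    conv_lhs => rw [← Measure.map_id (μ := γ)]
    refine Measure.map_congr ((key γ hγ).mono fun z hz => ?_)
    exact Prod.ext rfl hz.2
  refine ⟨w, G, T, hwm, hw, hT, ?_, hgraph γ₀ hopt ▸ hopt, hgraph⟩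
  rw [← hγ₀.1]
  refine (ae_map_iff (p := (· ∈ G)) measurable_fst.aemeasurable hT.measurableSet).2 ?_
  exact (key γ₀ hopt).mono fun z hz => hz.1

end

/-! ### The integral estimate -/

section

/-- Let `F` be injective on `A`, with the image of `η` on `A` bounded by `C` times the reference
measure `m`. Then the image of the measure with density `g` with respect to `η` on `A` has a density
with respect to `m`, whose `p`-norm is bounded by that of `g`: this density is the product of a
function bounded by `C` and of the function that is equal to `g` at the preimage. -/
theorem lintegral_rnDeriv_map_withDensity_rpow_le {Q X : Type*} [MeasurableSpace Q]
    [StandardBorelSpace Q] [MeasurableSpace X] [MeasurableSpace.CountablySeparated X]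
    (η : Measure Q) [SFinite η] (m : Measure X) [SigmaFinite m] {F : Q → X} (hF : Measurable F)
    {A : Set Q} (hA : MeasurableSet A) (hinj : InjOn F A) {C : ℝ≥0}
    (hC : ∀ B, MeasurableSet B → η (A ∩ F ⁻¹' B) ≤ C * m B) {g : Q → ℝ≥0∞} (hg : Measurable g)
    {p : ℝ} (hp : 1 < p) :
    ((η.restrict A).withDensity g).map F ≪ m ∧
      ∫⁻ x, (((η.restrict A).withDensity g).map F).rnDeriv m x ^ p ∂m ≤
        (C : ℝ≥0∞) ^ (p - 1) * ∫⁻ q in A, g q ^ p ∂η := by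
  set σ := ((η.restrict A).withDensity g).map F with hσ
  set k := (η.restrict A).map F with hk
  have hkB : ∀ B, MeasurableSet B → k B ≤ C * m B := fun B hB => by
    rw [hk, Measure.map_apply hF hB, Measure.restrict_apply (hF hB), inter_comm]
    exact hC B hB
  have hkm : k ≪ m := Measure.AbsolutelyContinuous.mk fun B hB h => by
    simpa [h] using hkB B hB
  have hkd : m.withDensity (k.rnDeriv m) = k := Measure.withDensity_rnDeriv_eq k m hkm
  have hρ : k.rnDeriv m ≤ᵐ[m] fun _ => (C : ℝ≥0∞) := by
    refine ae_le_of_forall_setLIntegral_le_of_sigmaFinite (Measure.measurable_rnDeriv _ _)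
      fun B hB _ => ?_
    rw [setLIntegral_const]
    exact (Measure.setLIntegral_rnDeriv_le B).trans (hkB B hB)
  have : StandardBorelSpace A := hA.standardBorel
  have he : MeasurableEmbedding (A.domRestrict F) :=
    (hF.comp measurable_subtype_coe).measurableEmbedding hinj.injective
  -- The function equal to `g` at the preimage; it is Borel by the theorem of Lusin and Souslin.
  let u : X → ℝ≥0∞ := Function.extend (A.domRestrict F) (fun q => g q) 0
  have hu : Measurable u := he.measurable_extend (hg.comp measurable_subtype_coe) measurable_zero
  have huF : ∀ q ∈ A, u (F q) = g q := fun q hq =>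
    he.injective.extend_apply (fun q : A => g q) 0 ⟨q, hq⟩
  have hσu : σ = k.withDensity u := by
    ext B hB
    rw [hσ, Measure.map_apply hF hB, withDensity_apply _ (hF hB), withDensity_apply _ hB, hk,
      setLIntegral_map hB hu hF]
    refine lintegral_congr_ae (ae_restrict_of_ae ?_)
    filter_upwards [ae_restrict_mem hA] with q hq
    rw [huF q hq]
  have hσm : σ = m.withDensity (k.rnDeriv m * u) := by
    rw [withDensity_mul m (Measure.measurable_rnDeriv _ _) hu, hkd, hσu]
  refine ⟨hσm ▸ withDensity_absolutelyContinuous _ _, ?_⟩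
  have hd : σ.rnDeriv m =ᵐ[m] k.rnDeriv m * u := by
    rw [hσm]
    exact Measure.rnDeriv_withDensity m ((Measure.measurable_rnDeriv _ _).mul hu)
  calc ∫⁻ x, σ.rnDeriv m x ^ p ∂m
      ≤ ∫⁻ x, (C : ℝ≥0∞) ^ (p - 1) * (k.rnDeriv m x * u x ^ p) ∂m := by
        refine lintegral_mono_ae ?_
        filter_upwards [hd, hρ] with x hx hρx
        rw [hx, Pi.mul_apply, ENNReal.mul_rpow_of_nonneg _ _ (by linarith), ← mul_assoc]
        gcongr
        calc k.rnDeriv m x ^ p = k.rnDeriv m x ^ (p - 1) * k.rnDeriv m x ^ (1 : ℝ) := by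
              rw [← ENNReal.rpow_add_of_nonneg _ _ (by linarith) zero_le_one, sub_add_cancel]
          _ ≤ _ := by
              rw [ENNReal.rpow_one]
              gcongr
    _ = (C : ℝ≥0∞) ^ (p - 1) * ∫⁻ x, u x ^ p ∂k := by
        have hm : Measurable fun x => k.rnDeriv m x * u x ^ p :=
          (Measure.measurable_rnDeriv _ _).mul (hu.pow_const p)
        rw [lintegral_const_mul _ hm]
        congr 1
        conv_rhs => rw [← hkd]
        rw [lintegral_withDensity_eq_lintegral_mul _ (Measure.measurable_rnDeriv _ _)
          (hu.pow_const p)]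
        rfl
    _ = (C : ℝ≥0∞) ^ (p - 1) * ∫⁻ q in A, g q ^ p ∂η := by
        rw [hk, lintegral_map (hu.pow_const p) hF]
        congr 1
        exact setLIntegral_congr_fun hA fun q hq => by rw [huF q hq]

/-- The endpoint `1`, which the cylinder leaves out, does not matter. -/
theorem lintegral_Ioo_indicator_Iic {τ : ℝ} (hτ : τ ≤ 1) (K : ℝ → ℝ≥0∞) :
    ∫⁻ s in Ioo (0 : ℝ) 1, (Iic τ).indicator K s = ∫⁻ s in Ioc 0 τ, K s := by
  rw [lintegral_indicator measurableSet_Iic, Measure.restrict_restrict measurableSet_Iic]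
  have h : Iic τ ∩ Ioc (0 : ℝ) 1 = Ioc 0 τ := by
    ext s; simp only [mem_inter_iff, mem_Iic, mem_Ioc]; constructor
    · exact fun h => ⟨h.2.1, h.1⟩
    · exact fun h => ⟨h.2, h.1, h.2.trans hτ⟩
  rw [← h, Measure.restrict_congr_set ((ae_eq_refl (Iic τ)).inter Ioo_ae_eq_Ioc)]

variable {d : ℕ} {Ω : Set (Space d)} {κ : ℝ} {N : Seminorm ℝ (Space d)} {w : Space d → ℝ}
  {G : Set (Space d)} {T : Space d → Space d} {φ : Space d → ℝ≥0∞} {p τ : ℝ}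

/-- The density with respect to the cone measure which, under interpolation, gives the partial
transport density `σ^{(τ)}`. -/
noncomputable def transportWeight (N : Seminorm ℝ (Space d)) (T : Space d → Space d)
    (φ : Space d → ℝ≥0∞) (τ : ℝ) : Space d × ℝ → ℝ≥0∞ :=
  {q | q.2 ≤ τ}.indicator fun q => φ q.1 * ENNReal.ofReal (N (q.1 - T q.1)) / coneWeight T q

theorem measurable_transportWeight (N : Seminorm ℝ (Space d)) (hT : Measurable T)
    (hφ : Measurable φ) (τ : ℝ) : Measurable (transportWeight N T φ τ) := by
  have hN := (continuous_seminorm N).measurable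
  refine Measurable.indicator ?_ (measurableSet_le measurable_snd measurable_const)
  have := measurable_coneWeight hT
  fun_prop

theorem coneWeight_eq (T : Space d → Space d) (x : Space d) {s : ℝ} (hs : s < 1) :
    coneWeight T (x, s) = ENNReal.ofReal (1 - s) ^ ((d - 1 : ℕ) : ℝ) * edist x (T x) ^ (2 : ℝ) := by
  rw [coneWeight, ENNReal.ofReal_mul (by have : 0 ≤ 1 - s := by linarith
                                         positivity), ENNReal.ofReal_pow (by linarith),
    ENNReal.ofReal_pow (norm_nonneg _), edist_dist, dist_eq_norm, ENNReal.rpow_natCast]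
  norm_cast

/-- The powers of the weight combine: those of the distance to `2 - p`, and those of `1 - s` to
`-(d - 1) (p - 1)`. -/
theorem coneWeight_mul_transportWeight_rpow_le (hd : 1 ≤ d) {c : ℝ≥0} (hc : ∀ v, N v ≤ c * ‖v‖)
    (hp : 1 < p) {x : Space d} (hx : T x ≠ x) {s : ℝ} (hs : s < 1) :
    coneWeight T (x, s) * transportWeight N T φ τ (x, s) ^ p ≤
      (c : ℝ≥0∞) ^ p * ((φ x ^ p * edist x (T x) ^ (2 - p)) *
        (Iic τ).indicator (fun s => ENNReal.ofReal (1 - s) ^ (-(((d : ℝ) - 1) * (p - 1)))) s) := by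
  by_cases hτ : s ≤ τ
  swap
  · rw [transportWeight, indicator_of_notMem (by exact hτ), ENNReal.zero_rpow_of_pos (by linarith),
      mul_zero]
    exact zero_le
  rw [transportWeight, indicator_of_mem (by exact hτ), indicator_of_mem (by exact hτ)]
  set δ := edist x (T x) with hδ
  set b := ENNReal.ofReal (1 - s) with hb
  have hδ0 : δ ≠ 0 := fun h => hx (edist_eq_zero.1 h).symm
  have hδt : δ ≠ ∞ := edist_ne_top _ _
  have hb0 : b ≠ 0 := (ENNReal.ofReal_pos.2 (by linarith)).ne'
  have hbt : b ≠ ∞ := ENNReal.ofReal_ne_top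
  have hN : ENNReal.ofReal (N (x - T x)) ≤ c * δ := by
    rw [hδ, edist_dist, dist_eq_norm, ← ENNReal.ofReal_coe_nnreal,
      ← ENNReal.ofReal_mul c.coe_nonneg]
    exact ENNReal.ofReal_le_ofReal (hc _)
  rw [coneWeight_eq T x hs, ← hb, ← hδ]
  set W := b ^ ((d - 1 : ℕ) : ℝ) * δ ^ (2 : ℝ) with hW
  have h1 : b ^ ((d - 1 : ℕ) : ℝ) ≠ 0 := (ENNReal.rpow_pos hb0.bot_lt hbt).ne'
  have h2 : δ ^ (2 : ℝ) ≠ 0 := (ENNReal.rpow_pos hδ0.bot_lt hδt).ne'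
  have h1t : b ^ ((d - 1 : ℕ) : ℝ) ≠ ∞ := ENNReal.rpow_ne_top_of_nonneg (by positivity) hbt
  have h2t : δ ^ (2 : ℝ) ≠ ∞ := ENNReal.rpow_ne_top_of_nonneg (by positivity) hδt
  have hW0 : W ≠ 0 := mul_ne_zero h1 h2
  have hWt : W ≠ ∞ := ENNReal.mul_ne_top h1t h2t
  have hWp : W * W⁻¹ ^ p = b ^ (-(((d : ℝ) - 1) * (p - 1))) * δ ^ (2 - 2 * p) := by
    rw [← ENNReal.rpow_neg_one W, ← ENNReal.rpow_mul]
    conv_lhs => enter [1]; rw [← ENNReal.rpow_one W]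
    rw [← ENNReal.rpow_add _ _ hW0 hWt, hW, ENNReal.mul_rpow_of_ne_zero h1 h2, ← ENNReal.rpow_mul,
      ← ENNReal.rpow_mul, Nat.cast_sub hd, Nat.cast_one]
    congr 2 <;> ring
  calc W * (φ x * ENNReal.ofReal (N (x - T x)) / W) ^ p
      ≤ W * (φ x * (c * δ) * W⁻¹) ^ p := by
        rw [div_eq_mul_inv]
        gcongr
    _ = c ^ p * (φ x ^ p * (δ ^ p * (W * W⁻¹ ^ p))) := by
        have hp0 : 0 ≤ p := by linarith
        rw [ENNReal.mul_rpow_of_nonneg _ _ hp0, ENNReal.mul_rpow_of_nonneg _ _ hp0,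
          ENNReal.mul_rpow_of_nonneg _ _ hp0]
        ring
    _ = c ^ p * (φ x ^ p * ((δ ^ p * δ ^ (2 - 2 * p)) * b ^ (-(((d : ℝ) - 1) * (p - 1))))) := by
        rw [hWp]
        ring
    _ = _ := by
        rw [← ENNReal.rpow_add _ _ hδ0 hδt]
        ring_nf

theorem coneWeight_ne_zero {x : Space d} (hx : T x ≠ x) {s : ℝ} (hs : s < 1) :
    coneWeight T (x, s) ≠ 0 := by
  rw [coneWeight]
  refine (ENNReal.ofReal_pos.2 ?_).ne'
  have h1 : 0 < 1 - s := by linarith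
  have h2 : 0 < ‖x - T x‖ := norm_pos_iff.2 (sub_ne_zero.2 hx.symm)
  positivity

instance (Ω : Set (Space d)) (T : Space d → Space d) [SFinite (surfaceMeasure Ω)] :
    SFinite (coneMeasure Ω T) := by
  unfold coneMeasure cylinderMeasure
  infer_instance

theorem interpolatedMeasure_map_apply [SFinite (surfaceMeasure Ω)] (hT : Measurable T)
    (hφ : Measurable φ) (t : ℝ) {B : Set (Space d)} (hB : MeasurableSet B) :
    interpolatedMeasure N (((surfaceMeasure Ω).withDensity φ).map fun x => (x, T x)) t B =
      ∫⁻ x, (interpolationMap T ⁻¹' B).indicator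
        (fun q => φ q.1 * ENNReal.ofReal (N (q.1 - T q.1))) (x, t) ∂surfaceMeasure Ω := by
  have hN : Measurable fun z : Space d × Space d => ENNReal.ofReal (N (z.1 - z.2)) :=
    ((continuous_seminorm N).measurable.comp (measurable_fst.sub measurable_snd)).ennreal_ofReal
  have hm : Measurable fun x => (x, T x) := measurable_id.prodMk hT
  have hNT : Measurable fun x => ENNReal.ofReal (N (x - T x)) := hN.comp hm
  have hI : Measurable fun z : Space d × Space d => (1 - t) • z.1 + t • z.2 := by fun_prop
  rw [interpolatedMeasure, Measure.map_apply hI hB, withDensity_apply _ (hI hB),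
    setLIntegral_map (hI hB) hN hm, ← lintegral_indicator (hm (hI hB)),
    lintegral_withDensity_eq_lintegral_mul _ hφ (hNT.indicator (hm (hI hB)))]
  refine lintegral_congr fun x => ?_
  by_cases hx : interpolationMap T (x, t) ∈ B
  · rw [Pi.mul_apply, indicator_of_mem (by exact hx), indicator_of_mem (by exact hx)]
  · rw [Pi.mul_apply, indicator_of_notMem (by exact hx), indicator_of_notMem (by exact hx),
      mul_zero]

/-- The partial transport density of the plan induced by `T` is the image, under interpolation, of
a measure that has a density with respect to the cone measure. -/
theorem partialTransportDensity_eq_map [IsFiniteMeasure (surfaceMeasure Ω)]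
    (hT : IsContactMap N Ω w G T) (hφ : Measurable φ)
    [IsFiniteMeasure ((surfaceMeasure Ω).withDensity φ)]
    (hG : ∀ᵐ x ∂(surfaceMeasure Ω).withDensity φ, x ∈ G) (hτ : τ ≤ 1) :
    partialTransportDensity N (((surfaceMeasure Ω).withDensity φ).map fun x => (x, T x)) τ =
      (((coneMeasure Ω T).restrict (G ×ˢ Ioo (0 : ℝ) 1)).withDensity
        (transportWeight N T φ τ)).map (interpolationMap T) := by
  have hN := (continuous_seminorm N).measurable
  have hTm := hT.measurable
  have hF := measurable_interpolationMap hTm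
  have hA : MeasurableSet (G ×ˢ Ioo (0 : ℝ) 1) := hT.measurableSet.prod measurableSet_Ioo
  have hg := measurable_transportWeight N hTm hφ τ
  have hW := measurable_coneWeight hTm
  ext B hB
  have hFB := hF hB
  rw [partialTransportDensity_apply N _ τ hB, Measure.map_apply hF hB, withDensity_apply _ hFB,
    Measure.restrict_restrict hFB, ← lintegral_indicator (hFB.inter hA), coneMeasure,
    lintegral_withDensity_eq_lintegral_mul _ hW (hg.indicator (hFB.inter hA)), cylinderMeasure,
    lintegral_prod_symm _ (hW.mul (hg.indicator (hFB.inter hA))).aemeasurable,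
    ← lintegral_Ioo_indicator_Iic hτ]
  refine setLIntegral_congr_fun measurableSet_Ioo fun s hs => ?_
  rw [ae_withDensity_iff hφ] at hG
  by_cases hsτ : s ≤ τ
  · rw [indicator_of_mem (by exact hsτ), interpolatedMeasure_map_apply hTm hφ s hB]
    refine lintegral_congr_ae ?_
    filter_upwards [hG] with x hx
    rw [Pi.mul_apply]
    by_cases hxB : interpolationMap T (x, s) ∈ B
    swap
    · rw [indicator_of_notMem (by exact hxB), indicator_of_notMem (fun h => hxB h.1), mul_zero]
    rw [indicator_of_mem (by exact hxB)]
    by_cases hxG : x ∈ G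
    · rw [indicator_of_mem (by exact ⟨hxB, hxG, hs⟩), transportWeight,
        indicator_of_mem (by exact hsτ), ENNReal.mul_div_cancel]
      · exact coneWeight_ne_zero (hT.contact x hxG).2.1 hs.2
      · exact ENNReal.ofReal_ne_top
    · have h0 : φ x = 0 := by
        by_contra h
        exact hxG (hx h)
      rw [indicator_of_notMem (fun h => hxG h.2.1), h0, zero_mul, mul_zero]
  · rw [indicator_of_notMem (by exact hsτ), eq_comm]
    refine (lintegral_congr fun x => ?_).trans lintegral_zero
    have : transportWeight N T φ τ (x, s) = 0 := indicator_of_notMem (by exact hsτ) _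
    rw [Pi.mul_apply, (indicator_apply_eq_zero.2 fun _ => this :
      (interpolationMap T ⁻¹' B ∩ G ×ˢ Ioo (0 : ℝ) 1).indicator (transportWeight N T φ τ)
        (x, s) = 0), mul_zero]

theorem IsUniformlyConvexDomain.partialTransportDensity_estimate
    (hΩ : IsUniformlyConvexDomain Ω κ) (hd : 2 ≤ d) (hN : IsStrictlyConvexNorm N) {c : ℝ≥0}
    (hc : ∀ v, N v ≤ c * ‖v‖) (hp : 1 < p) (hwm : Measurable w) (hw : IsBoundaryPotential N Ω w)
    (hT : IsContactMap N Ω w G T) (hφ : Measurable φ)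
    [IsFiniteMeasure ((surfaceMeasure Ω).withDensity φ)]
    (hG : ∀ᵐ x ∂(surfaceMeasure Ω).withDensity φ, x ∈ G) (hτ : τ ≤ 1)
    {σ : Measure (Space d)} (hσ : σ = partialTransportDensity N
      (((surfaceMeasure Ω).withDensity φ).map fun x => (x, T x)) τ) :
    σ ≪ volume ∧ ∫⁻ x, σ.rnDeriv volume x ^ p ≤
      ((coneConst d κ (Metric.diam Ω) ^ (p - 1) * c ^ p : ℝ≥0) : ℝ≥0∞) *
        (∫⁻ t in Ioc 0 τ, ENNReal.ofReal (1 - t) ^ (-(((d : ℝ) - 1) * (p - 1)))) *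
        ∫⁻ x, φ x ^ p * edist x (T x) ^ (2 - p) ∂surfaceMeasure Ω := by
  have := hΩ.finite_surfaceMeasure hd
  have hTm := hT.measurable
  have hA : MeasurableSet (G ×ˢ Ioo (0 : ℝ) 1) := hT.measurableSet.prod measurableSet_Ioo
  have hg := measurable_transportWeight N hTm hφ τ
  have hW := measurable_coneWeight hTm
  rw [partialTransportDensity_eq_map hT hφ hG hτ] at hσ
  subst hσ
  obtain ⟨h1, h2⟩ := lintegral_rnDeriv_map_withDensity_rpow_le (coneMeasure Ω T)
    (volume : Measure (Space d)) (measurable_interpolationMap hTm) hA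
    (hΩ.injOn_interpolationMap hN hw hT)
    (fun B hB => hΩ.coneMeasure_contactMap_le hN hd hw hwm hT hB) hg hp
  refine ⟨h1, h2.trans ?_⟩
  have hb : Measurable fun s : ℝ =>
      ENNReal.ofReal (1 - s) ^ (-(((d : ℝ) - 1) * (p - 1))) := by fun_prop
  have hφT : Measurable fun x => φ x ^ p * edist x (T x) ^ (2 - p) := by fun_prop
  have key : ∫⁻ q in G ×ˢ Ioo (0 : ℝ) 1, transportWeight N T φ τ q ^ p ∂coneMeasure Ω T ≤
      (c : ℝ≥0∞) ^ p * ((∫⁻ x, φ x ^ p * edist x (T x) ^ (2 - p) ∂surfaceMeasure Ω) *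
        ∫⁻ t in Ioc 0 τ, ENNReal.ofReal (1 - t) ^ (-(((d : ℝ) - 1) * (p - 1)))) := by
    have hm : Measurable fun z : Space d × ℝ => φ z.1 ^ p * edist z.1 (T z.1) ^ (2 - p) *
        (Iic τ).indicator
          (fun s => ENNReal.ofReal (1 - s) ^ (-(((d : ℝ) - 1) * (p - 1)))) z.2 :=
      (hφT.comp measurable_fst).mul ((hb.indicator measurableSet_Iic).comp measurable_snd)
    rw [← lintegral_Ioo_indicator_Iic hτ,
      ← lintegral_prod_mul hφT.aemeasurable (hb.indicator measurableSet_Iic).aemeasurable,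
      ← lintegral_const_mul _ hm, ← lintegral_indicator hA, coneMeasure, cylinderMeasure,
      lintegral_withDensity_eq_lintegral_mul _ hW ((hg.pow_const p).indicator hA)]
    refine lintegral_mono ?_
    rintro ⟨x, s⟩
    rw [Pi.mul_apply]
    by_cases hq : (x, s) ∈ G ×ˢ Ioo (0 : ℝ) 1
    · rw [indicator_of_mem hq]
      exact coneWeight_mul_transportWeight_rpow_le (by omega) hc hp (hT.contact x hq.1).2.1 hq.2.2
    · rw [indicator_of_notMem hq, mul_zero]
      exact zero_le
  calc _ ≤ _ := mul_le_mul_right key _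
    _ = _ := by
      rw [ENNReal.coe_mul, ENNReal.coe_rpow_of_nonneg _ (by linarith),
        ENNReal.coe_rpow_of_nonneg _ (by linarith)]
      ring

end

end BoundaryTransport

theorem mainTheorem3 {d : ℕ} (N : Seminorm ℝ (BoundaryTransport.Space d))
    (hN : BoundaryTransport.IsStrictlyConvexNorm N)
    (hUA : BoundaryTransport.UniquenessAssumption N) (p : ℝ) (hp : 1 < p) :
    ∃ C : ℝ → ℝ → ℝ≥0,
      ∀ (κ : ℝ) (Ω : Set (BoundaryTransport.Space d)),
        BoundaryTransport.IsUniformlyConvexDomain Ω κ →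
      ∀ f : BoundaryTransport.Space d → ℝ,
        0 ≤ᵐ[BoundaryTransport.surfaceMeasure Ω] f →
        MemLp f (ENNReal.ofReal p) (BoundaryTransport.surfaceMeasure Ω) →
      ∀ ν : Measure (BoundaryTransport.Space d),
        ν (frontier Ω)ᶜ = 0 →
        ν univ = BoundaryTransport.boundaryMeasure Ω f univ →
        Measure.MutuallySingular (BoundaryTransport.boundaryMeasure Ω f) ν →
        (2 < p →
          ∫⁻ x, ENNReal.ofReal (f x) ^ p * Metric.infEDist x ν.support ^ (2 - p)
            ∂(BoundaryTransport.surfaceMeasure Ω) < ∞) →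
      ∃ (γ : Measure (BoundaryTransport.Space d × BoundaryTransport.Space d))
        (T : BoundaryTransport.Space d → BoundaryTransport.Space d),
        BoundaryTransport.IsOptimalPlan N (BoundaryTransport.boundaryMeasure Ω f) ν γ ∧
        (∀ γ', BoundaryTransport.IsOptimalPlan N (BoundaryTransport.boundaryMeasure Ω f) ν γ' →
          γ' = γ) ∧
        Measurable T ∧
        γ = (BoundaryTransport.boundaryMeasure Ω f).map (fun x => (x, T x)) ∧
        ∀ τ : ℝ, 0 ≤ τ → τ ≤ 1 →
          BoundaryTransport.partialTransportDensity N γ τ ≪ volume ∧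
          ∫⁻ x in Ω, (BoundaryTransport.partialTransportDensity N γ τ).rnDeriv volume x ^ p ≤
            C κ (Metric.diam Ω)
              * (∫⁻ t in Ioc 0 τ, ENNReal.ofReal (1 - t) ^ (-(((d : ℝ) - 1) * (p - 1))))
              * ∫⁻ x, ENNReal.ofReal (f x) ^ p * edist x (T x) ^ (2 - p)
                  ∂(BoundaryTransport.surfaceMeasure Ω) := by

  obtain ⟨c, hc⟩ := BoundaryTransport.exists_seminorm_le N
  have hd : 2 ≤ d := hUA.elim (fun h => h.ge) And.left
  refine ⟨fun κ D => BoundaryTransport.coneConst d κ D ^ (p - 1) * c ^ p, ?_⟩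
  intro κ Ω hΩ f _ hfp ν hν hmass hsing _
  have := hΩ.finite_surfaceMeasure hd
  let φ : BoundaryTransport.Space d → ℝ≥0∞ := fun x => ENNReal.ofReal (hfp.1.mk f x)
  have hφ : Measurable φ := hfp.1.stronglyMeasurable_mk.measurable.ennreal_ofReal
  have hφf : φ =ᵐ[BoundaryTransport.surfaceMeasure Ω] fun x => ENNReal.ofReal (f x) :=
    hfp.1.ae_eq_mk.mono fun x hx => congrArg ENNReal.ofReal hx.symm
  have hμ : BoundaryTransport.boundaryMeasure Ω f =
      (BoundaryTransport.surfaceMeasure Ω).withDensity φ := withDensity_congr_ae hφf.symm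
  have hint : Integrable f (BoundaryTransport.surfaceMeasure Ω) :=
    hfp.integrable (by simpa using hp.le)
  have hfin : IsFiniteMeasure (BoundaryTransport.boundaryMeasure Ω f) :=
    isFiniteMeasure_withDensity hint.lintegral_lt_top.ne
  have hνfin : IsFiniteMeasure ν := ⟨hmass ▸ measure_lt_top _ _⟩
  obtain ⟨w, G, T, hwm, hw, hT, hG, hopt, huniq⟩ := hΩ.exists_optimal_contactMap hd hN
    (μ := BoundaryTransport.boundaryMeasure Ω f) (withDensity_absolutelyContinuous _ _) hν hmass.symm hsing
  refine ⟨_, T, hopt, huniq, hT.measurable, rfl, fun τ _ hτ => ?_⟩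
  rw [hμ] at hfin hG ⊢
  obtain ⟨h1, h2⟩ := hΩ.partialTransportDensity_estimate hd hN hc hp hwm hw hT hφ hG hτ rfl
  refine ⟨h1, (setLIntegral_le_lintegral _ _).trans (h2.trans_eq ?_)⟩
  congr 1
  refine lintegral_congr_ae (hφf.mono fun x hx => ?_)
  dsimp only
  rw [hx]
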